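/- Setting. Let $d\ge1$, $\beta\in(0,\infty)$, $\mathbb T^d=(\mathbb R/\mathbb Z)^d$, $\mathbb D=\mathbb T^d\times\mathbb R^d$, $z=(x,v)\in\mathbb D$, $M_\beta(v)=(\frac{\beta}{2\pi})^{d/2}e^{-\frac\beta2|v|^2}$, $\langle G\rangle_{v}=\int_{\mathbb R^d}G(v)M_\beta(v)\,dv$, and let $L^2_\beta$ be the complex $L^2$ space with weight $M_\beta$ (on $\mathbb R^d$) or $M_\beta(v_0)M_\beta(v_1)$ (on $\mathbb D^2$). $H^1_\beta(\mathbb R^d)$ is the space of $g\in L^2_\beta(\mathbb R^d)$ with weak gradient in $L^2_\beta$, normed by $(\|g\|^2+\|\nabla g\|^2)^{1/2}$, and $H^{-1}_\beta(\mathbb R^d)$ is its dual with respect to the scalar product $\int \overline h\,g\,M_\beta$; thus $(\nabla_v-\beta v)\cdot F$, for a vector field $F\in L^2_\beta$, is the element $\phi\mapsto-\int\overline{\nabla\phi}\cdot F\,M_\beta$. Let $V:\mathbb T^d\to\mathbb R$ belong to $W^{1,\infty}(\mathbb T^d)$ with $\widehat V(k)=\int_{\mathbb T^d}V(x)e^{-ik\cdot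 x}dx\ge0$ for all $k\in2\pi\mathbb Z^d$ (in particular $V$ is even). For $N\ge1$ set $$iL_2G=v_0\cdot\nabla_{x_0}G+v_1\cdot\nabla_{x_1}G+\tfrac{N+1-1}{N}\,\beta v_1\cdot\int_{\mathbb D}\nabla V(x_1-x_*)\,G(z_0,z_*)\,M_\beta(v_*)\,dz_*,$$ with domain the $G\in L^2_\beta(\mathbb D^2)$ for which this is (weakly) in $L^2_\beta(\mathbb D^2)$, $$S_1^2g(z_0,z_1)=\nabla V(x_0-x_1)\cdot(\nabla_{v_0}-\beta v_0+\beta v_1)g(v_0),\qquad M_2^1G(z_0)=\tfrac{N-0}{N}\int_{\mathbb D}\nabla V(x_0-x_*)\cdot(\nabla_{v_0}-\beta v_0)G(z_0,z_*)M_\beta(v_*)\,dz_*,$$ the latter being defined by duality. For $\Im\omega>0$ let $$\varepsilon^\circ_{\beta,1}(k,\omega)=1+\tfrac{N+1-1}{N}\,\beta\widehat V(k)\Big\langle\tfrac{k\cdot v}{k\cdot v-\omega}\Big\rangle_v,\qquad \varepsilon^\circ_{\beta,1}(k,s+i0)=\lim_{\eta\downarrow0}\varepsilon^\circ_{\beta,1}(k,s+i\eta),$$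 and for $k\neq0$ let $\langle\delta(k\cdot(v_*-v))\rangle_{v_*}=\frac1{|k|}\int_{\{v_*:\,k\cdot v_*=k\cdot v\}}M_\beta$, the integral being taken with respect to the $(d-1)$-dimensional Lebesgue measure; the terms with $k=0$ in the sums below are zero. Statement. For all $k\in2\pi\mathbb Z^d$, $v\in\mathbb R^d$ and $N\ge1$ the boundary value $\varepsilon^\circ_{\beta,1}(k,k\cdot v+i0)$ exists and is nonzero, and the two series over $k$ below converge absolutely. Let $g^\circ\in H^1_\beta(\mathbb R^d)$. For all $N\ge1$ and $\Im\omega>0$ there is exactly one $H$ in the domain of $L_2$ with $(iL_2-i\omega)H=S_1^2g^\circ$, denoted $(iL_2-i\omega)^{-1}S_1^2g^\circ$, and the following convergence holds in $H^{-1}_\beta(\mathbb R^d)$, uniformly for $N\ge1$: $$\begin{aligned}\lim_{\omega\to0,\ \Im\omega>0}\int_{\mathbb T^d}\big(M_2^1(iL_2-i\omega)^{-1}S_1^2g^\circ\big)(x,v)\,dx =\;&(\nabla_v-\beta v)\cdot\bigg(\sum_{k\in2\pi\mathbb Z^d}(k\otimes k)\frac{\pi\widehat V(k)^2\langle\delta(k\cdot(v_*-v))\rangle_{v_*}}{|\varepsilon^\circ_{\beta,1}(k,k\cdot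 v+i0)|^2}\bigg)\nabla_vg^\circ(v)\\ &+(\nabla_v-\beta v)\cdot\bigg(\sum_{k\in2\pi\mathbb Z^d}\beta\widehat V(k)\,(k\otimes k)\frac{\pi\widehat V(k)^2\langle\delta(k\cdot(v_*-v))\rangle_{v_*}}{|\varepsilon^\circ_{\beta,1}(k,k\cdot v+i0)|^2}\bigg)(\nabla_v-\beta v)g^\circ(v),\end{aligned}$$ where the vector fields under $(\nabla_v-\beta v)\cdot$ on the right-hand side have their sum in $L^2_\beta$. In addition, the argument of the limit can be written as $(\nabla_v-\beta v)\cdot G^\omega_{N,\beta}$ with a vector field $G^\omega_{N,\beta}\in L^2_\beta(\mathbb R^d)$ such that, for almost every $v$, $$|G^\omega_{N,\beta}(v)|\le C\,\big(|g^\circ(v)|^2+|(\nabla_v-\beta v)g^\circ(v)|^2\big)^{1/2},$$ where $C$ depends only on $d$, $\beta$ and an upper bound on $\|V\|_{L^\infty}+\|\nabla V\|_{L^\infty}$; in particular it does not depend on $N\ge1$, on $\omega$ with $\Im\omega>0$, or on $g^\circ$. -/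

import Mathlib

open MeasureTheory Filter Topology
open scoped ENNReal NNReal

noncomputable section

namespace LenardBalescu

/-! ### The phase space -/

/-- Velocities: `ℝ^d` with the Euclidean norm. -/
abbrev Vel (d : ℕ) := EuclideanSpace ℝ (Fin d)

/-- Complex vectors. -/
abbrev CVec (d : ℕ) := EuclideanSpace ℂ (Fin d)

/-- The torus `𝕋^d = (ℝ/ℤ)^d`, whose Fourier variables run over `2π ℤ^d`. -/
abbrev Torus (d : ℕ) := UnitAddTorus (Fin d)

/-- The one-particle phase space `𝔻 = 𝕋^d × ℝ^d`; a point is `z = (x, v)`. -/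
abbrev Phase (d : ℕ) := Torus d × Vel d

/-- The canonical projection `ℝ^d → 𝕋^d`. -/
def toTorus {d : ℕ} (y : Vel d) : Torus d := fun i => ((y i : ℝ) : UnitAddCircle)

/-- A real vector seen as a complex one. -/
def toC {d : ℕ} (w : Vel d) : CVec d := WithLp.toLp 2 (fun i => ((w i : ℝ) : ℂ))

/-- The Lebesgue measure on the torus, of total mass `1`. -/
def torusMeasure (d : ℕ) : Measure (Torus d) :=
  Measure.pi (fun _ : Fin d => (AddCircle.haarAddCircle : Measure UnitAddCircle))

instance (d : ℕ) : IsProbabilityMeasure (torusMeasure d) := by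
  unfold torusMeasure; infer_instance

/-- The Maxwellian `M_β(v) = (β/2π)^{d/2} exp(-β|v|²/2)`. -/
def maxwellDensity {d : ℕ} (β : ℝ) (v : Vel d) : ℝ :=
  (β / (2 * Real.pi)) ^ ((d : ℝ) / 2) * Real.exp (-(β / 2) * ‖v‖ ^ 2)

/-- The measure `M_β(v) dv` on `ℝ^d`. The average `⟨G⟩_v` is the integral against it. -/
def maxwell (d : ℕ) (β : ℝ) : Measure (Vel d) :=
  volume.withDensity (fun v => ENNReal.ofReal (maxwellDensity β v))

instance (d : ℕ) (β : ℝ) : SFinite (maxwell d β) := by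
  unfold maxwell; infer_instance

/-- The measure `M_β(v) dx dv` on `𝔻`. -/
def phaseMeasure (d : ℕ) (β : ℝ) : Measure (Phase d) := (torusMeasure d).prod (maxwell d β)

instance (d : ℕ) (β : ℝ) : SFinite (phaseMeasure d β) := by
  unfold phaseMeasure; infer_instance

/-- The measure `M_β(v₀) M_β(v₁) dz₀ dz₁` on `𝔻²`; a point is `z = (z₀, z₁)`. -/
def phaseMeasure2 (d : ℕ) (β : ℝ) : Measure (Phase d × Phase d) :=
  (phaseMeasure d β).prod (phaseMeasure d β)

/-- The Hilbert space `L²_β(𝔻²)`. -/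
abbrev L2Phase2 (d : ℕ) (β : ℝ) := Lp ℂ 2 (phaseMeasure2 d β)

/-! ### The interaction potential -/

/-- `∂_j η` for a function on the torus. -/
def torusPartial {d : ℕ} (j : Fin d) (η : Torus d → ℝ) (x : Torus d) : ℝ :=
  deriv (fun s : ℝ => η (x + toTorus (EuclideanSpace.single j s))) 0

/-- `W` is the weak gradient of `V` on the torus. -/
def HasTorusWeakGrad {d : ℕ} (V : Torus d → ℝ) (W : Torus d → Vel d) : Prop :=
  ∀ η : Torus d → ℝ, ContDiff ℝ (⊤ : ℕ∞) (fun y : Vel d => η (toTorus y)) → ∀ j : Fin d,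
    ∫ x, V x * torusPartial j η x ∂(torusMeasure d) = - ∫ x, W x j * η x ∂(torusMeasure d)

/-- `V ∈ W^{1,∞}(𝕋^d)` with weak gradient `W` and `‖V‖_{L^∞} + ‖W‖_{L^∞} ≤ K`. -/
structure IsW1Infty {d : ℕ} (V : Torus d → ℝ) (W : Torus d → Vel d) (K : ℝ≥0) : Prop where
  memLp : MemLp V ∞ (torusMeasure d)
  memLp_grad : MemLp W ∞ (torusMeasure d)
  weakGrad : HasTorusWeakGrad V W
  norm_le : eLpNorm V ∞ (torusMeasure d) + eLpNorm W ∞ (torusMeasure d) ≤ K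

/-- The wave vector `k = 2π n`, for `n ∈ ℤ^d`. -/
def waveVec {d : ℕ} (n : Fin d → ℤ) : Vel d :=
  WithLp.toLp 2 (fun i => 2 * Real.pi * (n i : ℝ))

/-- The Fourier coefficient `∫ V(x) exp(-i k·x) dx`, with `k = 2π n`. -/
def fourierV {d : ℕ} (V : Torus d → ℝ) (n : Fin d → ℤ) : ℂ :=
  UnitAddTorus.mFourierCoeff (fun x => ((V x : ℝ) : ℂ)) n

/-- `V` is positive definite: its Fourier coefficients are real and nonnegative. -/
def PosDefPotential {d : ℕ} (V : Torus d → ℝ) : Prop :=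
  ∀ n : Fin d → ℤ, 0 ≤ (fourierV V n).re ∧ (fourierV V n).im = 0

/-- The real number `V̂(k)`, `k = 2π n`, for a positive definite `V`. -/
def Vhat {d : ℕ} (V : Torus d → ℝ) (n : Fin d → ℤ) : ℝ := (fourierV V n).re

/-! ### The Sobolev spaces `H¹_β(ℝ^d)` and `H⁻¹_β(ℝ^d)` -/

/-- `∂_j η` for a function on `ℝ^d`. -/
def velPartial {d : ℕ} (j : Fin d) (η : Vel d → ℝ) (v : Vel d) : ℝ :=
  fderiv ℝ η v (EuclideanSpace.single j 1)

/-- `G` is the weak gradient of `g` on `ℝ^d`. -/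
def HasVelWeakGrad {d : ℕ} (g : Vel d → ℂ) (G : Vel d → CVec d) : Prop :=
  ∀ η : Vel d → ℝ, ContDiff ℝ (⊤ : ℕ∞) η → HasCompactSupport η → ∀ j : Fin d,
    ∫ v, g v * ((velPartial j η v : ℝ) : ℂ) = - ∫ v, G v j * ((η v : ℝ) : ℂ)

lemma maxwellDensity_pos {d : ℕ} {β : ℝ} (hβ : 0 < β) (v : Vel d) : 0 < maxwellDensity β v := by
  unfold maxwellDensity; positivity

lemma maxwellDensity_continuous {d : ℕ} (β : ℝ) :
    Continuous (maxwellDensity β : Vel d → ℝ) := by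
  unfold maxwellDensity; fun_prop

/-- A function in `L²_β(ℝ^d)` is Lebesgue integrable against compactly supported continuous
functions. -/
lemma integrable_mul_test {d : ℕ} {β : ℝ} (hβ : 0 < β) {f : Vel d → ℂ}
    (hf : MemLp f 2 (maxwell d β)) {χ : Vel d → ℝ} (hχ : Continuous χ)
    (hχs : HasCompactSupport χ) : Integrable (fun v => f v * ((χ v : ℝ) : ℂ)) := by
  have hloc : IsLocallyFiniteMeasure (maxwell d β) :=
    IsLocallyFiniteMeasure.withDensity_ofReal (maxwellDensity_continuous β)
  set ψ : Vel d → ℂ := fun v => ((χ v / maxwellDensity β v : ℝ) : ℂ) with hψ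
  have hψc : Continuous ψ :=
    Complex.continuous_ofReal.comp
      (hχ.div (maxwellDensity_continuous β) fun v => (maxwellDensity_pos hβ v).ne')
  have hψs : HasCompactSupport ψ := by
    refine hχs.mono fun v hv => ?_
    simp only [Function.mem_support, hψ] at hv ⊢
    intro h0
    simp [h0] at hv
  have h2 : MemLp ψ 2 (maxwell d β) := hψc.memLp_of_hasCompactSupport hψs
  have hint : Integrable (fun v => f v * ψ v) (maxwell d β) := hf.integrable_mul h2
  unfold maxwell at hint
  rw [integrable_withDensity_iff_integrable_smul'
    (maxwellDensity_continuous β).measurable.ennreal_ofReal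
    (ae_of_all _ fun _ => ENNReal.ofReal_lt_top)] at hint
  refine hint.congr (ae_of_all _ fun v => ?_)
  have hp := maxwellDensity_pos hβ v
  simp only [ENNReal.toReal_ofReal hp.le, hψ, Complex.real_smul]
  have hp' : ((maxwellDensity β v : ℝ) : ℂ) ≠ 0 := by exact_mod_cast hp.ne'
  push_cast
  field_simp

lemma volume_ac_maxwell {d : ℕ} {β : ℝ} (hβ : 0 < β) :
    (volume : Measure (Vel d)) ≪ maxwell d β :=
  withDensity_absolutelyContinuous'
    (maxwellDensity_continuous β).measurable.ennreal_ofReal.aemeasurable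
    (ae_of_all _ fun v => by simpa using maxwellDensity_pos hβ v)

lemma continuous_velPartial {d : ℕ} {η : Vel d → ℝ} (hη : ContDiff ℝ (⊤ : ℕ∞) η) (j : Fin d) :
    Continuous (velPartial j η) := by
  unfold velPartial
  exact (hη.continuous_fderiv (by simp)).clm_apply continuous_const

lemma hasCompactSupport_velPartial {d : ℕ} {η : Vel d → ℝ} (hη : HasCompactSupport η)
    (j : Fin d) : HasCompactSupport (velPartial j η) := by
  unfold velPartial
  exact hη.fderiv_apply (𝕜 := ℝ) (EuclideanSpace.single j 1)

lemma memLp_coord {d : ℕ} {μ : Measure (Vel d)} {G : Vel d → CVec d} (hG : MemLp G 2 μ)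
    (j : Fin d) : MemLp (fun v => G v j) 2 μ :=
  (EuclideanSpace.proj (𝕜 := ℂ) j : CVec d →L[ℂ] ℂ).comp_memLp' hG

/-- `H¹_β(ℝ^d)`, realized as the set of pairs `(g, ∇g) ∈ L²_β × L²_β`, where `∇g` is the weak
gradient of `g`. Its norm is `(‖g‖² + ‖∇g‖²)^{1/2}`, with the norms of `L²_β`. -/
def H1 (d : ℕ) {β : ℝ} (hβ : 0 < β) :
    Submodule ℂ (WithLp 2 (Lp ℂ 2 (maxwell d β) × Lp (CVec d) 2 (maxwell d β))) where
  carrier := {p | HasVelWeakGrad (p.fst : Vel d → ℂ) (p.snd : Vel d → CVec d)}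
  zero_mem' := by
    intro η hη hηs j
    have hac : (volume : Measure (Vel d)) ≪ maxwell d β :=
      volume_ac_maxwell hβ
    have h1 := hac.ae_le (Lp.coeFn_zero ℂ 2 (maxwell d β))
    have h2 := hac.ae_le (Lp.coeFn_zero (CVec d) 2 (maxwell d β))
    rw [integral_eq_zero_of_ae, integral_eq_zero_of_ae, neg_zero]
    · filter_upwards [h2] with v hv
      rw [WithLp.zero_snd, hv]
      simp
    · filter_upwards [h1] with v hv
      rw [WithLp.zero_fst, hv]
      simp
  add_mem' := by
    intro p q hp hq η hη hηs j
    have hac : (volume : Measure (Vel d)) ≪ maxwell d β :=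
      volume_ac_maxwell hβ
    have h1 := hac.ae_le (Lp.coeFn_add p.fst q.fst)
    have h2 := hac.ae_le (Lp.coeFn_add p.snd q.snd)
    have e1 : ∫ v, ((p + q).fst : Vel d → ℂ) v * ((velPartial j η v : ℝ) : ℂ)
        = ∫ v, ((p.fst : Vel d → ℂ) v * ((velPartial j η v : ℝ) : ℂ)
          + (q.fst : Vel d → ℂ) v * ((velPartial j η v : ℝ) : ℂ)) := by
      refine integral_congr_ae ?_
      filter_upwards [h1] with v hv
      rw [WithLp.add_fst, hv, Pi.add_apply, add_mul]
    have e2 : ∫ v, ((p + q).snd : Vel d → CVec d) v j * ((η v : ℝ) : ℂ)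
        = ∫ v, ((p.snd : Vel d → CVec d) v j * ((η v : ℝ) : ℂ)
          + (q.snd : Vel d → CVec d) v j * ((η v : ℝ) : ℂ)) := by
      refine integral_congr_ae ?_
      filter_upwards [h2] with v hv
      rw [WithLp.add_snd, hv, Pi.add_apply, PiLp.add_apply, add_mul]
    rw [e1, e2, integral_add, integral_add, hp η hη hηs j, hq η hη hηs j, neg_add]
    · exact integrable_mul_test hβ (memLp_coord (Lp.memLp _) j) hη.continuous hηs
    · exact integrable_mul_test hβ (memLp_coord (Lp.memLp _) j) hη.continuous hηs
    · exact integrable_mul_test hβ (Lp.memLp _) (continuous_velPartial hη j)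
        (hasCompactSupport_velPartial hηs j)
    · exact integrable_mul_test hβ (Lp.memLp _) (continuous_velPartial hη j)
        (hasCompactSupport_velPartial hηs j)
  smul_mem' := by
    intro c p hp η hη hηs j
    have hac : (volume : Measure (Vel d)) ≪ maxwell d β :=
      volume_ac_maxwell hβ
    have h1 := hac.ae_le (Lp.coeFn_smul c p.fst)
    have h2 := hac.ae_le (Lp.coeFn_smul c p.snd)
    have e1 : ∫ v, ((c • p).fst : Vel d → ℂ) v * ((velPartial j η v : ℝ) : ℂ)
        = ∫ v, c * ((p.fst : Vel d → ℂ) v * ((velPartial j η v : ℝ) : ℂ)) := by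
      refine integral_congr_ae ?_
      filter_upwards [h1] with v hv
      rw [WithLp.smul_fst, hv, Pi.smul_apply, smul_eq_mul, mul_assoc]
    have e2 : ∫ v, ((c • p).snd : Vel d → CVec d) v j * ((η v : ℝ) : ℂ)
        = ∫ v, c * ((p.snd : Vel d → CVec d) v j * ((η v : ℝ) : ℂ)) := by
      refine integral_congr_ae ?_
      filter_upwards [h2] with v hv
      rw [WithLp.smul_snd, hv, Pi.smul_apply, PiLp.smul_apply, smul_eq_mul, mul_assoc]
    rw [e1, e2, integral_const_mul, integral_const_mul, hp η hη hηs j, mul_neg]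

/-- The function underlying an element of `H¹_β(ℝ^d)`. -/
def val {d : ℕ} {β : ℝ} {hβ : 0 < β} (g : H1 d hβ) : Vel d → ℂ :=
  ⇑(WithLp.fst g.val)

/-- The weak gradient `∇g` of an element of `H¹_β(ℝ^d)`. -/
def grad {d : ℕ} {β : ℝ} {hβ : 0 < β} (g : H1 d hβ) : Vel d → CVec d :=
  ⇑(WithLp.snd g.val)

/-- `(∇_v - βv) g`, for `g ∈ H¹_β(ℝ^d)`. -/
def gradStar {d : ℕ} {β : ℝ} {hβ : 0 < β} (g : H1 d hβ) (v : Vel d) : CVec d :=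
  grad g v - ((β : ℂ) * val g v) • toC v

/-- `|⟨∇_v - βv⟩ g| = (|g|² + |(∇_v - βv) g|²)^{1/2}`, for `g ∈ H¹_β(ℝ^d)`. -/
def bracket {d : ℕ} {β : ℝ} {hβ : 0 < β} (g : H1 d hβ) (v : Vel d) : ℝ :=
  Real.sqrt (‖val g v‖ ^ 2 + ‖gradStar g v‖ ^ 2)

/-- `H⁻¹_β(ℝ^d)`: the dual of `H¹_β(ℝ^d)` with respect to the scalar product
`⟨h, g⟩ = ∫ conj(h) g M_β` of `L²_β`, that is, the continuous conjugate-linear functionals on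
`H¹_β(ℝ^d)` with the dual norm. -/
abbrev Hneg1 (d : ℕ) {β : ℝ} (hβ : 0 < β) := H1 d hβ →L⋆[ℂ] ℂ

/-- The pairing of `φ ∈ H¹_β(ℝ^d)` with the distribution `(∇_v - βv) · F`, for a vector field `F`
in `L²_β`. As `-(∇_v - βv)·` is the adjoint of `∇_v` in `L²_β`, it is `-∫ conj(∇φ) · F M_β`. -/
def divPairing {d : ℕ} {β : ℝ} {hβ : 0 < β} (F : Vel d → CVec d) (φ : H1 d hβ) : ℂ :=
  - ∫ v, inner ℂ (grad φ v) (F v) ∂(maxwell d β)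

/-! ### The operators of the hierarchy

Throughout, `W` is the gradient of the potential. -/

/-- Test functions on `𝔻²`. -/
structure IsTest {d : ℕ} (φ : Phase d × Phase d → ℂ) : Prop where
  smooth : ContDiff ℝ (⊤ : ℕ∞) (fun y : (Vel d × Vel d) × (Vel d × Vel d) =>
    φ ((toTorus y.1.1, y.1.2), (toTorus y.2.1, y.2.2)))
  compactSupport : HasCompactSupport φ

/-- `(v₀·∇_{x₀} + v₁·∇_{x₁}) φ`. -/
def transport {d : ℕ} (φ : Phase d × Phase d → ℂ) (z : Phase d × Phase d) : ℂ :=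
  deriv (fun s : ℝ => φ ((z.1.1 + toTorus (s • z.1.2), z.1.2),
    (z.2.1 + toTorus (s • z.2.2), z.2.2))) 0

/-- `β v₁ · ∫_𝔻 ∇V(x₁ - x_*) G(z₀, z_*) M_β(v_*) dz_*`. -/
def meanField {d : ℕ} (β : ℝ) (W : Torus d → Vel d) (G : Phase d × Phase d → ℂ)
    (z : Phase d × Phase d) : ℂ :=
  ∫ zs : Phase d, ((β * inner ℝ z.2.2 (W (z.2.1 - zs.1)) : ℝ) : ℂ) * G (z.1, zs)
    ∂(phaseMeasure d β)

/-- `F = i L₂ G`, where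
`i L₂ G = v₀·∇_{x₀} G + v₁·∇_{x₁} G
  + ((N+1-1)/N) β v₁ · ∫ ∇V(x₁ - x_*) G(z₀, z_*) M_β(v_*) dz_*`
and the transport term is taken in the weak sense. The domain of `L₂` consists of the
`G ∈ L²_β(𝔻²)` for which such an `F` exists in `L²_β(𝔻²)`. -/
def IsIL2 {d : ℕ} {β : ℝ} (N : ℕ) (W : Torus d → Vel d) (G F : L2Phase2 d β) : Prop :=
  ∀ φ : Phase d × Phase d → ℂ, IsTest φ →
    ∫ z, G z * transport φ z ∂(phaseMeasure2 d β) =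
      - ∫ z, (F z - ((((N : ℝ) + 1 - 1) / N : ℝ) : ℂ) * meanField β W G z) * φ z
          ∂(phaseMeasure2 d β)

/-- `H` is in the domain of `L₂` and `(i L₂ - i ω) H = S`. -/
def SolvesResolvent {d : ℕ} {β : ℝ} (N : ℕ) (W : Torus d → Vel d) (ω : ℂ)
    (S : Phase d × Phase d → ℂ) (H : L2Phase2 d β) : Prop :=
  ∃ F : L2Phase2 d β, IsIL2 N W H F ∧
    ⇑(F - (Complex.I * ω) • H) =ᵐ[phaseMeasure2 d β] S

/-- `S₁² g = ∇V(x₀ - x₁) · (∇_{v₀} - β v₀ + β v₁) g(v₀)`. -/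
def S12 {d : ℕ} {β : ℝ} {hβ : 0 < β} (W : Torus d → Vel d) (g : H1 d hβ)
    (z : Phase d × Phase d) : ℂ :=
  inner ℂ (toC (W (z.1.1 - z.2.1)))
    (gradStar g z.1.2 + ((β : ℂ) * val g z.1.2) • toC z.2.2)

/-- The pairing of `φ ∈ H¹_β(ℝ^d)` with the space average `∫_{𝕋^d} (M₂¹ H)(x, ·) dx`, where
`M₂¹ H = ((N-0)/N) ∫_𝔻 ∇V(x₀ - x_*) · (∇_{v₀} - β v₀) H(z₀, z_*) M_β(v_*) dz_*`
is defined by duality: `-(∇_{v₀} - β v₀)` is the adjoint of `∇_{v₀}` in `L²_β`. -/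
def avgM21Pairing {d : ℕ} {β : ℝ} {hβ : 0 < β} (N : ℕ) (W : Torus d → Vel d)
    (H : L2Phase2 d β) (φ : H1 d hβ) : ℂ :=
  - (((((N : ℝ) - 0) / N : ℝ) : ℂ) *
    ∫ z, inner ℂ (grad φ z.1.2) (H z • toC (W (z.1.1 - z.2.1))) ∂(phaseMeasure2 d β))

/-! ### The dispersion function and the limit -/

/-- `ε°_{β,m}(k, ω) = 1 + ((N+1-m)/N) β V̂(k) ⟨k·v / (k·v - ω)⟩_v`, with `k = 2π n`. -/
def eps {d : ℕ} (β : ℝ) (V : Torus d → ℝ) (N m : ℕ) (n : Fin d → ℤ) (ω : ℂ) : ℂ :=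
  1 + ((((N : ℝ) + 1 - m) / N * β * Vhat V n : ℝ) : ℂ) *
    ∫ v, ((inner ℝ (waveVec n) v : ℝ) : ℂ) / (((inner ℝ (waveVec n) v : ℝ) : ℂ) - ω)
      ∂(maxwell d β)

/-- The boundary value `ε°_{β,m}(k, s + i0)`, for real `s`. -/
def epsPlus {d : ℕ} (β : ℝ) (V : Torus d → ℝ) (N m : ℕ) (n : Fin d → ℤ) (s : ℝ) : ℂ :=
  limUnder (𝓝[>] (0 : ℝ)) (fun η : ℝ => eps β V N m n ((s : ℂ) + (η : ℂ) * Complex.I))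

/-- `⟨δ(k·(v_* - v))⟩_{v_*}` for `k ≠ 0`: the integral of `M_β / |k|` over the hyperplane
`{v_* : k·v_* = k·v}`, whose points are `(k·v/|k|²) k + u` with `u ⊥ k`, with respect to its
`(d-1)`-dimensional Lebesgue measure. -/
def deltaAvg {d : ℕ} (β : ℝ) (k v : Vel d) : ℝ :=
  (∫ u : ((Submodule.span ℝ {k})ᗮ : Submodule ℝ (Vel d)),
    maxwellDensity β ((inner ℝ k v / ‖k‖ ^ 2) • k + (u : Vel d))
      ∂((stdOrthonormalBasis ℝ ((Submodule.span ℝ {k})ᗮ : Submodule ℝ (Vel d))).toBasis.addHaar))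
    / ‖k‖

/-- `π V̂(k)² ⟨δ(k·(v_* - v))⟩_{v_*} / |ε°_{β,1}(k, k·v + i0)|²`, with `k = 2π n`. -/
def kernelCoef {d : ℕ} (β : ℝ) (V : Torus d → ℝ) (N : ℕ) (v : Vel d) (n : Fin d → ℤ) : ℝ :=
  Real.pi * Vhat V n ^ 2 * deltaAvg β (waveVec n) v /
    ‖epsPlus β V N 1 n (inner ℝ (waveVec n) v)‖ ^ 2

/-- `∑_k a_k (k ⊗ k) π V̂(k)² ⟨δ(k·(v_* - v))⟩_{v_*} / |ε°_{β,1}(k, k·v + i0)|²`. -/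
def kernelSum {d : ℕ} (β : ℝ) (V : Torus d → ℝ) (N : ℕ) (a : (Fin d → ℤ) → ℝ) (v : Vel d) :
    Matrix (Fin d) (Fin d) ℝ :=
  ∑' n : Fin d → ℤ,
    (a n * kernelCoef β V N v n) • Matrix.vecMulVec (waveVec n).ofLp (waveVec n).ofLp

/-- A real matrix applied to a complex vector. -/
def applyMat {d : ℕ} (A : Matrix (Fin d) (Fin d) ℝ) (w : CVec d) : CVec d :=
  WithLp.toLp 2 ((A.map (fun t : ℝ => (t : ℂ))).mulVec w.ofLp)

/-- The vector field whose image under `(∇_v - βv)·` is the limit. -/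
def limitFlux {d : ℕ} {β : ℝ} {hβ : 0 < β} (V : Torus d → ℝ) (N : ℕ) (g : H1 d hβ)
    (v : Vel d) : CVec d :=
  applyMat (kernelSum β V N (fun _ => 1) v) (grad g v) +
    applyMat (kernelSum β V N (fun n => β * Vhat V n) v) (gradStar g v)

end LenardBalescu

end

open LenardBalescu

/-! The resolvent equation can be solved explicitly, and the solution stays regular up to the real
axis.

The source depends on the positions only through x₀ - x₁, so a Fourier series in the relative
position leaves one equation per k. In it v₀ is a parameter, and the mean-field term sees only the
density ρ_k(v₀), the M_β-average of the mode over v₁. Dividing by ω - k·v₀ + k·v₁ and averaging over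
v₁ gives a scalar linear equation for ρ_k, whose coefficient is the dispersion function 1 + βV̂(k) Z
at (ω - k·v₀)/|k|. The space average of M₂¹ needs no more than these densities: mode k adds -iV̂(k)
ρ_k k to the flux. As ρ_k carries a further factor V̂(k), the terms are bounded by a multiple of
|k|² V̂(k)², and Parseval for ∇V sums this to at most K². These steps are `resolventMode_equation`,
`integral_resolventMode`, `avgM21Pairing_resolventSol` and `exists_norm_flux_le`.

Uniformity in ω comes from the special functions F(z) = ∫_0^∞ exp(izt - t²/2β) dt and Z = 1 + izF.
On the closed upper half-plane both are continuous and bounded, and zZ is bounded. For c ≥ 0 the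
function 1 + cZ has no zero there. Inside, Im(zZ) ≥ 0, so z + czZ has positive imaginary part. On
the axis, Im Z(a) = a Re F(a) with Re F(a) > 0, and Z(0) = 1. Compactness turns this into a lower
bound uniform in 0 ≤ c ≤ βK (`exists_lower_bound_dispersion`). Hence dominated convergence applies,
in the sum over k and then in L²_β, and L²_β convergence of the fluxes gives H⁻¹_β convergence of
their divergences.

At ω = 0 the modes k and -k involve complex conjugate values of F and Z. In their sum all products
cancel except those with Re F/|ε|², and Re F/|k| is exactly π⟨δ(k·(v_* - v))⟩ (`add_conj_div_eq`,
`pi_mul_deltaAvg`, `limitFlux_eq_flux`).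

For uniqueness, all double Fourier coefficients of a homogeneous solution satisfy the same kind of
scalar equation, so they vanish because the dispersion function does not (`ae_coeff2_eq_zero`). Two
side points: (∇ - βv)g lies in L²_β because functions in H¹_β have a second moment
(`memLp_coord_mul_val`), and the prefactors (N+1-1)/N and (N-0)/N equal 1, so nothing depends on N.
-/

noncomputable section

namespace LenardBalescu

/-! ### The plasma dispersion function -/

/-- The Gaussian weighted by `exp (i z t)`. -/
def gaussExp (β : ℝ) (z : ℂ) (t : ℝ) : ℂ :=
  Complex.exp (Complex.I * z * t - (t : ℂ) ^ 2 / (2 * β))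

/-- The Laplace transform of a Gaussian, `∫_0^∞ exp (i z t) exp (-t² / 2β) dt`. -/
def gaussLaplace (β : ℝ) (z : ℂ) : ℂ := ∫ t in Set.Ioi (0 : ℝ), gaussExp β z t

/-- The plasma dispersion function `Z`, normalized so that `Z 0 = 1`. -/
def plasmaZ (β : ℝ) (z : ℂ) : ℂ := 1 + Complex.I * z * gaussLaplace β z

lemma norm_gaussExp (β : ℝ) (z : ℂ) (t : ℝ) :
    ‖gaussExp β z t‖ = Real.exp (-(z.im * t) - t ^ 2 / (2 * β)) := by
  rw [gaussExp, Complex.norm_exp]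
  congr 1
  have : ((t : ℂ) ^ 2 / (2 * β)) = ((t ^ 2 / (2 * β) : ℝ) : ℂ) := by push_cast; ring
  rw [this, Complex.sub_re, Complex.ofReal_re]
  simp

lemma norm_gaussExp_le {β : ℝ} {z : ℂ} (hz : 0 ≤ z.im) {t : ℝ} (ht : 0 ≤ t) :
    ‖gaussExp β z t‖ ≤ Real.exp (-(1 / (2 * β)) * t ^ 2) := by
  rw [norm_gaussExp]
  apply Real.exp_le_exp.2
  have := mul_nonneg hz ht
  have e : t ^ 2 / (2 * β) = 1 / (2 * β) * t ^ 2 := by ring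
  rw [e]; linarith

lemma continuous_gaussExp (β : ℝ) (z : ℂ) : Continuous (gaussExp β z) := by
  unfold gaussExp; fun_prop

lemma hasDerivAt_gaussExp (β : ℝ) (z : ℂ) (t : ℝ) :
    HasDerivAt (gaussExp β z) ((Complex.I * z - t / β) * gaussExp β z t) t := by
  have h0 : HasDerivAt (fun s : ℝ => (s : ℂ)) 1 t := Complex.ofRealCLM.hasDerivAt
  have h := (((h0.const_mul (Complex.I * z)).sub ((h0.pow 2).div_const (2 * (β : ℂ))))).cexp
  convert! h using 1
  simp only [gaussExp, Pi.sub_apply, Pi.pow_apply]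
  rw [mul_comm]
  congr 1
  by_cases hb : (β : ℂ) = 0
  · simp [hb]
  · field_simp; push_cast; ring

lemma integrable_pow_mul_exp {β : ℝ} (hβ : 0 < β) (m : ℕ) :
    Integrable (fun t : ℝ => t ^ m * Real.exp (-(1 / (2 * β)) * t ^ 2)) := by
  have := integrable_rpow_mul_exp_neg_mul_sq (b := 1 / (2 * β)) (by positivity) (s := m)
    (by have : (0 : ℝ) ≤ m := Nat.cast_nonneg m
        linarith)
  simpa [Real.rpow_natCast] using this

lemma integrableOn_pow_mul_gaussExp {β : ℝ} (hβ : 0 < β) {z : ℂ} (hz : 0 ≤ z.im) (m : ℕ) :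
    IntegrableOn (fun t : ℝ => (t : ℂ) ^ m * gaussExp β z t) (Set.Ioi 0) := by
  refine Integrable.mono' (integrable_pow_mul_exp hβ m).integrableOn ?_ ?_
  · exact (((Complex.continuous_ofReal.pow m).mul (continuous_gaussExp β z))).aestronglyMeasurable
  · refine (ae_restrict_iff' measurableSet_Ioi).2 (ae_of_all _ fun t ht => ?_)
    have ht' : (0 : ℝ) ≤ t := le_of_lt ht
    rw [norm_mul, norm_pow, Complex.norm_real, Real.norm_of_nonneg ht']
    exact mul_le_mul_of_nonneg_left (norm_gaussExp_le hz ht') (by positivity)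

lemma norm_integral_pow_mul_gaussExp_le {β : ℝ} (hβ : 0 < β) {z : ℂ} (hz : 0 ≤ z.im) (m : ℕ) :
    ‖∫ t in Set.Ioi (0 : ℝ), (t : ℂ) ^ m * gaussExp β z t‖ ≤
      ∫ t in Set.Ioi (0 : ℝ), t ^ m * Real.exp (-(1 / (2 * β)) * t ^ 2) := by
  refine norm_integral_le_of_norm_le (integrable_pow_mul_exp hβ m).integrableOn ?_
  refine (ae_restrict_iff' measurableSet_Ioi).2 (ae_of_all _ fun t ht => ?_)
  have ht' : (0 : ℝ) ≤ t := le_of_lt ht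
  rw [norm_mul, norm_pow, Complex.norm_real, Real.norm_of_nonneg ht']
  exact mul_le_mul_of_nonneg_left (norm_gaussExp_le hz ht') (by positivity)

/-- The moment `∫_0^∞ t^m exp (-t² / 2β) dt`. -/
def gaussMoment (β : ℝ) (m : ℕ) : ℝ :=
  ∫ t in Set.Ioi (0 : ℝ), t ^ m * Real.exp (-(1 / (2 * β)) * t ^ 2)

lemma gaussMoment_nonneg (β : ℝ) (m : ℕ) : 0 ≤ gaussMoment β m :=
  setIntegral_nonneg measurableSet_Ioi fun t ht => by
    have ht' : (0 : ℝ) ≤ t := le_of_lt ht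
    positivity

lemma norm_gaussLaplace_le {β : ℝ} (hβ : 0 < β) {z : ℂ} (hz : 0 ≤ z.im) :
    ‖gaussLaplace β z‖ ≤ gaussMoment β 0 := by
  simpa [gaussLaplace, gaussMoment] using norm_integral_pow_mul_gaussExp_le hβ hz 0

lemma continuousOn_gaussLaplace {β : ℝ} (hβ : 0 < β) :
    ContinuousOn (gaussLaplace β) {z : ℂ | 0 ≤ z.im} := by
  unfold gaussLaplace
  refine continuousOn_of_dominated (bound := fun t => Real.exp (-(1 / (2 * β)) * t ^ 2)) ?_ ?_ ?_ ?_
  · exact fun z _ => (continuous_gaussExp β z).aestronglyMeasurable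
  · exact fun z hz => (ae_restrict_iff' measurableSet_Ioi).2
      (ae_of_all _ fun t ht => norm_gaussExp_le hz (le_of_lt ht))
  · have := (integrable_pow_mul_exp hβ 0).integrableOn (s := Set.Ioi 0)
    simp only [pow_zero, one_mul] at this
    exact this
  · refine ae_of_all _ fun t => Continuous.continuousOn ?_
    unfold gaussExp; fun_prop

/-- The derivative (iz - t/β) exp(izt - t²/2β) of the kernel integrates to -1 over (0,∞). The
first-moment form shows that Z is bounded on the closed half-plane, which 1 + izF does not. -/
lemma plasmaZ_eq_integral {β : ℝ} (hβ : 0 < β) {z : ℂ} (hz : 0 ≤ z.im) :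
    plasmaZ β z = (1 / β) * ∫ t in Set.Ioi (0 : ℝ), (t : ℂ) ^ 1 * gaussExp β z t := by
  have i0 := integrableOn_pow_mul_gaussExp hβ hz 0
  have i1 := integrableOn_pow_mul_gaussExp hβ hz 1
  simp only [pow_zero, one_mul] at i0
  have hd : IntegrableOn (fun t : ℝ => (Complex.I * z - t / β) * gaussExp β z t) (Set.Ioi 0) := by
    refine ((i0.const_mul (Complex.I * z)).sub (i1.const_mul (1 / (β : ℂ)))).congr
      (ae_of_all _ fun t => ?_)
    simp only [Pi.sub_apply]; ring
  have h := integral_Ioi_of_hasDerivAt_of_tendsto' (fun t _ => hasDerivAt_gaussExp β z t) hd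
    (tendsto_zero_of_hasDerivAt_of_integrableOn_Ioi (fun t _ => hasDerivAt_gaussExp β z t) hd i0)
  have e0 : gaussExp β z 0 = 1 := by simp [gaussExp]
  rw [e0] at h
  have e : ∫ t in Set.Ioi (0 : ℝ), (Complex.I * z - t / β) * gaussExp β z t =
      Complex.I * z * gaussLaplace β z -
        (1 / β) * ∫ t in Set.Ioi (0 : ℝ), (t : ℂ) ^ 1 * gaussExp β z t := by
    rw [gaussLaplace, ← integral_const_mul, ← integral_const_mul, ← integral_sub
      (i0.const_mul (Complex.I * z)) (i1.const_mul (1 / (β : ℂ)))]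
    refine integral_congr_ae (ae_of_all _ fun t => ?_)
    ring
  rw [e] at h
  rw [plasmaZ]
  linear_combination h

lemma norm_plasmaZ_le {β : ℝ} (hβ : 0 < β) {z : ℂ} (hz : 0 ≤ z.im) :
    ‖plasmaZ β z‖ ≤ β⁻¹ * gaussMoment β 1 := by
  rw [plasmaZ_eq_integral hβ hz, norm_mul]
  have : ‖(1 / β : ℂ)‖ = β⁻¹ := by simp [abs_of_pos hβ]
  rw [this]
  exact mul_le_mul_of_nonneg_left (norm_integral_pow_mul_gaussExp_le hβ hz 1) (by positivity)

/-- A second integration by parts, on t times the kernel, trades the factor z for the moments of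
order 2 and 0. The resulting decay of Z confines the search for small values of 1 + cZ to a compact
set. -/
lemma norm_mul_norm_plasmaZ_le {β : ℝ} (hβ : 0 < β) {z : ℂ} (hz : 0 ≤ z.im) :
    ‖z‖ * ‖plasmaZ β z‖ ≤ β⁻¹ * (β⁻¹ * gaussMoment β 2 + gaussMoment β 0) := by
  have i0 := integrableOn_pow_mul_gaussExp hβ hz 0
  have i1 := integrableOn_pow_mul_gaussExp hβ hz 1
  have i2 := integrableOn_pow_mul_gaussExp hβ hz 2
  have hder : ∀ t : ℝ, HasDerivAt (fun t : ℝ => (t : ℂ) ^ 1 * gaussExp β z t)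
      (gaussExp β z t + (t : ℂ) * ((Complex.I * z - t / β) * gaussExp β z t)) t := by
    intro t
    have h0 : HasDerivAt (fun s : ℝ => (s : ℂ)) 1 t := Complex.ofRealCLM.hasDerivAt
    have := h0.mul (hasDerivAt_gaussExp β z t)
    rw [one_mul] at this
    simp only [pow_one]
    exact this
  have hd : IntegrableOn (fun t : ℝ => gaussExp β z t +
      (t : ℂ) * ((Complex.I * z - t / β) * gaussExp β z t)) (Set.Ioi 0) := by
    refine ((i0.add (i1.const_mul (Complex.I * z))).sub (i2.const_mul (1 / (β : ℂ)))).congr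
      (ae_of_all _ fun t => ?_)
    simp only [Pi.sub_apply, Pi.add_apply]; ring
  have h := integral_Ioi_of_hasDerivAt_of_tendsto' (fun t _ => hder t) hd
    (tendsto_zero_of_hasDerivAt_of_integrableOn_Ioi (fun t _ => hder t) hd i1)
  have e : ∫ t in Set.Ioi (0 : ℝ), (gaussExp β z t +
      (t : ℂ) * ((Complex.I * z - t / β) * gaussExp β z t)) =
      (∫ t in Set.Ioi (0 : ℝ), (t : ℂ) ^ 0 * gaussExp β z t) +
      Complex.I * z * (∫ t in Set.Ioi (0 : ℝ), (t : ℂ) ^ 1 * gaussExp β z t) -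
        (1 / β) * ∫ t in Set.Ioi (0 : ℝ), (t : ℂ) ^ 2 * gaussExp β z t := by
    rw [← integral_const_mul, ← integral_const_mul,
      ← integral_add i0 (i1.const_mul (Complex.I * z))]
    refine (integral_congr_ae (ae_of_all _ fun t => ?_)).trans (integral_sub
      (i0.add (i1.const_mul (Complex.I * z))) (i2.const_mul (1 / (β : ℂ))))
    ring
  rw [e] at h
  have hb : (β : ℂ) ≠ 0 := by exact_mod_cast hβ.ne'
  have key : Complex.I * z * plasmaZ β z =
      (1 / β) * ((1 / β) * (∫ t in Set.Ioi (0 : ℝ), (t : ℂ) ^ 2 * gaussExp β z t) -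
        ∫ t in Set.Ioi (0 : ℝ), (t : ℂ) ^ 0 * gaussExp β z t) := by
    rw [plasmaZ_eq_integral hβ hz]
    simp only [Complex.ofReal_zero, pow_one, zero_mul, sub_zero] at h ⊢
    linear_combination (1 / (β : ℂ)) * h
  have hn : ‖z‖ * ‖plasmaZ β z‖ = ‖Complex.I * z * plasmaZ β z‖ := by simp
  have hb1 : ‖(1 / β : ℂ)‖ = β⁻¹ := by simp [abs_of_pos hβ]
  rw [hn, key, norm_mul, hb1]
  refine mul_le_mul_of_nonneg_left ((norm_sub_le _ _).trans (add_le_add ?_ ?_)) (by positivity)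
  · rw [norm_mul, hb1]
    exact mul_le_mul_of_nonneg_left (norm_integral_pow_mul_gaussExp_le hβ hz 2) (by positivity)
  · exact norm_integral_pow_mul_gaussExp_le hβ hz 0

lemma continuousOn_plasmaZ {β : ℝ} (hβ : 0 < β) :
    ContinuousOn (plasmaZ β) {z : ℂ | 0 ≤ z.im} := by
  unfold plasmaZ
  have := continuousOn_gaussLaplace hβ
  fun_prop

/-- On the real axis this reads F(-a) = conj F(a), the relation between the modes k and -k at zero
frequency. -/
lemma gaussLaplace_neg_conj (β : ℝ) (z : ℂ) :
    gaussLaplace β (-(starRingEnd ℂ z)) = starRingEnd ℂ (gaussLaplace β z) := by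
  unfold gaussLaplace
  rw [← integral_conj]
  refine integral_congr_ae (ae_of_all _ fun t => ?_)
  simp only [gaussExp, ← Complex.exp_conj]
  congr 1
  simp [Complex.conj_ofNat]

lemma plasmaZ_neg_conj (β : ℝ) (z : ℂ) :
    plasmaZ β (-(starRingEnd ℂ z)) = starRingEnd ℂ (plasmaZ β z) := by
  simp [plasmaZ, gaussLaplace_neg_conj]

lemma gaussLaplace_neg_ofReal (β a : ℝ) :
    gaussLaplace β (-(a : ℂ)) = starRingEnd ℂ (gaussLaplace β a) := by
  simpa using gaussLaplace_neg_conj β a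

lemma plasmaZ_neg_ofReal (β a : ℝ) :
    plasmaZ β (-(a : ℂ)) = starRingEnd ℂ (plasmaZ β a) := by
  simpa using plasmaZ_neg_conj β a

/-- F(a) + F(-a) = 2 Re F(a) is the integral over the whole line, hence a Gaussian Fourier
transform. This plays the role of the Plemelj formula: the Dirac mass of the limit comes from this
real part. -/
lemma re_gaussLaplace_ofReal {β : ℝ} (hβ : 0 < β) (a : ℝ) :
    (gaussLaplace β a).re = Real.sqrt (Real.pi * β / 2) * Real.exp (-(β * a ^ 2 / 2)) := by
  have hz : 0 ≤ (a : ℂ).im := by simp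
  have i0 : IntegrableOn (gaussExp β a) (Set.Ioi 0) := by
    simpa using integrableOn_pow_mul_gaussExp hβ hz 0
  have hint : Integrable (gaussExp β a) := by
    refine Integrable.mono' (by simpa using integrable_pow_mul_exp hβ 0)
      (continuous_gaussExp β a).aestronglyMeasurable (ae_of_all _ fun t => ?_)
    rw [norm_gaussExp]
    apply le_of_eq; simp; ring
  have h1 : ∫ t, gaussExp β a t = gaussLaplace β (-(a : ℂ)) + gaussLaplace β a := by
    rw [← intervalIntegral.integral_Iic_add_Ioi (b := 0) hint.integrableOn hint.integrableOn,
      gaussLaplace, gaussLaplace]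
    congr 1
    have := integral_comp_neg_Ioi (0 : ℝ) (gaussExp β a)
    rw [neg_zero] at this
    rw [← this]
    refine integral_congr_ae (ae_of_all _ fun t => ?_)
    simp [gaussExp]
  have h2 := fourierIntegral_gaussian (b := ((1 / (2 * β) : ℝ) : ℂ))
    (by rw [Complex.ofReal_re]; positivity) a
  have h3 : ∫ t : ℝ, Complex.exp (Complex.I * a * t) *
      Complex.exp (-((1 / (2 * β) : ℝ) : ℂ) * (t : ℂ) ^ 2) = ∫ t, gaussExp β a t := by
    refine integral_congr_ae (ae_of_all _ fun t => ?_)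
    simp only [gaussExp, ← Complex.exp_add]
    congr 1
    push_cast; ring
  rw [h3, h1, gaussLaplace_neg_ofReal, add_comm, Complex.add_conj] at h2
  have e1 : ((Real.pi : ℂ) / ((1 / (2 * β) : ℝ) : ℂ)) ^ (1 / 2 : ℂ) =
      ((2 * Real.sqrt (Real.pi * β / 2) : ℝ) : ℂ) := by
    have : ((Real.pi : ℂ) / ((1 / (2 * β) : ℝ) : ℂ)) = ((2 ^ 2 * (Real.pi * β / 2) : ℝ) : ℂ) := by
      have hb : (β : ℂ) ≠ 0 := by exact_mod_cast hβ.ne'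
      push_cast; field_simp
    rw [this, show (1 / 2 : ℂ) = ((1 / 2 : ℝ) : ℂ) by push_cast; ring,
      ← Complex.ofReal_cpow (by positivity), ← Real.sqrt_eq_rpow,
      Real.sqrt_mul (by positivity), Real.sqrt_sq (by norm_num)]
  have e2 : Complex.exp (-(a : ℂ) ^ 2 / (4 * ((1 / (2 * β) : ℝ) : ℂ))) =
      ((Real.exp (-(β * a ^ 2 / 2)) : ℝ) : ℂ) := by
    rw [Complex.ofReal_exp]
    congr 1
    have hb : (β : ℂ) ≠ 0 := by exact_mod_cast hβ.ne'
    push_cast; field_simp; norm_num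
  rw [e1, e2] at h2
  have h4 : 2 * (gaussLaplace β a).re =
      2 * Real.sqrt (Real.pi * β / 2) * Real.exp (-(β * a ^ 2 / 2)) := by exact_mod_cast h2
  linarith

lemma im_plasmaZ_ofReal (β a : ℝ) : (plasmaZ β a).im = a * (gaussLaplace β a).re := by
  simp [plasmaZ]

lemma plasmaZ_zero (β : ℝ) : plasmaZ β 0 = 1 := by simp [plasmaZ]

/-- The imaginary part c a Re F(a) vanishes only for c = 0 or a = 0, since Re F is a positive
Gaussian; the value is then 1 or 1 + c. -/
lemma one_add_mul_plasmaZ_ofReal_ne_zero {β : ℝ} (hβ : 0 < β) {c : ℝ} (hc : 0 ≤ c) (a : ℝ) :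
    1 + (c : ℂ) * plasmaZ β a ≠ 0 := by
  intro h
  have him : c * (plasmaZ β a).im = 0 := by simpa using congrArg Complex.im h
  have hre : 1 + c * (plasmaZ β a).re = 0 := by simpa using congrArg Complex.re h
  rcases eq_or_ne c 0 with rfl | hc0
  · simp at hre
  · have h1 : (plasmaZ β a).im = 0 := by simpa [hc0] using him
    rw [im_plasmaZ_ofReal, re_gaussLaplace_ofReal hβ] at h1
    have hp : 0 < Real.sqrt (Real.pi * β / 2) * Real.exp (-(β * a ^ 2 / 2)) := by positivity
    have ha : a = 0 := by
      rcases mul_eq_zero.1 h1 with h | h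
      · exact h
      · exact absurd h hp.ne'
    subst ha
    simp [plasmaZ_zero] at hre
    linarith

/-- A lower bound for the dispersion function, given its positivity in the open half-plane. -/
lemma exists_lower_bound_one_add_mul_plasmaZ {β : ℝ} (hβ : 0 < β)
    (hpos : ∀ z : ℂ, 0 < z.im → 0 ≤ (z * plasmaZ β z).im) (c₁ : ℝ) :
    ∃ δ : ℝ, 0 < δ ∧ ∀ c : ℝ, 0 ≤ c → c ≤ c₁ → ∀ z : ℂ, 0 ≤ z.im →
      δ ≤ ‖1 + (c : ℂ) * plasmaZ β z‖ := by
  have hne : ∀ c : ℝ, 0 ≤ c → ∀ z : ℂ, 0 ≤ z.im → 1 + (c : ℂ) * plasmaZ β z ≠ 0 := by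
    intro c hc z hz
    rcases hz.eq_or_lt with h0 | h0
    · have : z = (z.re : ℂ) := by apply Complex.ext <;> simp [← h0]
      rw [this]
      exact one_add_mul_plasmaZ_ofReal_ne_zero hβ hc _
    · intro h
      -- After multiplication by z the imaginary part is Im z + c Im(zZ), which is strictly
      -- positive.
      have h1 : z + (c : ℂ) * (z * plasmaZ β z) = 0 := by linear_combination z * h
      have h2 : z.im + c * (z * plasmaZ β z).im = 0 := by
        have := congrArg Complex.im h1
        rwa [Complex.add_im, Complex.im_ofReal_mul, Complex.zero_im] at this
      have := mul_nonneg hc (hpos z h0)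
      linarith
  set D : ℝ := β⁻¹ * (β⁻¹ * gaussMoment β 2 + gaussMoment β 0) with hD
  have hD0 : 0 ≤ D := by
    have := gaussMoment_nonneg β 2
    have := gaussMoment_nonneg β 0
    positivity
  set R : ℝ := 2 * (|c₁| * D) + 1 with hR
  have hR0 : 0 < R := by positivity
  have hfar : ∀ c : ℝ, 0 ≤ c → c ≤ c₁ → ∀ z : ℂ, 0 ≤ z.im → R ≤ ‖z‖ →
      1 / 2 ≤ ‖1 + (c : ℂ) * plasmaZ β z‖ := by
    intro c hc hc1 z hz hRz
    have h1 := norm_mul_norm_plasmaZ_le hβ hz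
    have hz0 : 0 < ‖z‖ := hR0.trans_le hRz
    have h2 : c * ‖plasmaZ β z‖ ≤ 1 / 2 := by
      have h3 : c * (‖z‖ * ‖plasmaZ β z‖) ≤ |c₁| * D :=
        mul_le_mul (hc1.trans (le_abs_self _)) h1 (by positivity) (abs_nonneg _)
      have h4 : ‖z‖ * (c * ‖plasmaZ β z‖) ≤ ‖z‖ * (1 / 2) := by nlinarith
      exact le_of_mul_le_mul_left h4 hz0
    have h5 : ‖(1 : ℂ)‖ ≤ ‖1 + (c : ℂ) * plasmaZ β z‖ + ‖(c : ℂ) * plasmaZ β z‖ := by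
      simpa using norm_sub_le (1 + (c : ℂ) * plasmaZ β z) ((c : ℂ) * plasmaZ β z)
    rw [norm_one, norm_mul, Complex.norm_real, Real.norm_of_nonneg hc] at h5
    linarith
  have hcomp : IsCompact (Set.Icc (0 : ℝ) c₁ ×ˢ (Metric.closedBall (0 : ℂ) R ∩ {z | 0 ≤ z.im})) :=
    isCompact_Icc.prod ((isCompact_closedBall _ _).inter_right
      (isClosed_le continuous_const Complex.continuous_im))
  have hcont : ContinuousOn (fun p : ℝ × ℂ => ‖1 + (p.1 : ℂ) * plasmaZ β p.2‖)
      (Set.Icc (0 : ℝ) c₁ ×ˢ (Metric.closedBall (0 : ℂ) R ∩ {z | 0 ≤ z.im})) := by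
    have h1 : ContinuousOn (fun p : ℝ × ℂ => plasmaZ β p.2)
        (Set.Icc (0 : ℝ) c₁ ×ˢ (Metric.closedBall (0 : ℂ) R ∩ {z | 0 ≤ z.im})) :=
      (continuousOn_plasmaZ hβ).comp continuousOn_snd fun p hp => hp.2.2
    fun_prop
  rcases (Set.Icc (0 : ℝ) c₁).eq_empty_or_nonempty with he | hne'
  -- For c₁ < 0 no c is admissible, and any δ works.
  · refine ⟨1, one_pos, fun c hc hc1 => ?_⟩
    exact absurd (Set.mem_Icc.2 ⟨hc, hc1⟩) (by simp [he])
  · obtain ⟨c0, hc0⟩ := hne'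
    obtain ⟨p, hp, hmin⟩ := hcomp.exists_isMinOn ⟨(c0, 0), hc0, by simp [hR0.le], by simp⟩ hcont
    refine ⟨min (1 / 2) ‖1 + (p.1 : ℂ) * plasmaZ β p.2‖, lt_min (by norm_num)
      (norm_pos_iff.2 (hne _ hp.1.1 _ hp.2.2)), fun c hc hc1 z hz => ?_⟩
    rcases le_total R ‖z‖ with h | h
    · exact (min_le_left _ _).trans (hfar c hc hc1 z hz h)
    · exact (min_le_right _ _).trans (hmin (a := (c, z)) ⟨⟨hc, hc1⟩, by simpa using h, hz⟩)

end LenardBalescu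
end

noncomputable section

namespace LenardBalescu

/-! ### The Maxwellian measure -/

lemma maxwell_ac_volume (d : ℕ) (β : ℝ) : maxwell d β ≪ (volume : Measure (Vel d)) :=
  withDensity_absolutelyContinuous _ _

lemma integral_maxwell {d : ℕ} {β : ℝ} (hβ : 0 < β) {E : Type*} [NormedAddCommGroup E]
    [NormedSpace ℝ E] (f : Vel d → E) :
    ∫ v, f v ∂(maxwell d β) = ∫ v, maxwellDensity β v • f v := by
  unfold maxwell
  rw [integral_withDensity_eq_integral_toReal_smul
    (maxwellDensity_continuous β).measurable.ennreal_ofReal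
    (ae_of_all _ fun _ => ENNReal.ofReal_lt_top)]
  refine integral_congr_ae (ae_of_all _ fun v => ?_)
  simp only [ENNReal.toReal_ofReal (maxwellDensity_pos hβ v).le]

lemma integrable_maxwell_iff {d : ℕ} {β : ℝ} (hβ : 0 < β) {E : Type*} [NormedAddCommGroup E]
    [NormedSpace ℝ E] {f : Vel d → E} :
    Integrable f (maxwell d β) ↔ Integrable (fun v => maxwellDensity β v • f v) := by
  unfold maxwell
  rw [integrable_withDensity_iff_integrable_smul'
    (maxwellDensity_continuous β).measurable.ennreal_ofReal
    (ae_of_all _ fun _ => ENNReal.ofReal_lt_top)]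
  refine integrable_congr (ae_of_all _ fun v => ?_)
  simp only [ENNReal.toReal_ofReal (maxwellDensity_pos hβ v).le]

lemma integral_cexp_inner_maxwell {d : ℕ} {β : ℝ} (hβ : 0 < β) (k : Vel d) (t : ℝ) :
    ∫ v, Complex.exp (Complex.I * t * (inner ℝ k v : ℝ)) ∂(maxwell d β) =
      Complex.exp (-((t : ℂ) ^ 2 * (‖k‖ : ℂ) ^ 2 / (2 * β))) := by
  rw [integral_maxwell hβ]
  have hb : (β : ℂ) ≠ 0 := by exact_mod_cast hβ.ne'
  have h := GaussianFourier.integral_cexp_neg_mul_sq_norm_add (b := ((β / 2 : ℝ) : ℂ))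
    (by rw [Complex.ofReal_re]; positivity) (Complex.I * t) k
  have e : ∀ v : Vel d, maxwellDensity β v •
      Complex.exp (Complex.I * t * (inner ℝ k v : ℝ)) =
      (((β / (2 * Real.pi)) ^ ((d : ℝ) / 2) : ℝ) : ℂ) *
        Complex.exp (-((β / 2 : ℝ) : ℂ) * ‖v‖ ^ 2 + Complex.I * t * (inner ℝ k v : ℝ)) := by
    intro v
    rw [Complex.exp_add, maxwellDensity, Complex.real_smul]
    push_cast
    ring_nf
  simp_rw [e]
  rw [integral_const_mul, h, ← mul_assoc]
  have e2 : (((β / (2 * Real.pi)) ^ ((d : ℝ) / 2) : ℝ) : ℂ) *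
      ((Real.pi : ℂ) / ((β / 2 : ℝ) : ℂ)) ^ ((Module.finrank ℝ (Vel d) : ℂ) / 2) = 1 := by
    have : ((Real.pi : ℂ) / ((β / 2 : ℝ) : ℂ)) ^ ((Module.finrank ℝ (Vel d) : ℂ) / 2) =
        (((Real.pi / (β / 2)) ^ ((d : ℝ) / 2) : ℝ) : ℂ) := by
      rw [Complex.ofReal_cpow (by positivity)]
      simp
    rw [this, ← Complex.ofReal_mul, ← Real.mul_rpow (by positivity) (by positivity)]
    have : β / (2 * Real.pi) * (Real.pi / (β / 2)) = 1 := by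
      have := Real.pi_pos.ne'
      field_simp
    rw [this]; simp
  rw [e2, one_mul]
  congr 1
  push_cast
  field_simp
  rw [Complex.I_sq]
  ring

lemma isProbabilityMeasure_maxwell (d : ℕ) {β : ℝ} (hβ : 0 < β) :
    IsProbabilityMeasure (maxwell d β) := by
  -- At k = 0 and t = 0 the characteristic function is the total mass.
  have h := integral_cexp_inner_maxwell (d := d) hβ 0 0
  simp only [inner_zero_left, Complex.ofReal_zero, mul_zero, Complex.exp_zero, integral_const,
    norm_zero, ne_eq, OfNat.ofNat_ne_zero, not_false_eq_true, zero_pow, zero_div, neg_zero] at h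
  constructor
  have h1 : (maxwell d β).real Set.univ = 1 := by
    have : (((maxwell d β).real Set.univ : ℝ) : ℂ) = 1 := by simpa using h
    exact_mod_cast this
  rw [measureReal_def, ENNReal.toReal_eq_one_iff] at h1
  exact h1

/-- The resolvent as a time integral. Under Fubini it turns averages of 1/(ξ + k·v) into Laplace
transforms of the characteristic function. -/
lemma inv_eq_integral_cexp {ζ : ℂ} (hζ : 0 < ζ.im) :
    1 / ζ = -Complex.I * ∫ t in Set.Ioi (0 : ℝ), Complex.exp (Complex.I * ζ * t) := by
  have hne : ζ ≠ 0 := by rintro rfl; simp at hζ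
  rw [integral_exp_mul_complex_Ioi (by simpa using hζ)]
  simp only [Complex.ofReal_zero, mul_zero, Complex.exp_zero]
  field_simp [Complex.I_ne_zero]

lemma add_ofReal_ne_zero {ξ : ℂ} (hξ : 0 < ξ.im) (x : ℝ) : ξ + x ≠ 0 := by
  intro h
  have := congrArg Complex.im h
  simp at this
  linarith

lemma norm_inv_add_ofReal_le {ξ : ℂ} (hξ : 0 < ξ.im) (x : ℝ) : ‖(ξ + x)⁻¹‖ ≤ ξ.im⁻¹ := by
  rw [norm_inv]
  refine inv_anti₀ hξ ?_
  have := Complex.abs_im_le_norm (ξ + x)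
  simp only [Complex.add_im, Complex.ofReal_im, add_zero, abs_of_pos hξ] at this
  exact this

lemma continuous_inv_add_inner {d : ℕ} {ξ : ℂ} (hξ : 0 < ξ.im) (k : Vel d) :
    Continuous (fun v : Vel d => (ξ + (inner ℝ k v : ℝ))⁻¹) := by
  refine Continuous.inv₀ (by fun_prop) fun v => add_ofReal_ne_zero hξ _

lemma integrable_inv_add_inner {d : ℕ} {β : ℝ} (hβ : 0 < β) {ξ : ℂ} (hξ : 0 < ξ.im) (k : Vel d) :
    Integrable (fun v => (ξ + (inner ℝ k v : ℝ))⁻¹) (maxwell d β) := by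
  have := isProbabilityMeasure_maxwell d hβ
  exact Integrable.of_bound (continuous_inv_add_inner hξ k).aestronglyMeasurable ξ.im⁻¹
    (ae_of_all _ fun v => norm_inv_add_ofReal_le hξ _)

lemma gaussLaplace_div {β : ℝ} {κ : ℝ} (hκ : 0 < κ) (ξ : ℂ) :
    gaussLaplace β (ξ / κ) = κ * ∫ t in Set.Ioi (0 : ℝ),
      Complex.exp (Complex.I * ξ * t) * Complex.exp (-((t : ℂ) ^ 2 * (κ : ℂ) ^ 2 / (2 * β))) := by
  have h := integral_comp_mul_left_Ioi (gaussExp β (ξ / κ)) 0 hκ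
  rw [mul_zero] at h
  have hk : (κ : ℂ) ≠ 0 := by exact_mod_cast hκ.ne'
  rw [gaussLaplace]
  have e : ∀ t : ℝ, Complex.exp (Complex.I * ξ * t) *
      Complex.exp (-((t : ℂ) ^ 2 * (κ : ℂ) ^ 2 / (2 * β))) = gaussExp β (ξ / κ) (κ * t) := by
    intro t
    rw [gaussExp, ← Complex.exp_add]
    congr 1
    push_cast
    field_simp
    ring
  simp_rw [e]
  rw [h, Complex.real_smul]
  push_cast
  field_simp

/-- After exchanging the time integral with the average, only the Gaussian characteristic function
along k remains, and rescaling t by |k| produces F. -/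
lemma integral_inv_add_inner {d : ℕ} {β : ℝ} (hβ : 0 < β) {ξ : ℂ} (hξ : 0 < ξ.im) {k : Vel d}
    (hk : k ≠ 0) :
    ∫ v, (ξ + (inner ℝ k v : ℝ))⁻¹ ∂(maxwell d β) =
      -(Complex.I / ‖k‖) * gaussLaplace β (ξ / ‖k‖) := by
  have := isProbabilityMeasure_maxwell d hβ
  have hk' : (0 : ℝ) < ‖k‖ := norm_pos_iff.2 hk
  have hkc : ((‖k‖ : ℝ) : ℂ) ≠ 0 := by exact_mod_cast hk'.ne'
  rw [gaussLaplace_div hk']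
  have e1 : ∀ v : Vel d, (ξ + (inner ℝ k v : ℝ))⁻¹ = -Complex.I * ∫ t in Set.Ioi (0 : ℝ),
      Complex.exp (Complex.I * ξ * t) * Complex.exp (Complex.I * t * (inner ℝ k v : ℝ)) := by
    intro v
    rw [← one_div, inv_eq_integral_cexp (by simpa using hξ)]
    congr 1
    refine integral_congr_ae (ae_of_all _ fun t => ?_)
    simp only [← Complex.exp_add]
    congr 1
    ring
  simp_rw [e1]
  rw [integral_const_mul, integral_integral_swap]
  · simp_rw [integral_const_mul, integral_cexp_inner_maxwell hβ k]
    generalize (∫ t in Set.Ioi (0 : ℝ), Complex.exp (Complex.I * ξ * t) *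
      Complex.exp (-((t : ℂ) ^ 2 * (‖k‖ : ℂ) ^ 2 / (2 * β)))) = A
    field_simp
  · have hexp : Integrable (fun t : ℝ => Complex.exp (Complex.I * ξ * t))
        (volume.restrict (Set.Ioi 0)) :=
      integrableOn_exp_mul_complex_Ioi (by simpa using hξ) 0
    have h1 : Integrable (fun p : Vel d × ℝ => (1 : ℂ) * Complex.exp (Complex.I * ξ * p.2))
        ((maxwell d β).prod (volume.restrict (Set.Ioi 0))) :=
      (integrable_const (1 : ℂ)).mul_prod hexp
    refine Integrable.mono h1 ?_ (ae_of_all _ fun p => ?_)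
    · exact Continuous.aestronglyMeasurable (by fun_prop)
    · simp only [Function.uncurry, norm_mul, one_mul]
      rw [Complex.norm_exp (Complex.I * _ * ((inner ℝ k p.1 : ℝ) : ℂ))]
      simp

/-- Since x/(ξ + x) = 1 - ξ/(ξ + x), the combination 1 + izF appears; this is the reason for the
definition of Z. -/
lemma integral_inner_mul_inv_add_inner {d : ℕ} {β : ℝ} (hβ : 0 < β) {ξ : ℂ} (hξ : 0 < ξ.im)
    {k : Vel d} (hk : k ≠ 0) :
    ∫ v, ((inner ℝ k v : ℝ) : ℂ) * (ξ + (inner ℝ k v : ℝ))⁻¹ ∂(maxwell d β) =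
      plasmaZ β (ξ / ‖k‖) := by
  have := isProbabilityMeasure_maxwell d hβ
  have e : ∀ v : Vel d, ((inner ℝ k v : ℝ) : ℂ) * (ξ + (inner ℝ k v : ℝ))⁻¹ =
      1 - ξ * (ξ + (inner ℝ k v : ℝ))⁻¹ := by
    intro v
    have := add_ofReal_ne_zero hξ (inner ℝ k v)
    field_simp
    ring
  simp_rw [e]
  rw [integral_sub (integrable_const _) ((integrable_inv_add_inner hβ hξ k).const_mul _),
    integral_const_mul, integral_inv_add_inner hβ hξ hk, plasmaZ]
  simp
  ring

/-- The sign is invisible on the Laplace transform but clear on the velocity average: in dimension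
one Z(z) averages x/(z + x), and zx/(z + x) has imaginary part x² Im z/|z + x|². -/
lemma im_mul_plasmaZ_nonneg {β : ℝ} (hβ : 0 < β) {z : ℂ} (hz : 0 < z.im) :
    0 ≤ (z * plasmaZ β z).im := by
  set e : Vel 1 := EuclideanSpace.single 0 1
  have he : ‖e‖ = 1 := by simp [e]
  have he0 : e ≠ 0 := by rw [← norm_pos_iff, he]; exact one_pos
  have h := integral_inner_mul_inv_add_inner (d := 1) hβ hz he0
  rw [he, Complex.ofReal_one, div_one] at h
  rw [← h, ← integral_const_mul]
  have hint : Integrable (fun v : Vel 1 =>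
      z * (((inner ℝ e v : ℝ) : ℂ) * (z + (inner ℝ e v : ℝ))⁻¹)) (maxwell 1 β) := by
    have := isProbabilityMeasure_maxwell 1 hβ
    refine (((integrable_const (1 : ℂ)).sub
      ((integrable_inv_add_inner hβ hz e).const_mul z)).const_mul z).congr
      (ae_of_all _ fun v => ?_)
    have := add_ofReal_ne_zero hz (inner ℝ e v)
    simp only [Pi.sub_apply]
    field_simp
    ring
  have him : (∫ v : Vel 1, z * (((inner ℝ e v : ℝ) : ℂ) * (z + (inner ℝ e v : ℝ))⁻¹)
      ∂(maxwell 1 β)).im = ∫ v : Vel 1,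
      (z * (((inner ℝ e v : ℝ) : ℂ) * (z + (inner ℝ e v : ℝ))⁻¹)).im ∂(maxwell 1 β) :=
    (integral_im hint).symm
  rw [him]
  refine integral_nonneg fun v => ?_
  set x : ℝ := inner ℝ e v
  have hx := add_ofReal_ne_zero hz x
  have : (z * ((x : ℂ) * (z + x)⁻¹)).im = x ^ 2 * z.im / Complex.normSq (z + x) := by
    rw [Complex.inv_def]
    simp [Complex.mul_im, Complex.mul_re]
    ring
  simp only [Pi.zero_apply]
  rw [this]
  have := Complex.normSq_nonneg (z + x)
  positivity

/-! ### The dispersion function, its boundary values and the hyperplane average -/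

lemma exists_lower_bound_dispersion {β : ℝ} (hβ : 0 < β) (c₁ : ℝ) :
    ∃ δ : ℝ, 0 < δ ∧ ∀ c : ℝ, 0 ≤ c → c ≤ c₁ → ∀ z : ℂ, 0 ≤ z.im →
      δ ≤ ‖1 + (c : ℂ) * plasmaZ β z‖ :=
  exists_lower_bound_one_add_mul_plasmaZ hβ (fun _ hz => im_mul_plasmaZ_nonneg hβ hz) c₁

/-- The average is evaluated with -k in place of k, to match the denominator k·v - ω. The prefactor
(N+1-1)/N is 1, so the value does not depend on N. -/
lemma eps_eq_plasmaZ {d : ℕ} {β : ℝ} (hβ : 0 < β) (V : Torus d → ℝ) {N : ℕ} (hN : 1 ≤ N)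
    {n : Fin d → ℤ} (hn : waveVec n ≠ 0) {ω : ℂ} (hω : 0 < ω.im) :
    eps β V N 1 n ω = 1 + ((β * Vhat V n : ℝ) : ℂ) * plasmaZ β (ω / ‖waveVec n‖) := by
  have hN' : (N : ℝ) ≠ 0 := by positivity
  have hm : -waveVec n ≠ 0 := neg_ne_zero.2 hn
  have h := integral_inner_mul_inv_add_inner hβ hω hm
  rw [norm_neg] at h
  rw [eps, ← h]
  congr 2
  · congr 1
    field_simp
    simp
  · refine integral_congr_ae (ae_of_all _ fun v => ?_)
    simp only [inner_neg_left, Complex.ofReal_neg, div_eq_mul_inv]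
    rw [show ω + -((inner ℝ (waveVec n) v : ℝ) : ℂ) =
      -(((inner ℝ (waveVec n) v : ℝ) : ℂ) - ω) by ring, inv_neg]
    ring

lemma tendsto_eps {d : ℕ} {β : ℝ} (hβ : 0 < β) (V : Torus d → ℝ) {N : ℕ} (hN : 1 ≤ N)
    {n : Fin d → ℤ} (hn : waveVec n ≠ 0) (s : ℝ) :
    Tendsto (fun η : ℝ => eps β V N 1 n ((s : ℂ) + (η : ℂ) * Complex.I)) (𝓝[>] (0 : ℝ))
      (𝓝 (1 + ((β * Vhat V n : ℝ) : ℂ) * plasmaZ β ((s / ‖waveVec n‖ : ℝ) : ℂ))) := by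
  have hk : 0 < ‖waveVec n‖ := norm_pos_iff.2 hn
  have h1 : Tendsto (fun η : ℝ => 1 + ((β * Vhat V n : ℝ) : ℂ) *
      plasmaZ β (((s : ℂ) + (η : ℂ) * Complex.I) / ‖waveVec n‖)) (𝓝[>] (0 : ℝ))
      (𝓝 (1 + ((β * Vhat V n : ℝ) : ℂ) * plasmaZ β ((s / ‖waveVec n‖ : ℝ) : ℂ))) := by
    refine (Tendsto.const_mul _ ?_).const_add _
    refine ((continuousOn_plasmaZ hβ) ((s / ‖waveVec n‖ : ℝ) : ℂ) (by simp)).tendsto.comp ?_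
    refine tendsto_nhdsWithin_iff.2 ⟨?_, ?_⟩
    · have : Continuous (fun η : ℝ => ((s : ℂ) + (η : ℂ) * Complex.I) / ‖waveVec n‖) := by
        fun_prop
      have := this.tendsto 0
      simp only [Complex.ofReal_zero, zero_mul, add_zero] at this
      push_cast
      exact this.mono_left nhdsWithin_le_nhds
    · filter_upwards [self_mem_nhdsWithin] with η hη
      have hη' : (0 : ℝ) < η := hη
      simp only [Complex.div_ofReal_im]
      simp
      positivity
  refine h1.congr' ?_
  filter_upwards [self_mem_nhdsWithin] with η hη
  rw [eps_eq_plasmaZ hβ V hN hn]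
  simpa using hη

lemma epsPlus_eq {d : ℕ} {β : ℝ} (hβ : 0 < β) (V : Torus d → ℝ) {N : ℕ} (hN : 1 ≤ N)
    {n : Fin d → ℤ} (hn : waveVec n ≠ 0) (s : ℝ) :
    epsPlus β V N 1 n s =
      1 + ((β * Vhat V n : ℝ) : ℂ) * plasmaZ β ((s / ‖waveVec n‖ : ℝ) : ℂ) :=
  (tendsto_eps hβ V hN hn s).limUnder_eq

lemma tendsto_epsPlus_and_ne_zero {d : ℕ} {β : ℝ} (hβ : 0 < β) {V : Torus d → ℝ}
    (hV : PosDefPotential V) {N : ℕ} (hN : 1 ≤ N) (n : Fin d → ℤ) (s : ℝ) :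
    Tendsto (fun η : ℝ => eps β V N 1 n ((s : ℂ) + (η : ℂ) * Complex.I)) (𝓝[>] (0 : ℝ))
      (𝓝 (epsPlus β V N 1 n s)) ∧ epsPlus β V N 1 n s ≠ 0 := by
  by_cases hn : waveVec n = 0
  · have h1 : ∀ ω, eps β V N 1 n ω = 1 := by
      intro ω
      simp [eps, hn]
    have h2 : Tendsto (fun η : ℝ => eps β V N 1 n ((s : ℂ) + (η : ℂ) * Complex.I))
        (𝓝[>] (0 : ℝ)) (𝓝 1) := by
      simp only [h1]; exact tendsto_const_nhds
    have h3 : epsPlus β V N 1 n s = 1 := h2.limUnder_eq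
    rw [h3]
    exact ⟨h2, one_ne_zero⟩
  · rw [epsPlus_eq hβ V hN hn]
    exact ⟨tendsto_eps hβ V hN hn s, one_add_mul_plasmaZ_ofReal_ne_zero hβ
      (mul_nonneg hβ.le (hV n).1) _⟩

/-- On the hyperplane, M_β splits into a Gaussian in its distance to the origin and a
(d-1)-dimensional Gaussian integral. The powers of β/2π combine to 1/2, which gives the constant of
Re F. -/
lemma pi_mul_deltaAvg {d : ℕ} {β : ℝ} (hβ : 0 < β) {k : Vel d} (hk : k ≠ 0) (v : Vel d) :
    Real.pi * deltaAvg β k v =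
      (gaussLaplace β ((inner ℝ k v / ‖k‖ : ℝ) : ℂ)).re / ‖k‖ := by
  have hk' : 0 < ‖k‖ := norm_pos_iff.2 hk
  rw [deltaAvg, OrthonormalBasis.addHaar_eq_volume, re_gaussLaplace_ofReal hβ]
  set U : Submodule ℝ (Vel d) := (Submodule.span ℝ {k})ᗮ with hU
  have hfin : (Module.finrank ℝ U : ℝ) = d - 1 := by
    have := Submodule.finrank_add_finrank_orthogonal (Submodule.span ℝ {k})
    rw [finrank_span_singleton hk, finrank_euclideanSpace, Fintype.card_fin] at this
    have h2 : (1 : ℝ) + (Module.finrank ℝ U : ℝ) = d := by exact_mod_cast this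
    linarith
  have e : ∀ u : U, maxwellDensity β ((inner ℝ k v / ‖k‖ ^ 2) • k + (u : Vel d)) =
      ((β / (2 * Real.pi)) ^ ((d : ℝ) / 2) * Real.exp (-(β * (inner ℝ k v / ‖k‖) ^ 2 / 2))) *
        Real.exp (-(β / 2) * ‖u‖ ^ 2) := by
    intro u
    have horth : inner ℝ ((inner ℝ k v / ‖k‖ ^ 2) • k) (u : Vel d) = 0 := by
      rw [inner_smul_left, (Submodule.mem_orthogonal_singleton_iff_inner_right.1 u.2), mul_zero]
    have hn := norm_add_sq_eq_norm_sq_add_norm_sq_real horth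
    have hs : ‖(inner ℝ k v / ‖k‖ ^ 2) • k‖ ^ 2 = (inner ℝ k v / ‖k‖) ^ 2 := by
      rw [norm_smul, Real.norm_eq_abs, mul_pow, sq_abs]
      field_simp
    rw [maxwellDensity, mul_assoc, ← Real.exp_add]
    congr 2
    rw [pow_two ‖_ + _‖, hn, ← pow_two, hs, ← pow_two, Submodule.coe_norm]
    ring
  simp_rw [e]
  rw [integral_const_mul, GaussianFourier.integral_rexp_neg_mul_sq_norm (by positivity), hfin]
  have hpi := Real.pi_pos
  have key : Real.pi * ((β / (2 * Real.pi)) ^ ((d : ℝ) / 2) *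
      (Real.pi / (β / 2)) ^ (((d : ℝ) - 1) / 2)) = Real.sqrt (Real.pi * β / 2) := by
    have e1 : Real.pi / (β / 2) = (β / (2 * Real.pi))⁻¹ := by field_simp
    rw [e1, Real.inv_rpow (by positivity), ← Real.rpow_neg (by positivity),
      ← Real.rpow_add (by positivity),
      show (d : ℝ) / 2 + -((d - 1) / 2) = 1 / 2 by ring, ← Real.sqrt_eq_rpow]
    have e2 : Real.pi * β / 2 = Real.pi ^ 2 * (β / (2 * Real.pi)) := by field_simp
    rw [e2, Real.sqrt_mul (by positivity), Real.sqrt_sq hpi.le]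
  rw [← key]
  ring

end LenardBalescu
end

noncomputable section

namespace LenardBalescu

/-! ### Functions in `H¹_β` have a finite second moment -/

lemma hasFDerivAt_maxwellDensity {d : ℕ} (β : ℝ) (v : Vel d) :
    HasFDerivAt (maxwellDensity β : Vel d → ℝ)
      (-(β * maxwellDensity β v) • innerSL ℝ v) v := by
  have h := ((hasStrictFDerivAt_norm_sq v).hasFDerivAt.const_mul (-(β / 2))).exp.const_mul
    ((β / (2 * Real.pi)) ^ ((d : ℝ) / 2))
  convert! h using 1
  ext w
  simp [maxwellDensity]
  ring

lemma lintegral_maxwell {d : ℕ} (β : ℝ) (f : Vel d → ℝ≥0∞) (hf : AEMeasurable f) :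
    ∫⁻ v, f v ∂(maxwell d β) = ∫⁻ v, ENNReal.ofReal (maxwellDensity β v) * f v := by
  unfold maxwell
  rw [lintegral_withDensity_eq_lintegral_mul₀
    (maxwellDensity_continuous β).measurable.ennreal_ofReal.aemeasurable hf]
  rfl

lemma locallyIntegrable_of_memLp_maxwell {d : ℕ} {β : ℝ} (hβ : 0 < β) {E : Type*}
    [NormedAddCommGroup E] [NormedSpace ℝ E] {f : Vel d → E} (hf : MemLp f 2 (maxwell d β)) :
    LocallyIntegrable f := by
  have := isProbabilityMeasure_maxwell d hβ
  have h1 : Integrable f (maxwell d β) := hf.integrable (by norm_num)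
  rw [integrable_maxwell_iff hβ] at h1
  have hc : Continuous fun v : Vel d => (maxwellDensity β v)⁻¹ :=
    (maxwellDensity_continuous β).inv₀ fun v => (maxwellDensity_pos hβ v).ne'
  have h2 := (h1.locallyIntegrable.locallyIntegrableOn Set.univ).continuousOn_smul isOpen_univ.isLocallyClosed
    hc.continuousOn
  rw [locallyIntegrableOn_univ] at h2
  have e : (fun v => (maxwellDensity β v)⁻¹ • maxwellDensity β v • f v) = f := by
    funext v
    rw [smul_smul, inv_mul_cancel₀ (maxwellDensity_pos hβ v).ne', one_smul]
  rwa [e] at h2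

/-- The weighted second-moment bound for a `C¹` function, localized by a cutoff. -/
lemma integral_sq_coord_mul_cutoff_le {d : ℕ} {β : ℝ} (hβ : 0 < β) {f θ : Vel d → ℝ}
    (hf : ContDiff ℝ 1 f) (hθ : ContDiff ℝ 1 θ) (hθ0 : ∀ v, 0 ≤ θ v)
    (hθ1 : ∀ v, θ v ≤ 1) (j : Fin d) {C : ℝ} (hC : ∀ v, |v j * velPartial j θ v| ≤ C)
    {S : Set (Vel d)} (hS : IsCompact S) (hθS : tsupport θ ⊆ S) :
    β / 2 * ∫ v, v j ^ 2 * θ v * f v ^ 2 * maxwellDensity β v ≤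
      (1 + C) * (∫ v in S, f v ^ 2 * maxwellDensity β v) +
      2 / β * ∫ v in S, velPartial j f v ^ 2 * maxwellDensity β v := by
  set e : Vel d := EuclideanSpace.single j 1
  set M : Vel d → ℝ := maxwellDensity β
  have hMc : Continuous M := maxwellDensity_continuous β
  have hM0 : ∀ v, 0 < M v := maxwellDensity_pos hβ
  have hpc : Continuous fun v : Vel d => v j := by fun_prop
  have hθs : HasCompactSupport θ := hS.of_isClosed_subset (isClosed_tsupport θ) hθS
  have hcf' : Continuous (velPartial j f) :=
    (hf.continuous_fderiv one_ne_zero).clm_apply continuous_const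
  have hcθ' : Continuous (velPartial j θ) :=
    (hθ.continuous_fderiv one_ne_zero).clm_apply continuous_const
  -- The derivative ∂_j χ contains -β v_j² θ M, whose integral against f² is to be controlled; the
  -- cutoff makes the integration by parts legitimate.
  set χ : Vel d → ℝ := fun v => v j * θ v * M v with hχ
  have hd : ∀ v, HasFDerivAt χ
      (((v j * θ v) • (-(β * M v) • innerSL ℝ v)) +
        M v • (v j • fderiv ℝ θ v + θ v • (EuclideanSpace.proj j : Vel d →L[ℝ] ℝ))) v := by
    intro v
    have h1 : HasFDerivAt (fun v : Vel d => v j) (EuclideanSpace.proj j : Vel d →L[ℝ] ℝ) v :=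
      (EuclideanSpace.proj j : Vel d →L[ℝ] ℝ).hasFDerivAt
    exact (h1.mul ((hθ.differentiable one_ne_zero) v).hasFDerivAt).mul
      (hasFDerivAt_maxwellDensity β v)
  have hde : ∀ v, fderiv ℝ χ v e =
      M v * θ v + M v * (v j * velPartial j θ v) - β * v j ^ 2 * θ v * M v := by
    intro v
    rw [(hd v).fderiv]
    simp [velPartial, e, EuclideanSpace.inner_single_right]
    ring
  have hχc : Continuous χ := (hpc.mul hθ.continuous).mul hMc
  have hχs : HasCompactSupport χ := (hθs.mul_left (f := fun v : Vel d => v j)).mul_right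
  have hχ'c : Continuous fun v => fderiv ℝ χ v e := by
    simp_rw [hde]
    have := hθ.continuous
    fun_prop
  have hχ's : HasCompactSupport fun v => fderiv ℝ χ v e := hχs.fderiv_apply (𝕜 := ℝ) e
  have hf2 : ∀ v, fderiv ℝ (fun v => f v ^ 2) v e = 2 * f v * velPartial j f v := by
    intro v
    have := (((hf.differentiable one_ne_zero) v).hasFDerivAt.pow 2).fderiv
    rw [this]
    simp [velPartial, e]
  have hfc := hf.continuous
  have i1 : Integrable fun v => 2 * f v * velPartial j f v * χ v :=
    ((by fun_prop : Continuous fun v => 2 * f v * velPartial j f v * χ v)).integrable_of_hasCompactSupport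
      hχs.mul_left
  have i2 : Integrable fun v => f v ^ 2 * fderiv ℝ χ v e :=
    ((hfc.pow 2).mul hχ'c).integrable_of_hasCompactSupport hχ's.mul_left
  have hibp := integral_mul_fderiv_eq_neg_fderiv_mul_of_integrable (𝕜 := ℝ) (μ := volume)
    (f := fun v => f v ^ 2) (g := χ) (v := e) (by simpa only [hf2] using i1) i2
    (((hfc.pow 2).mul hχc).integrable_of_hasCompactSupport hχs.mul_left)
    (fun v _ => ((hf.differentiable one_ne_zero) v).pow 2) (fun v _ => (hd v).differentiableAt)
  simp only [hf2] at hibp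
  have i3 : IntegrableOn (fun v => f v ^ 2 * M v) S :=
    ((hfc.pow 2).mul hMc).continuousOn.integrableOn_compact hS
  have i4 : IntegrableOn (fun v => velPartial j f v ^ 2 * M v) S :=
    ((hcf'.pow 2).mul hMc).continuousOn.integrableOn_compact hS
  have i5 : Integrable fun v => v j ^ 2 * θ v * f v ^ 2 * M v := by
    refine Continuous.integrable_of_hasCompactSupport ?_ ?_
    · have := hθ.continuous
      fun_prop
    · exact ((hθs.mul_left (f := fun v : Vel d => v j ^ 2)).mul_right).mul_right
  have i6 : Integrable (S.indicator fun v => (1 + C) * (f v ^ 2 * M v) +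
      2 / β * (velPartial j f v ^ 2 * M v)) :=
    (integrable_indicator_iff hS.measurableSet).2 ((i3.const_mul _).add (i4.const_mul _))
  have hC0 : ∀ v, 0 ≤ C := fun v => (abs_nonneg _).trans (hC v)
  -- The added expression f² ∂_jχ + 2f ∂_jf χ has zero integral. Of its term -β v_j² θ f² M, one
  -- half absorbs the first summand and the other half the Young bound `a3` of the cross term.
  have hpt : ∀ v, β / 2 * (v j ^ 2 * θ v * f v ^ 2 * M v) + (f v ^ 2 * fderiv ℝ χ v e +
      2 * f v * velPartial j f v * χ v) ≤
      S.indicator (fun v => (1 + C) * (f v ^ 2 * M v) +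
        2 / β * (velPartial j f v ^ 2 * M v)) v := by
    intro v
    by_cases hv : v ∈ S
    · rw [Set.indicator_of_mem hv, hde]
      have h1 : v j * velPartial j θ v ≤ C := (le_abs_self _).trans (hC v)
      have h2 := hθ0 v
      have h3 := hθ1 v
      have h4 := (hM0 v).le
      have a1 : f v ^ 2 * M v * θ v ≤ f v ^ 2 * M v * 1 :=
        mul_le_mul_of_nonneg_left h3 (by positivity)
      have a2 : f v ^ 2 * M v * (v j * velPartial j θ v) ≤ f v ^ 2 * M v * C :=
        mul_le_mul_of_nonneg_left h1 (by positivity)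
      have a3 : 2 * (f v * velPartial j f v * v j) ≤
          β / 2 * (v j * f v) ^ 2 + 2 / β * velPartial j f v ^ 2 := by
        have : 0 ≤ β / 2 * (v j * f v - 2 / β * velPartial j f v) ^ 2 := by positivity
        have hb : β / 2 * (v j * f v - 2 / β * velPartial j f v) ^ 2 =
          β / 2 * (v j * f v) ^ 2 + 2 / β * velPartial j f v ^ 2 -
            2 * (f v * velPartial j f v * v j) := by
          field_simp
          ring
        linarith
      have a4 := mul_le_mul_of_nonneg_left a3 (mul_nonneg h2 h4)
      have a5 : M v * (2 / β * velPartial j f v ^ 2) * θ v ≤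
          M v * (2 / β * velPartial j f v ^ 2) * 1 :=
        mul_le_mul_of_nonneg_left h3 (by positivity)
      simp only [hχ]
      nlinarith
    · rw [Set.indicator_of_notMem hv]
      have hθv : θ v = 0 := image_eq_zero_of_notMem_tsupport fun h => hv (hθS h)
      have hθ'v : velPartial j θ v = 0 := by
        have : v ∉ tsupport (fderiv ℝ θ) := fun h => hv (hθS (tsupport_fderiv_subset ℝ h))
        simp [velPartial, image_eq_zero_of_notMem_tsupport this]
      rw [hde]
      simp [hχ, hθv, hθ'v]
  have hint := integral_mono ((i5.const_mul (β / 2)).add (i2.add i1)) i6 hpt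
  simp only [Pi.add_apply] at hint
  have l1 : ∫ v, (β / 2 * (v j ^ 2 * θ v * f v ^ 2 * M v) + (f v ^ 2 * fderiv ℝ χ v e +
      2 * f v * velPartial j f v * χ v)) =
      β / 2 * ∫ v, v j ^ 2 * θ v * f v ^ 2 * M v := by
    have : ∫ v, (f v ^ 2 * fderiv ℝ χ v e + 2 * f v * velPartial j f v * χ v) = 0 := by
      rw [integral_add i2 i1, hibp]; ring
    refine (integral_add (i5.const_mul (β / 2)) (i2.add i1)).trans ?_
    rw [integral_const_mul]
    simp only [Pi.add_apply]
    rw [this, add_zero]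
  rw [l1, integral_indicator hS.measurableSet,
    integral_add (i3.const_mul _) (i4.const_mul _), integral_const_mul, integral_const_mul] at hint
  exact hint

/-! ### Mollification in the Gaussian-weighted space, and the second moment -/

/-- `h` is the weak `j`-th partial derivative of `f`, for real functions. -/
def HasWeakPartial {d : ℕ} (j : Fin d) (f h : Vel d → ℝ) : Prop :=
  ∀ η : Vel d → ℝ, ContDiff ℝ (⊤ : ℕ∞) η → HasCompactSupport η →
    ∫ v, f v * velPartial j η v = - ∫ v, h v * η v

/-- The mollification of `f` by a normalized bump function. -/
def mollify {d : ℕ} (φ : ContDiffBump (0 : Vel d)) (f : Vel d → ℝ) (v : Vel d) : ℝ :=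
  ∫ t, φ.normed volume t * f (v - t)

lemma mollify_eq_convolution {d : ℕ} (φ : ContDiffBump (0 : Vel d)) (f : Vel d → ℝ) :
    mollify φ f = MeasureTheory.convolution (φ.normed volume) f
      (ContinuousLinearMap.lsmul ℝ ℝ) volume := by
  funext v
  rw [convolution_def]
  rfl

/-- The derivative falls on the bump, and w ↦ φ(v - w) is an admissible test function for the weak
derivative. The sign from the reflection cancels the sign in the weak formulation. -/
lemma velPartial_mollify {d : ℕ} (φ : ContDiffBump (0 : Vel d)) {f h : Vel d → ℝ}
    (hf : LocallyIntegrable f) {j : Fin d} (hw : HasWeakPartial j f h) :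
    velPartial j (mollify φ f) = mollify φ h := by
  funext v
  set e : Vel d := EuclideanSpace.single j 1
  have hφ : ContDiff ℝ 1 (φ.normed volume) := φ.contDiff_normed
  have hφs : HasCompactSupport (φ.normed volume) := φ.hasCompactSupport_normed
  have hd := hφs.hasFDerivAt_convolution_left (ContinuousLinearMap.lsmul ℝ ℝ) (μ := volume)
    hφ hf v
  have hex := (hφs.fderiv (𝕜 := ℝ)).convolutionExists_left
    ((ContinuousLinearMap.lsmul ℝ ℝ).precompL (Vel d)) (μ := volume)
    (hφ.continuous_fderiv one_ne_zero) hf v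
  rw [velPartial, mollify_eq_convolution, hd.fderiv, convolution_def,
    ContinuousLinearMap.integral_apply hex]
  have e1 : ∀ t, ((ContinuousLinearMap.lsmul ℝ ℝ).precompL (Vel d)
      (fderiv ℝ (φ.normed volume) t) (f (v - t))) e =
      velPartial j (φ.normed volume) t * f (v - t) := by
    intro t
    rw [ContinuousLinearMap.precompL_apply]
    rfl
  refine (integral_congr_ae (ae_of_all _ e1)).trans ?_
  set η : Vel d → ℝ := fun w => φ.normed volume (v - w) with hη
  have hηd : ContDiff ℝ (⊤ : ℕ∞) η := φ.contDiff_normed.comp (contDiff_const.sub contDiff_id)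
  have hηs : HasCompactSupport η := hφs.comp_homeomorph (Homeomorph.subLeft v)
  have hη' : ∀ w, velPartial j η w = -velPartial j (φ.normed volume) (v - w) := by
    intro w
    have h1 : HasFDerivAt η ((fderiv ℝ (φ.normed volume) (v - w)).comp
        (-ContinuousLinearMap.id ℝ (Vel d))) w := by
      have := ((hφ.differentiable one_ne_zero) (v - w)).hasFDerivAt.comp w
        ((hasFDerivAt_const v w).sub (hasFDerivAt_id w))
      rw [zero_sub] at this
      exact this
    rw [velPartial, h1.fderiv]
    simp [velPartial]
  have h2 := hw η hηd hηs
  rw [← integral_sub_left_eq_self (fun t => velPartial j (φ.normed volume) t * f (v - t)) volume v]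
  simp only [sub_sub_cancel]
  rw [← integral_sub_left_eq_self (fun w => h w * η w) volume v] at h2
  simp only [hη', mul_neg, integral_neg, neg_inj] at h2
  simp only [hη, sub_sub_cancel] at h2
  rw [mollify]
  simp_rw [mul_comm (velPartial j _ _), mul_comm (φ.normed volume _)]
  exact h2

lemma contDiff_mollify {d : ℕ} (φ : ContDiffBump (0 : Vel d)) {f : Vel d → ℝ}
    (hf : LocallyIntegrable f) : ContDiff ℝ 1 (mollify φ f) := by
  rw [mollify_eq_convolution]
  exact φ.hasCompactSupport_normed.contDiff_convolution_left _ φ.contDiff_normed hf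

/-- Jensen's inequality: the normalized bump is a probability density. -/
lemma enorm_mollify_sq_le {d : ℕ} (φ : ContDiffBump (0 : Vel d)) {f : Vel d → ℝ}
    (hf : AEStronglyMeasurable f) (v : Vel d) :
    ‖mollify φ f v‖ₑ ^ 2 ≤
      ∫⁻ t, ENNReal.ofReal (φ.normed volume t) * ‖f (v - t)‖ₑ ^ 2 := by
  set ρ : Vel d → ℝ≥0∞ := fun t => ENNReal.ofReal (φ.normed volume t)
  have hρ : Measurable ρ := φ.continuous_normed.measurable.ennreal_ofReal
  set ν : Measure (Vel d) := volume.withDensity ρ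
  have hν : IsProbabilityMeasure ν := by
    constructor
    rw [withDensity_apply _ MeasurableSet.univ, Measure.restrict_univ,
      ← ofReal_integral_eq_lintegral_ofReal φ.integrable_normed
        (ae_of_all _ fun t => φ.nonneg_normed t), φ.integral_normed, ENNReal.ofReal_one]
  have hfm : AEStronglyMeasurable (fun t => f (v - t)) :=
    hf.comp_quasiMeasurePreserving (quasiMeasurePreserving_sub_left volume v)
  have hfν : AEStronglyMeasurable (fun t => f (v - t)) ν :=
    hfm.mono_ac (withDensity_absolutelyContinuous _ _)
  have h1 : mollify φ f v = ∫ t, f (v - t) ∂ν := by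
    rw [integral_withDensity_eq_integral_toReal_smul hρ
      (ae_of_all _ fun _ => ENNReal.ofReal_lt_top), mollify]
    refine integral_congr_ae (ae_of_all _ fun t => ?_)
    simp only [ρ, ENNReal.toReal_ofReal (φ.nonneg_normed t), smul_eq_mul]
  have h2 : ‖mollify φ f v‖ₑ ≤ eLpNorm (fun t => f (v - t)) 2 ν := by
    rw [h1]
    refine (enorm_integral_le_lintegral_enorm _).trans ?_
    rw [← eLpNorm_one_eq_lintegral_enorm]
    exact eLpNorm_le_eLpNorm_of_exponent_le (by norm_num) hfν
  have h3 := pow_le_pow_left' h2 2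
  refine h3.trans (le_of_eq ?_)
  have h4 := eLpNorm_nnreal_pow_eq_lintegral (f := fun t => f (v - t)) (μ := ν) (p := 2) (by norm_num)
  have h5 : eLpNorm (fun t => f (v - t)) 2 ν ^ 2 = ∫⁻ t, ‖f (v - t)‖ₑ ^ 2 ∂ν := by
    have e2 : ((2 : ℝ≥0) : ℝ) = ((2 : ℕ) : ℝ) := by norm_num
    have e3 : ((2 : ℝ≥0) : ℝ≥0∞) = 2 := by norm_num
    rw [e2, e3] at h4
    simpa only [ENNReal.rpow_natCast] using h4
  rw [h5, lintegral_withDensity_eq_lintegral_mul₀ hρ.aemeasurable (hfm.enorm.pow_const 2)]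
  rfl

/-- M_β is not comparable with its translates globally. For |v| ≤ 2R and |t| ≤ 1/R, however, |v -
t|² ≤ |v|² + 5, hence M_β(v) ≤ e^{5β/2} M_β(v - t). The mollification radius therefore has to shrink
as the ball grows. -/
lemma lintegral_mollify_sq_le {d : ℕ} {β : ℝ} (hβ : 0 < β) (φ : ContDiffBump (0 : Vel d))
    {R : ℝ} (hR : 1 ≤ R) (hφ : φ.rOut ≤ 1 / R) {f : Vel d → ℝ} (hfl : LocallyIntegrable f) :
    ∫⁻ v in Metric.closedBall 0 (2 * R), ‖mollify φ f v‖ₑ ^ 2 ∂(maxwell d β) ≤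
      ENNReal.ofReal (Real.exp (5 / 2 * β)) * ∫⁻ v, ‖f v‖ₑ ^ 2 ∂(maxwell d β) := by
  have hf := hfl.aestronglyMeasurable
  set S : Set (Vel d) := Metric.closedBall 0 (2 * R)
  set ρ : Vel d → ℝ≥0∞ := fun t => ENNReal.ofReal (φ.normed volume t)
  set m : Vel d → ℝ≥0∞ := fun v => ENNReal.ofReal (maxwellDensity β v)
  set c : ℝ≥0∞ := ENNReal.ofReal (Real.exp (5 / 2 * β))
  have hm : Measurable m := (maxwellDensity_continuous β).measurable.ennreal_ofReal
  have hρ : Measurable ρ := φ.continuous_normed.measurable.ennreal_ofReal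
  have hmax : ∀ v ∈ S, ∀ t, m v * ρ t ≤ c * (m (v - t) * ρ t) := by
    intro v hv t
    by_cases ht : t ∈ Metric.ball (0 : Vel d) φ.rOut
    · rw [← mul_assoc]
      gcongr
      rw [← ENNReal.ofReal_mul (Real.exp_nonneg _)]
      apply ENNReal.ofReal_le_ofReal
      unfold maxwellDensity
      rw [mul_left_comm, ← Real.exp_add]
      gcongr
      have ht1 : ‖t‖ ≤ 1 / R := by
        have : ‖t‖ < φ.rOut := by simpa using ht
        linarith
      have hv1 : ‖v‖ ≤ 2 * R := by simpa [S] using hv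
      have h1 : ‖v - t‖ ≤ ‖v‖ + ‖t‖ := norm_sub_le v t
      have hR0 : 0 < R := by linarith
      have h2 : ‖v‖ * ‖t‖ ≤ 2 := by
        calc ‖v‖ * ‖t‖ ≤ (2 * R) * (1 / R) := by gcongr
          _ = 2 := by field_simp
      have h3 : ‖t‖ ≤ 1 := ht1.trans ((div_le_one hR0).2 hR)
      have h4 : ‖v - t‖ ^ 2 ≤ ‖v‖ ^ 2 + 5 := by nlinarith [norm_nonneg (v - t), norm_nonneg v, norm_nonneg t]
      nlinarith
    · have : ρ t = 0 := by
        have : φ.normed volume t = 0 := by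
          rw [← Function.notMem_support, φ.support_normed_eq]; exact ht
        simp [ρ, this]
      simp [this]
  have hfa : AEMeasurable (fun v => ‖f v‖ₑ ^ 2) := hf.enorm.pow_const 2
  have hFm : AEMeasurable (Function.uncurry fun t v : Vel d =>
      c * (m (v - t) * ρ t) * ‖f (v - t)‖ₑ ^ 2) ((volume : Measure (Vel d)).prod volume) := by
    have h1 : AEMeasurable (fun p : Vel d × Vel d => ‖f (p.2 - p.1)‖ₑ ^ 2)
        ((volume : Measure (Vel d)).prod volume) :=
      hfa.comp_quasiMeasurePreserving
        ((quasiMeasurePreserving_sub_of_right_invariant volume volume).comp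
          Measure.measurePreserving_swap.quasiMeasurePreserving)
    refine AEMeasurable.mul (Measurable.aemeasurable ?_) h1
    fun_prop
  rw [maxwell, restrict_withDensity Metric.isClosed_closedBall.measurableSet,
    ← maxwell, lintegral_maxwell β _ hfa]
  rw [lintegral_withDensity_eq_lintegral_mul₀ hm.aemeasurable
    ((contDiff_mollify φ hfl).continuous.measurable.enorm.pow_const 2).aemeasurable]
  calc ∫⁻ v in S, (m * fun v => ‖mollify φ f v‖ₑ ^ 2) v
      ≤ ∫⁻ v in S, ∫⁻ t, c * (m (v - t) * ρ t) * ‖f (v - t)‖ₑ ^ 2 := by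
        refine setLIntegral_mono' Metric.isClosed_closedBall.measurableSet fun v hv => ?_
        rw [Pi.mul_apply]
        refine (mul_le_mul_right (enorm_mollify_sq_le φ hf v) (m v)).trans ?_
        rw [← lintegral_const_mul']
        · refine lintegral_mono fun t => ?_
          rw [← mul_assoc]
          exact mul_le_mul_left (hmax v hv t) _
        · exact ENNReal.ofReal_ne_top
    _ ≤ ∫⁻ v, ∫⁻ t, c * (m (v - t) * ρ t) * ‖f (v - t)‖ₑ ^ 2 := setLIntegral_le_lintegral _ _
    _ = ∫⁻ t, ∫⁻ v, c * (m (v - t) * ρ t) * ‖f (v - t)‖ₑ ^ 2 :=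
        (lintegral_lintegral_swap hFm).symm
    -- Translation invariance removes t from the inner integral, so that only the unit mass of the
    -- bump is left.
    _ = ∫⁻ t, ρ t * (c * ∫⁻ v, m v * ‖f v‖ₑ ^ 2) := by
        refine lintegral_congr fun t => ?_
        rw [lintegral_sub_right_eq_self (fun w => c * (m w * ρ t) * ‖f w‖ₑ ^ 2) t,
          ← lintegral_const_mul' _ _ ENNReal.ofReal_ne_top,
          ← lintegral_const_mul' _ _ ENNReal.ofReal_ne_top]
        refine lintegral_congr fun v => ?_
        ring
    _ = c * ∫⁻ v, m v * ‖f v‖ₑ ^ 2 := by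
        rw [lintegral_mul_const _ hρ, ← ofReal_integral_eq_lintegral_ofReal φ.integrable_normed
          (ae_of_all _ fun t => φ.nonneg_normed t), φ.integral_normed, ENNReal.ofReal_one, one_mul]

/-- A smooth cutoff equal to `1` on the unit ball. -/
def unitBump (d : ℕ) : ContDiffBump (0 : Vel d) := ⟨1, 2, one_pos, one_lt_two⟩

lemma exists_bound_coord_mul_velPartial_unitBump (d : ℕ) (j : Fin d) :
    ∃ C : ℝ, 0 ≤ C ∧ ∀ v : Vel d, |v j * velPartial j (unitBump d) v| ≤ C := by
  have hc : Continuous fun v : Vel d => v j * velPartial j (unitBump d) v :=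
    (by fun_prop : Continuous fun v : Vel d => v j).mul
      (continuous_velPartial (unitBump d).contDiff j)
  have hs : HasCompactSupport fun v : Vel d => v j * velPartial j (unitBump d) v :=
    (hasCompactSupport_velPartial (unitBump d).hasCompactSupport j).mul_left
  obtain ⟨C, hC⟩ := hc.bounded_above_of_compact_support hs
  exact ⟨C, (norm_nonneg _).trans (hC 0), fun v => hC v⟩

lemma memLp_two_iff_lintegral {α E : Type*} [MeasurableSpace α] [NormedAddCommGroup E]
    {μ : Measure α} {f : α → E} :
    MemLp f 2 μ ↔ AEStronglyMeasurable f μ ∧ ∫⁻ x, ‖f x‖ₑ ^ 2 ∂μ < ∞ := by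
  rw [MemLp, eLpNorm_lt_top_iff_lintegral_rpow_enorm_lt_top (by norm_num) (by norm_num)]
  have e2 : (2 : ℝ≥0∞).toReal = ((2 : ℕ) : ℝ) := by norm_num
  simp only [e2, ENNReal.rpow_natCast]

/-- The cutoff inequality is applied to mollifications of f. Mollifying at scale 1/R while cutting
off at scale R keeps its constants uniform, and Fatou's lemma gives the bound for f. -/
lemma memLp_coord_mul_of_hasWeakPartial {d : ℕ} {β : ℝ} (hβ : 0 < β) {f h : Vel d → ℝ}
    (hf : MemLp f 2 (maxwell d β)) (hh : MemLp h 2 (maxwell d β)) {j : Fin d}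
    (hw : HasWeakPartial j f h) : MemLp (fun v => v j * f v) 2 (maxwell d β) := by
  have hfl := locallyIntegrable_of_memLp_maxwell hβ hf
  have hhl := locallyIntegrable_of_memLp_maxwell hβ hh
  have hmeas : AEStronglyMeasurable (fun v => v j * f v) (maxwell d β) :=
    (by fun_prop : Continuous fun v : Vel d => v j).aestronglyMeasurable.mul hf.1
  refine memLp_two_iff_lintegral.2 ⟨hmeas, ?_⟩
  obtain ⟨C, hC0, hC⟩ := exists_bound_coord_mul_velPartial_unitBump d j
  set R : ℕ → ℝ := fun n => n + 1
  have hR : ∀ n, 1 ≤ R n := fun n => by simp [R]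
  have hR0 : ∀ n, 0 < R n := fun n => by linarith [hR n]
  set φ : ℕ → ContDiffBump (0 : Vel d) := fun n =>
    ⟨1 / (2 * R n), 1 / R n, by have := hR0 n; positivity, by
      have := hR0 n
      gcongr
      linarith⟩
  set θ : ℕ → Vel d → ℝ := fun n v => unitBump d ((R n)⁻¹ • v)
  set F : ℕ → Vel d → ℝ≥0∞ := fun n v =>
    ENNReal.ofReal (v j ^ 2 * θ n v * mollify (φ n) f v ^ 2)
  set c : ℝ := Real.exp (5 / 2 * β)
  set A : ℝ := ∫ v, f v ^ 2 ∂(maxwell d β)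
  set B : ℝ := ∫ v, h v ^ 2 ∂(maxwell d β)
  have hball : ∀ (n : ℕ) {p : Vel d → ℝ}, MemLp p 2 (maxwell d β) →
      ∫ v in Metric.closedBall 0 (2 * R n), mollify (φ n) p v ^ 2 * maxwellDensity β v ≤
        c * ∫ v, p v ^ 2 ∂(maxwell d β) := by
    intro n p hp
    have hpl := locallyIntegrable_of_memLp_maxwell hβ hp
    have h1 := lintegral_mollify_sq_le hβ (φ n) (hR n) le_rfl hpl
    have hi : Integrable (fun v => p v ^ 2) (maxwell d β) := hp.integrable_sq
    have hS : MeasurableSet (Metric.closedBall (0 : Vel d) (2 * R n)) :=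
      Metric.isClosed_closedBall.measurableSet
    have e1 : ∀ (q : Vel d → ℝ) (v : Vel d), ‖q v‖ₑ ^ 2 = ENNReal.ofReal (q v ^ 2) := by
      intro q v
      rw [← sq_abs (q v), ENNReal.ofReal_pow (abs_nonneg _), ← Real.norm_eq_abs, ofReal_norm]
    simp_rw [e1 p, e1 (mollify (φ n) p)] at h1
    rw [← ofReal_integral_eq_lintegral_ofReal hi (ae_of_all _ fun v => sq_nonneg _),
      ← ENNReal.ofReal_mul (Real.exp_nonneg _)] at h1
    have hcm := (contDiff_mollify (φ n) hpl).continuous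
    rw [← integral_indicator hS]
    have e2 : ∫ v, (Metric.closedBall (0 : Vel d) (2 * R n)).indicator
        (fun v => mollify (φ n) p v ^ 2 * maxwellDensity β v) v =
        ∫ v in Metric.closedBall (0 : Vel d) (2 * R n), mollify (φ n) p v ^ 2 ∂(maxwell d β) := by
      rw [← integral_indicator hS, integral_maxwell hβ]
      refine integral_congr_ae (ae_of_all _ fun v => ?_)
      by_cases hv : v ∈ Metric.closedBall (0 : Vel d) (2 * R n)
      · simp only [Set.indicator_of_mem hv, smul_eq_mul]
        ring
      · simp only [Set.indicator_of_notMem hv, smul_zero]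
    rw [e2, integral_eq_lintegral_of_nonneg_ae (ae_of_all _ fun v => sq_nonneg _)
      (hcm.pow 2).aestronglyMeasurable]
    refine ENNReal.toReal_le_of_le_ofReal ?_ h1
    exact mul_nonneg (Real.exp_nonneg _) (integral_nonneg fun v => sq_nonneg _)
  have hF : ∀ n, ∫⁻ v, F n v ∂(maxwell d β) ≤
      ENNReal.ofReal (2 / β * ((1 + C) * (c * A) + 2 / β * (c * B))) := by
    intro n
    have hθd : ContDiff ℝ 1 (θ n) := (unitBump d).contDiff.comp (contDiff_const_smul _)
    have hθp : ∀ v, velPartial j (θ n) v = (R n)⁻¹ * velPartial j (unitBump d) ((R n)⁻¹ • v) := by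
      intro v
      have h1 := ((((unitBump d).contDiff (n := 1)).differentiable one_ne_zero)
        ((R n)⁻¹ • v)).hasFDerivAt.comp v ((hasFDerivAt_id v).const_smul (R n)⁻¹)
      have h2 : fderiv ℝ (θ n) v = _ := h1.fderiv
      rw [velPartial, h2]
      simp [velPartial]
    have hS : IsCompact (Metric.closedBall (0 : Vel d) (2 * R n)) := isCompact_closedBall _ _
    have hsub : tsupport (θ n) ⊆ Metric.closedBall (0 : Vel d) (2 * R n) := by
      refine closure_minimal (fun v hv => ?_) Metric.isClosed_closedBall
      have h1 : (R n)⁻¹ • v ∈ Function.support (unitBump d) := hv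
      rw [(unitBump d).support_eq] at h1
      have h2 : ‖(R n)⁻¹ • v‖ < 2 := by simpa [unitBump] using h1
      rw [norm_smul, norm_inv, Real.norm_of_nonneg (hR0 n).le, inv_mul_lt_iff₀ (hR0 n)] at h2
      simp only [Metric.mem_closedBall, dist_zero_right]
      linarith
    -- The expression v_j ∂_j θ is invariant under dilation of θ, so one constant serves every
    -- cutoff.
    have hCn : ∀ v, |v j * velPartial j (θ n) v| ≤ C := by
      intro v
      have := hC ((R n)⁻¹ • v)
      rw [hθp]
      convert this using 2
      simp
      ring
    have h1 := integral_sq_coord_mul_cutoff_le hβ (contDiff_mollify (φ n) hfl) hθd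
      (fun v => (unitBump d).nonneg) (fun v => (unitBump d).le_one) j hCn hS hsub
    rw [velPartial_mollify (φ n) hfl hw] at h1
    have h2 := hball n hf
    have h3 := hball n hh
    have h4 : ∫ v, v j ^ 2 * θ n v * mollify (φ n) f v ^ 2 * maxwellDensity β v ≤
        2 / β * ((1 + C) * (c * A) + 2 / β * (c * B)) := by
      have h5 : β / 2 * (∫ v, v j ^ 2 * θ n v * mollify (φ n) f v ^ 2 * maxwellDensity β v) ≤
          (1 + C) * (c * A) + 2 / β * (c * B) := by
        refine h1.trans (add_le_add ?_ ?_)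
        · exact mul_le_mul_of_nonneg_left h2 (by positivity)
        · exact mul_le_mul_of_nonneg_left h3 (by positivity)
      have h6 := mul_le_mul_of_nonneg_left h5 (by positivity : 0 ≤ 2 / β)
      rw [← mul_assoc, show 2 / β * (β / 2) = 1 by field_simp, one_mul] at h6
      exact h6
    have hcF : Continuous fun v => v j ^ 2 * θ n v * mollify (φ n) f v ^ 2 := by
      have := hθd.continuous
      have := (contDiff_mollify (φ n) hfl).continuous
      fun_prop
    have hsF : HasCompactSupport fun v => v j ^ 2 * θ n v * mollify (φ n) f v ^ 2 :=
      HasCompactSupport.mul_right (HasCompactSupport.mul_left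
        (hS.of_isClosed_subset (isClosed_tsupport _) hsub))
    have hiF : Integrable (fun v => v j ^ 2 * θ n v * mollify (φ n) f v ^ 2) (maxwell d β) := by
      rw [integrable_maxwell_iff hβ]
      exact ((maxwellDensity_continuous β).smul hcF).integrable_of_hasCompactSupport
        hsF.smul_left
    rw [← ofReal_integral_eq_lintegral_ofReal hiF (ae_of_all _ fun v => by
      have := (unitBump d).nonneg (x := (R n)⁻¹ • v)
      positivity)]
    apply ENNReal.ofReal_le_ofReal
    rw [integral_maxwell hβ]
    refine le_trans (le_of_eq ?_) h4
    refine integral_congr_ae (ae_of_all _ fun v => ?_)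
    simp only [smul_eq_mul]
    ring
  have hlimR : Tendsto R atTop atTop :=
    tendsto_atTop_add_const_right _ _ tendsto_natCast_atTop_atTop
  have hlim : ∀ᵐ v ∂(maxwell d β), Tendsto (fun n => F n v) atTop (𝓝 (‖v j * f v‖ₑ ^ 2)) := by
    have h1 : ∀ᵐ v : Vel d, Tendsto (fun n => mollify (φ n) f v) atTop (𝓝 (f v)) := by
      have := ContDiffBump.ae_convolution_tendsto_right_of_locallyIntegrable (μ := volume)
        (φ := φ) (l := atTop) (K := 2) (g := f)
        (by
          have := tendsto_inv_atTop_zero.comp hlimR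
          simpa [φ, Function.comp_def] using this)
        (Eventually.of_forall fun n => by
          have := hR0 n
          simp only [φ]
          apply le_of_eq
          field_simp) hfl
      simp_rw [mollify_eq_convolution]
      exact this
    filter_upwards [(maxwell_ac_volume d β).ae_le h1] with v hv
    have h2 : Tendsto (fun n => θ n v) atTop (𝓝 1) := by
      refine tendsto_const_nhds.congr' ?_
      filter_upwards [hlimR.eventually_ge_atTop ‖v‖] with n hn
      refine ((unitBump d).one_of_mem_closedBall ?_).symm
      have : ‖(R n)⁻¹ • v‖ ≤ 1 := by
        rw [norm_smul, norm_inv, Real.norm_of_nonneg (hR0 n).le, inv_mul_le_iff₀ (hR0 n)]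
        linarith
      simpa [unitBump] using this
    have h3 : Tendsto (fun n => v j ^ 2 * θ n v * mollify (φ n) f v ^ 2) atTop
        (𝓝 (v j ^ 2 * 1 * f v ^ 2)) := (h2.const_mul _).mul (hv.pow 2)
    have h4 := ENNReal.tendsto_ofReal h3
    convert h4 using 2
    rw [mul_one, ← mul_pow, ← sq_abs (v j * f v), ENNReal.ofReal_pow (abs_nonneg _),
      ← Real.norm_eq_abs, ofReal_norm]
  have hFm : ∀ n, Measurable (F n) := by
    intro n
    have h1 := ((unitBump d).continuous.comp (continuous_const_smul (R n)⁻¹))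
    have h2 := (contDiff_mollify (φ n) hfl).continuous
    have : Continuous fun v => v j ^ 2 * θ n v * mollify (φ n) f v ^ 2 :=
      ((by fun_prop : Continuous fun v : Vel d => v j ^ 2).mul h1).mul (h2.pow 2)
    exact this.measurable.ennreal_ofReal
  calc ∫⁻ v, ‖v j * f v‖ₑ ^ 2 ∂(maxwell d β)
      = ∫⁻ v, liminf (fun n => F n v) atTop ∂(maxwell d β) := by
        refine lintegral_congr_ae ?_
        filter_upwards [hlim] with v hv
        exact hv.liminf_eq.symm
    _ ≤ liminf (fun n => ∫⁻ v, F n v ∂(maxwell d β)) atTop := lintegral_liminf_le hFm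
    _ ≤ ENNReal.ofReal (2 / β * ((1 + C) * (c * A) + 2 / β * (c * B))) := by
        refine liminf_le_of_le (by isBoundedDefault) fun b hb => ?_
        obtain ⟨n, hn⟩ := hb.exists
        exact hn.trans (hF n)
    _ < ∞ := ENNReal.ofReal_lt_top

/-- Functions in `H¹_β` have a finite second moment. -/
lemma memLp_coord_mul_val {d : ℕ} {β : ℝ} {hβ : 0 < β} (g : H1 d hβ) (j : Fin d) :
    MemLp (fun v => ((v j : ℝ) : ℂ) * val g v) 2 (maxwell d β) := by
  have hg : MemLp (val g) 2 (maxwell d β) := Lp.memLp _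
  have hG : MemLp (fun v => grad g v j) 2 (maxwell d β) := memLp_coord (Lp.memLp _) j
  have hw := g.2
  have hi1 : ∀ η : Vel d → ℝ, ContDiff ℝ (⊤ : ℕ∞) η → HasCompactSupport η →
      Integrable (fun v => val g v * ((velPartial j η v : ℝ) : ℂ)) := fun η h1 h2 =>
    integrable_mul_test hβ hg (continuous_velPartial h1 j) (hasCompactSupport_velPartial h2 j)
  have hi2 : ∀ η : Vel d → ℝ, ContDiff ℝ (⊤ : ℕ∞) η → HasCompactSupport η →
      Integrable (fun v => grad g v j * ((η v : ℝ) : ℂ)) := fun η h1 h2 =>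
    integrable_mul_test hβ hG h1.continuous h2
  have hre : HasWeakPartial j (fun v => (val g v).re) (fun v => (grad g v j).re) := by
    intro η h1 h2
    have h := congrArg Complex.re (hw η h1 h2 j)
    rw [Complex.neg_re] at h
    have r1 := integral_re (hi1 η h1 h2)
    have r2 := integral_re (hi2 η h1 h2)
    simp only [RCLike.re_to_complex, Complex.re_mul_ofReal] at r1 r2
    rw [r1, r2]
    exact h
  have him : HasWeakPartial j (fun v => (val g v).im) (fun v => (grad g v j).im) := by
    intro η h1 h2
    have h := congrArg Complex.im (hw η h1 h2 j)
    rw [Complex.neg_im] at h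
    have r1 := integral_im (hi1 η h1 h2)
    have r2 := integral_im (hi2 η h1 h2)
    simp only [RCLike.im_to_complex, Complex.im_mul_ofReal] at r1 r2
    rw [r1, r2]
    exact h
  have m1 := memLp_coord_mul_of_hasWeakPartial hβ hg.re hG.re hre
  have m2 := memLp_coord_mul_of_hasWeakPartial hβ hg.im hG.im him
  have m3 := (m1.ofReal (K := ℂ)).add ((m2.ofReal (K := ℂ)).const_mul Complex.I)
  refine m3.ae_eq (ae_of_all _ fun v => ?_)
  simp only [Pi.add_apply, RCLike.re_to_complex, RCLike.im_to_complex, Complex.coe_algebraMap]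
  conv_rhs => rw [← Complex.re_add_im (val g v)]
  push_cast
  ring

end LenardBalescu
end

noncomputable section

namespace LenardBalescu

/-! ### Fourier series on the torus -/

open UnitAddTorus in
lemma mFourierCoeff_eq_integral_torusMeasure {d : ℕ} (f : Torus d → ℂ) (n : Fin d → ℤ) :
    mFourierCoeff f n = ∫ x, mFourier (-n) x * f x ∂(torusMeasure d) := rfl

open UnitAddTorus in
lemma norm_mFourier_apply {d : ℕ} (n : Fin d → ℤ) (x : Torus d) : ‖mFourier n x‖ = 1 := by
  simp [mFourier, fourier_apply, norm_prod, Circle.norm_coe]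

open UnitAddTorus in
/-- The Fourier monomials as an orthonormal basis of `L²` for `torusMeasure`. -/
def torusBasis (d : ℕ) : HilbertBasis (Fin d → ℤ) ℂ (Lp ℂ 2 (torusMeasure d)) :=
  mFourierBasis (d := Fin d)

open UnitAddTorus in
lemma coeFn_torusBasis {d : ℕ} (n : Fin d → ℤ) :
    torusBasis d n =ᵐ[torusMeasure d] mFourier n := by
  have h : torusBasis d n = mFourierLp 2 n := congrFun (coe_mFourierBasis (d := Fin d)) n
  rw [h]
  exact coeFn_mFourierLp 2 n

open UnitAddTorus in
lemma torusBasis_repr {d : ℕ} (f : Lp ℂ 2 (torusMeasure d)) (n : Fin d → ℤ) :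
    (torusBasis d).repr f n = mFourierCoeff f n :=
  mFourierBasis_repr (d := Fin d) f n

open UnitAddTorus in
lemma mFourierCoeff_congr_ae {d : ℕ} {f h : Torus d → ℂ} (hfh : f =ᵐ[torusMeasure d] h)
    (n : Fin d → ℤ) : mFourierCoeff f n = mFourierCoeff h n := by
  rw [mFourierCoeff_eq_integral_torusMeasure, mFourierCoeff_eq_integral_torusMeasure]
  refine integral_congr_ae ?_
  filter_upwards [hfh] with x hx
  rw [hx]

open UnitAddTorus in
lemma ae_eq_zero_of_mFourierCoeff {d : ℕ} {f : Torus d → ℂ} (hf : MemLp f 2 (torusMeasure d))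
    (h : ∀ n, mFourierCoeff f n = 0) : f =ᵐ[torusMeasure d] 0 := by
  have h1 : hf.toLp f = 0 := by
    apply (torusBasis d).repr.injective
    ext n
    rw [torusBasis_repr, mFourierCoeff_congr_ae hf.coeFn_toLp, h, map_zero]
    rfl
  have h2 := hf.coeFn_toLp
  rw [h1] at h2
  exact h2.symm.trans (Lp.coeFn_zero _ _ _)

open UnitAddTorus in
lemma hasSum_sq_norm_mFourierCoeff {d : ℕ} {f : Torus d → ℂ} (hf : MemLp f 2 (torusMeasure d)) :
    HasSum (fun n => ‖mFourierCoeff f n‖ ^ 2) (∫ x, ‖f x‖ ^ 2 ∂(torusMeasure d)) := by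
  have h : HasSum (fun n => ‖mFourierCoeff (hf.toLp f) n‖ ^ 2)
      (∫ x, ‖hf.toLp f x‖ ^ 2 ∂(torusMeasure d)) := hasSum_sq_mFourierCoeff (d := Fin d) (hf.toLp f)
  have e : ∫ x, ‖hf.toLp f x‖ ^ 2 ∂(torusMeasure d) = ∫ x, ‖f x‖ ^ 2 ∂(torusMeasure d) := by
    refine integral_congr_ae ?_
    filter_upwards [hf.coeFn_toLp] with x hx
    rw [hx]
  rw [e] at h
  simpa only [mFourierCoeff_congr_ae hf.coeFn_toLp] using h

open UnitAddTorus in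
lemma tendsto_eLpNorm_sub_fourierSum {d : ℕ} {f : Torus d → ℂ} (hf : MemLp f 2 (torusMeasure d)) :
    Tendsto (fun s : Finset (Fin d → ℤ) =>
      eLpNorm (fun x => f x - ∑ n ∈ s, mFourierCoeff f n * mFourier n x) 2 (torusMeasure d))
      atTop (𝓝 0) := by
  have h := (torusBasis d).hasSum_repr (hf.toLp f)
  have h1 : Tendsto (fun s : Finset (Fin d → ℤ) =>
      hf.toLp f - ∑ n ∈ s, (torusBasis d).repr (hf.toLp f) n • torusBasis d n) atTop (𝓝 0) := by
    have := (tendsto_const_nhds (x := hf.toLp f)).sub h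
    rwa [sub_self] at this
  have h2 := (Lp.tendsto_Lp_iff_tendsto_eLpNorm' _ _).1 h1
  refine h2.congr fun s => eLpNorm_congr_ae ?_
  have h3 : ∀ᵐ x ∂(torusMeasure d), ∀ n ∈ s, torusBasis d n x = mFourier n x :=
    (Finset.eventually_all s).2 fun n _ => coeFn_torusBasis n
  have h4 : ∀ᵐ x ∂(torusMeasure d), ∀ n ∈ s,
      ((torusBasis d).repr (hf.toLp f) n • torusBasis d n : Lp ℂ 2 (torusMeasure d)) x =
        (torusBasis d).repr (hf.toLp f) n • torusBasis d n x :=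
    (Finset.eventually_all s).2 fun n _ => Lp.coeFn_smul _ _
  filter_upwards [hf.coeFn_toLp, h3, h4, Lp.coeFn_zero ℂ 2 (torusMeasure d),
    Lp.coeFn_sub (hf.toLp f) (∑ n ∈ s, (torusBasis d).repr (hf.toLp f) n • torusBasis d n),
    Lp.coeFn_fun_finsetSum s (fun n => (torusBasis d).repr (hf.toLp f) n • torusBasis d n)]
    with x hx1 hx3 hx4 hx5 hx6 hx7
  rw [Pi.sub_apply, hx5, Pi.zero_apply, sub_zero, hx6, Pi.sub_apply, hx1, hx7]
  congr 1
  refine Finset.sum_congr rfl fun n hn => ?_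
  rw [hx4 n hn, hx3 n hn, torusBasis_repr, mFourierCoeff_congr_ae hf.coeFn_toLp, smul_eq_mul]

open UnitAddTorus in
lemma mFourier_add_toTorus {d : ℕ} (n : Fin d → ℤ) (x : Torus d) (y : Vel d) :
    mFourier n (x + toTorus y) =
      mFourier n x * Complex.exp (Complex.I * (inner ℝ (waveVec n) y : ℝ)) := by
  have h1 : mFourier n (x + toTorus y) = mFourier n x * mFourier n (toTorus y) := by
    simp [mFourier, fourier_apply, Finset.prod_mul_distrib, AddCircle.toCircle_add]
  rw [h1]
  congr 1
  simp only [mFourier, toTorus, ContinuousMap.coe_mk, fourier_coe_apply]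
  rw [← Complex.exp_sum]
  congr 1
  rw [PiLp.inner_apply, Complex.ofReal_sum, Finset.mul_sum]
  refine Finset.sum_congr rfl fun i _ => ?_
  simp [waveVec]
  ring

open UnitAddTorus in
lemma mFourier_add_arg {d : ℕ} (n : Fin d → ℤ) (x y : Torus d) :
    mFourier n (x + y) = mFourier n x * mFourier n y := by
  simp [mFourier, fourier_apply, Finset.prod_mul_distrib, AddCircle.toCircle_add]

@[simp] lemma waveVec_neg {d : ℕ} (n : Fin d → ℤ) : waveVec (-n) = -waveVec n := by
  ext i; simp [waveVec]

lemma waveVec_eq_zero_iff {d : ℕ} {n : Fin d → ℤ} : waveVec n = 0 ↔ n = 0 := by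
  constructor
  · intro h
    funext i
    have := congrArg (fun w : Vel d => w i) h
    simpa [waveVec, Real.pi_ne_zero] using this
  · rintro rfl
    ext i; simp [waveVec]

/-- Allows |k| to be replaced by |k|² in the bounds on the flux. -/
lemma one_le_norm_waveVec {d : ℕ} {n : Fin d → ℤ} (hn : waveVec n ≠ 0) : 1 ≤ ‖waveVec n‖ := by
  have hn0 : n ≠ 0 := fun h => hn (waveVec_eq_zero_iff.2 h)
  obtain ⟨i, hi⟩ := Function.ne_iff.1 hn0
  have h1 : |waveVec n i| ≤ ‖waveVec n‖ := by
    simpa using PiLp.norm_apply_le (waveVec n) i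
  refine le_trans ?_ h1
  have h2 : (1 : ℝ) ≤ |(n i : ℝ)| := by
    have := Int.one_le_abs hi
    exact_mod_cast this
  have h3 : |waveVec n i| = 2 * Real.pi * |(n i : ℝ)| := by
    simp [waveVec, abs_mul, abs_of_pos Real.pi_pos]
  rw [h3]
  nlinarith [Real.pi_gt_three]

/-! ### Fourier coefficients of the potential and of its gradient -/

lemma integrable_of_memLp_top {d : ℕ} {E : Type*} [NormedAddCommGroup E]
    {f : Torus d → E} (hf : MemLp f ∞ (torusMeasure d)) : Integrable f (torusMeasure d) :=
  memLp_one_iff_integrable.1 (hf.mono_exponent le_top)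

lemma memLp_top_grad_coord {d : ℕ} {V : Torus d → ℝ} {W : Torus d → Vel d} {K : ℝ≥0}
    (h : IsW1Infty V W K) (j : Fin d) :
    MemLp (fun x => ((W x j : ℝ) : ℂ)) ∞ (torusMeasure d) := by
  have h1 : MemLp (fun x => W x j) ∞ (torusMeasure d) :=
    (EuclideanSpace.proj (𝕜 := ℝ) j : Vel d →L[ℝ] ℝ).comp_memLp' h.memLp_grad
  exact h1.ofReal

lemma ae_norm_grad_le {d : ℕ} {V : Torus d → ℝ} {W : Torus d → Vel d} {K : ℝ≥0}
    (h : IsW1Infty V W K) : ∀ᵐ x ∂(torusMeasure d), ‖W x‖ ≤ K := by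
  have h1 : eLpNorm W ∞ (torusMeasure d) ≤ K := le_trans le_add_self h.norm_le
  rw [eLpNorm_exponent_top] at h1
  filter_upwards [ae_le_eLpNormEssSup (f := W) (μ := torusMeasure d)] with x hx
  have := hx.trans h1
  rw [← ofReal_norm, ENNReal.ofReal_le_iff_le_toReal (by simp)] at this
  simpa using this

lemma ae_norm_potential_le {d : ℕ} {V : Torus d → ℝ} {W : Torus d → Vel d} {K : ℝ≥0}
    (h : IsW1Infty V W K) : ∀ᵐ x ∂(torusMeasure d), ‖V x‖ ≤ K := by
  have h1 : eLpNorm V ∞ (torusMeasure d) ≤ K := le_trans le_self_add h.norm_le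
  rw [eLpNorm_exponent_top] at h1
  filter_upwards [ae_le_eLpNormEssSup (f := V) (μ := torusMeasure d)] with x hx
  have := hx.trans h1
  rw [← ofReal_norm, ENNReal.ofReal_le_iff_le_toReal (by simp)] at this
  simpa using this

open UnitAddTorus in
lemma Vhat_le {d : ℕ} {V : Torus d → ℝ} {W : Torus d → Vel d} {K : ℝ≥0}
    (h : IsW1Infty V W K) (n : Fin d → ℤ) : Vhat V n ≤ K := by
  refine (Complex.re_le_norm _).trans ?_
  rw [fourierV, mFourierCoeff_eq_integral_torusMeasure]
  refine (norm_integral_le_of_norm_le_const (C := (K : ℝ)) ?_).trans (by simp)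
  filter_upwards [ae_norm_potential_le h] with x hx
  rw [norm_mul, norm_mFourier_apply, one_mul, Complex.norm_real]
  exact hx

open UnitAddTorus in
lemma Vhat_neg {d : ℕ} (V : Torus d → ℝ) (n : Fin d → ℤ) : Vhat V (-n) = Vhat V n := by
  have : fourierV V (-n) = starRingEnd ℂ (fourierV V n) := by
    rw [fourierV, fourierV, mFourierCoeff_eq_integral_torusMeasure,
      mFourierCoeff_eq_integral_torusMeasure, ← integral_conj]
    refine integral_congr_ae (ae_of_all _ fun x => ?_)
    simp only [map_mul, Complex.conj_ofReal]
    rw [← mFourier_neg]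
  rw [Vhat, this, Complex.conj_re, Vhat]

lemma fourierV_eq {d : ℕ} {V : Torus d → ℝ} (hV : PosDefPotential V) (n : Fin d → ℤ) :
    fourierV V n = (Vhat V n : ℂ) := by
  apply Complex.ext
  · simp [Vhat]
  · simp [(hV n).2]

open UnitAddTorus in
lemma hasDerivAt_mFourier_line {d : ℕ} (n : Fin d → ℤ) (x : Torus d) (y : Vel d) (s : ℝ) :
    HasDerivAt (fun s : ℝ => mFourier n (x + toTorus (s • y)))
      (Complex.I * (inner ℝ (waveVec n) y : ℝ) * mFourier n (x + toTorus (s • y))) s := by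
  have e : ∀ s : ℝ, mFourier n (x + toTorus (s • y)) =
      mFourier n x * Complex.exp ((s : ℂ) * (Complex.I * (inner ℝ (waveVec n) y : ℝ))) := by
    intro s
    rw [mFourier_add_toTorus, inner_smul_right]
    congr 2
    push_cast
    ring
  have h0 : HasDerivAt (fun s : ℝ => (s : ℂ) * (Complex.I * (inner ℝ (waveVec n) y : ℝ)))
      (1 * (Complex.I * (inner ℝ (waveVec n) y : ℝ))) s :=
    (Complex.ofRealCLM.hasDerivAt (x := s)).mul_const _
  have h := h0.cexp.const_mul (mFourier n x)
  simp only [e]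
  convert! h using 1
  ring

open UnitAddTorus in
lemma contDiff_mFourier_toTorus {d : ℕ} (n : Fin d → ℤ) :
    ContDiff ℝ (⊤ : ℕ∞) (fun y : Vel d => mFourier n (toTorus y)) := by
  have e : (fun y : Vel d => mFourier n (toTorus y)) =
      fun y => Complex.exp (Complex.I * (inner ℝ (waveVec n) y : ℝ)) := by
    funext y
    have := mFourier_add_toTorus n 0 y
    rw [zero_add] at this
    rw [this]
    simp [mFourier]
  rw [e]
  have h1 : ContDiff ℝ (⊤ : ℕ∞) fun y : Vel d => ((inner ℝ (waveVec n) y : ℝ) : ℂ) :=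
    Complex.ofRealCLM.contDiff.comp (contDiff_const.inner ℝ contDiff_id)
  exact (contDiff_const.mul h1).cexp

open UnitAddTorus in
-- The weak gradient is tested against exp(-ik·x). Test functions are real, so the real and
-- imaginary parts are used separately.
lemma mFourierCoeff_grad {d : ℕ} {V : Torus d → ℝ} {W : Torus d → Vel d} {K : ℝ≥0}
    (h : IsW1Infty V W K) (hV : PosDefPotential V) (n : Fin d → ℤ) (j : Fin d) :
    mFourierCoeff (fun x => ((W x j : ℝ) : ℂ)) n =
      Complex.I * (waveVec n j : ℝ) * (Vhat V n : ℝ) := by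
  set a : Torus d → ℂ := fun x => mFourier (-n) x with ha
  have hac : Continuous a := (mFourier (-n)).continuous
  have hVi : Integrable (fun x => ((V x : ℝ) : ℂ)) (torusMeasure d) :=
    (integrable_of_memLp_top h.memLp).ofReal
  have hWi : Integrable (fun x => ((W x j : ℝ) : ℂ)) (torusMeasure d) :=
    integrable_of_memLp_top (memLp_top_grad_coord h j)
  have hmul : ∀ {f : Torus d → ℂ}, Integrable f (torusMeasure d) →
      Integrable (fun x => f x * a x) (torusMeasure d) := fun hf =>
    hf.mul_bdd (c := 1) hac.aestronglyMeasurable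
      (ae_of_all _ fun x => (norm_mFourier_apply _ x).le)
  have hder : ∀ x, HasDerivAt (fun s : ℝ => a (x + toTorus (EuclideanSpace.single j s)))
      (Complex.I * (-(waveVec n j) : ℝ) * a x) 0 := by
    intro x
    have h1 := hasDerivAt_mFourier_line (-n) x (EuclideanSpace.single j (1 : ℝ)) 0
    have e : ∀ s : ℝ, s • (EuclideanSpace.single j (1 : ℝ) : Vel d) =
        EuclideanSpace.single j s := by
      intro s; ext i; by_cases hi : i = j <;> simp [hi]
    have e0 : toTorus (EuclideanSpace.single j (0 : ℝ) : Vel d) = 0 := by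
      funext i; by_cases hi : i = j <;> simp [toTorus, hi]
    simp only [e, e0, add_zero] at h1
    convert! h1 using 3
    simp [EuclideanSpace.inner_single_right]
  have hsm := contDiff_mFourier_toTorus (-n)
  have hre := h.weakGrad (fun x => (a x).re) (Complex.reCLM.contDiff.comp hsm) j
  have him := h.weakGrad (fun x => (a x).im) (Complex.imCLM.contDiff.comp hsm) j
  have dre : ∀ x, torusPartial j (fun x => (a x).re) x =
      (Complex.I * (-(waveVec n j) : ℝ) * a x).re := fun x =>
    (Complex.reCLM.hasFDerivAt.comp_hasDerivAt (0 : ℝ) (hder x)).deriv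
  have dim : ∀ x, torusPartial j (fun x => (a x).im) x =
      (Complex.I * (-(waveVec n j) : ℝ) * a x).im := fun x =>
    (Complex.imCLM.hasFDerivAt.comp_hasDerivAt (0 : ℝ) (hder x)).deriv
  simp only [dre] at hre
  simp only [dim] at him
  have iV : Integrable (fun x => ((V x : ℝ) : ℂ) * (Complex.I * (-(waveVec n j) : ℝ) * a x))
      (torusMeasure d) := by
    refine ((hmul hVi).const_mul (Complex.I * (-(waveVec n j) : ℝ))).congr
      (ae_of_all _ fun x => ?_)
    simp only []
    ring
  have key : ∫ x, ((V x : ℝ) : ℂ) * (Complex.I * (-(waveVec n j) : ℝ) * a x) ∂(torusMeasure d) =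
      -∫ x, ((W x j : ℝ) : ℂ) * a x ∂(torusMeasure d) := by
    apply Complex.ext
    · have r1 := integral_re iV
      have r2 := integral_re (hmul hWi)
      simp only [RCLike.re_to_complex, Complex.re_ofReal_mul] at r1 r2
      rw [Complex.neg_re, ← r1, ← r2]
      exact hre
    · have r1 := integral_im iV
      have r2 := integral_im (hmul hWi)
      simp only [RCLike.im_to_complex, Complex.im_ofReal_mul] at r1 r2
      rw [Complex.neg_im, ← r1, ← r2]
      exact him
  have e1 : ∫ x, ((V x : ℝ) : ℂ) * (Complex.I * (-(waveVec n j) : ℝ) * a x) ∂(torusMeasure d) =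
      Complex.I * (-(waveVec n j) : ℝ) * fourierV V n := by
    rw [fourierV, mFourierCoeff_eq_integral_torusMeasure, ← integral_const_mul]
    refine integral_congr_ae (ae_of_all _ fun x => ?_)
    simp only [ha]
    ring
  have e2 : ∫ x, ((W x j : ℝ) : ℂ) * a x ∂(torusMeasure d) =
      mFourierCoeff (fun x => ((W x j : ℝ) : ℂ)) n := by
    rw [mFourierCoeff_eq_integral_torusMeasure]
    refine integral_congr_ae (ae_of_all _ fun x => ?_)
    simp only [ha]
    ring
  rw [e1, e2, fourierV_eq hV] at key
  rw [eq_neg_iff_add_eq_zero, add_comm, ← eq_neg_iff_add_eq_zero] at key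
  rw [key]
  push_cast
  ring

/-- `Σ |k|² V̂(k)² ≤ K²`. -/
lemma summable_sq_waveVec_mul_Vhat {d : ℕ} {V : Torus d → ℝ} {W : Torus d → Vel d} {K : ℝ≥0}
    (h : IsW1Infty V W K) (hV : PosDefPotential V) :
    Summable (fun n : Fin d → ℤ => ‖waveVec n‖ ^ 2 * Vhat V n ^ 2) ∧
      ∑' n : Fin d → ℤ, ‖waveVec n‖ ^ 2 * Vhat V n ^ 2 ≤ (K : ℝ) ^ 2 := by
  have hm : ∀ j, MemLp (fun x => ((W x j : ℝ) : ℂ)) 2 (torusMeasure d) := fun j =>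
    (memLp_top_grad_coord h j).mono_exponent le_top
  -- Parseval for each component of ∇V, summed over the components; the torus has mass 1, so
  -- ‖∇V‖²_{L²} ≤ K².
  have h1 := hasSum_sum (s := Finset.univ) fun j _ => hasSum_sq_norm_mFourierCoeff (hm j)
  have e : ∀ n : Fin d → ℤ, ∑ j, ‖UnitAddTorus.mFourierCoeff
      (fun x => ((W x j : ℝ) : ℂ)) n‖ ^ 2 = ‖waveVec n‖ ^ 2 * Vhat V n ^ 2 := by
    intro n
    rw [EuclideanSpace.norm_sq_eq, Finset.sum_mul]
    refine Finset.sum_congr rfl fun j _ => ?_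
    rw [mFourierCoeff_grad h hV]
    simp [mul_pow]
  simp only [e] at h1
  refine ⟨h1.summable, ?_⟩
  rw [h1.tsum_eq, ← integral_finsetSum _ fun j _ => (hm j).integrable_norm_pow two_ne_zero]
  have e2 : ∀ x, ∑ j, ‖((W x j : ℝ) : ℂ)‖ ^ 2 = ‖W x‖ ^ 2 := by
    intro x
    rw [EuclideanSpace.norm_sq_eq]
    simp
  simp only [e2]
  have h3 : ∫ x, ‖W x‖ ^ 2 ∂(torusMeasure d) ≤ ∫ _, (K : ℝ) ^ 2 ∂(torusMeasure d) := by
    refine integral_mono_of_nonneg (ae_of_all _ fun x => by positivity) (integrable_const _) ?_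
    filter_upwards [ae_norm_grad_le h] with x hx
    gcongr
  simpa using h3

end LenardBalescu
end

noncomputable section

namespace LenardBalescu

/-! ### Translation-invariant functions on the two-particle phase space -/

instance (d : ℕ) : (torusMeasure d).IsAddHaarMeasure := by
  unfold torusMeasure; infer_instance

/-- The measure `M_β(v₀) M_β(v₁) dv₀ dv₁`. -/
def velMeasure2 (d : ℕ) (β : ℝ) : Measure (Vel d × Vel d) := (maxwell d β).prod (maxwell d β)

instance (d : ℕ) (β : ℝ) : SFinite (velMeasure2 d β) := by
  unfold velMeasure2; infer_instance

instance (d : ℕ) (β : ℝ) : SFinite (phaseMeasure2 d β) := by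
  unfold phaseMeasure2; infer_instance

lemma isProbabilityMeasure_velMeasure2 (d : ℕ) {β : ℝ} (hβ : 0 < β) :
    IsProbabilityMeasure (velMeasure2 d β) := by
  have := isProbabilityMeasure_maxwell d hβ
  unfold velMeasure2; infer_instance

lemma isProbabilityMeasure_phaseMeasure (d : ℕ) {β : ℝ} (hβ : 0 < β) :
    IsProbabilityMeasure (phaseMeasure d β) := by
  have := isProbabilityMeasure_maxwell d hβ
  unfold phaseMeasure; infer_instance

lemma isProbabilityMeasure_phaseMeasure2 (d : ℕ) {β : ℝ} (hβ : 0 < β) :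
    IsProbabilityMeasure (phaseMeasure2 d β) := by
  have := isProbabilityMeasure_phaseMeasure d hβ
  unfold phaseMeasure2; infer_instance

/-- Positions first, velocities second. -/
def regroup {d : ℕ} (z : Phase d × Phase d) : (Torus d × Torus d) × (Vel d × Vel d) :=
  ((z.1.1, z.2.1), (z.1.2, z.2.2))

lemma measurePreserving_regroup (d : ℕ) (β : ℝ) :
    MeasurePreserving (regroup (d := d)) (phaseMeasure2 d β)
      (((torusMeasure d).prod (torusMeasure d)).prod (velMeasure2 d β)) := by
  unfold phaseMeasure2 phaseMeasure velMeasure2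
  set T := torusMeasure d
  set M := maxwell d β
  have h1 := measurePreserving_prodAssoc T M (T.prod M)
  have h2 : MeasurePreserving (Prod.map id MeasurableEquiv.prodAssoc.symm)
      (T.prod (M.prod (T.prod M))) (T.prod ((M.prod T).prod M)) :=
    (MeasurePreserving.id T).prod (measurePreserving_prodAssoc M T M).symm
  have h3 : MeasurePreserving (Prod.map id (Prod.map Prod.swap id))
      (T.prod ((M.prod T).prod M)) (T.prod ((T.prod M).prod M)) :=
    (MeasurePreserving.id T).prod (Measure.measurePreserving_swap.prod (MeasurePreserving.id M))
  have h4 : MeasurePreserving (Prod.map id MeasurableEquiv.prodAssoc)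
      (T.prod ((T.prod M).prod M)) (T.prod (T.prod (M.prod M))) :=
    (MeasurePreserving.id T).prod (measurePreserving_prodAssoc T M M)
  have h5 := (measurePreserving_prodAssoc T T (M.prod M)).symm
  exact h5.comp (h4.comp (h3.comp (h2.comp h1)))

/-- The relative position and the two velocities. -/
def relCoord {d : ℕ} (z : Phase d × Phase d) : Torus d × (Vel d × Vel d) :=
  (z.1.1 - z.2.1, (z.1.2, z.2.2))

/-- The difference of two independent uniform points of the torus is uniform, so functions of x₀ -
x₁ can be integrated on a single torus. -/
lemma measurePreserving_relCoord (d : ℕ) (β : ℝ) :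
    MeasurePreserving (relCoord (d := d)) (phaseMeasure2 d β)
      ((torusMeasure d).prod (velMeasure2 d β)) := by
  have h1 : MeasurePreserving (fun x : Torus d × Torus d => x.1 - x.2)
      ((torusMeasure d).prod (torusMeasure d)) (torusMeasure d) :=
    measurePreserving_fst.comp (measurePreserving_sub_prod (torusMeasure d) (torusMeasure d))
  exact (h1.prod (MeasurePreserving.id (velMeasure2 d β))).comp (measurePreserving_regroup d β)

/-- The function `f(x₀ - x₁) ψ(v₀, v₁)`. -/
def rel {d : ℕ} (f : Torus d → ℂ) (ψ : Vel d × Vel d → ℂ) (z : Phase d × Phase d) : ℂ :=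
  f (z.1.1 - z.2.1) * ψ (z.1.2, z.2.2)

lemma integral_rel {d : ℕ} {β : ℝ} {f : Torus d → ℂ} {ψ : Vel d × Vel d → ℂ}
    (hf : AEStronglyMeasurable f (torusMeasure d)) (hψ : AEStronglyMeasurable ψ (velMeasure2 d β)) :
    ∫ z, rel f ψ z ∂(phaseMeasure2 d β) =
      (∫ x, f x ∂(torusMeasure d)) * ∫ v, ψ v ∂(velMeasure2 d β) := by
  have hmp := measurePreserving_relCoord d β
  have h1 : ∫ z, (fun p : Torus d × (Vel d × Vel d) => f p.1 * ψ p.2) (relCoord z)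
      ∂(phaseMeasure2 d β) = ∫ p, f p.1 * ψ p.2 ∂((torusMeasure d).prod (velMeasure2 d β)) := by
    rw [← hmp.map_eq, integral_map hmp.measurable.aemeasurable]
    rw [hmp.map_eq]
    exact hf.comp_fst.mul hψ.comp_snd
  rw [← integral_prod_mul]
  exact h1

lemma eLpNorm_two_prod_mul {α γ : Type*} [MeasurableSpace α] [MeasurableSpace γ] {μ : Measure α}
    {ν : Measure γ} [SFinite ν] {f : α → ℂ} {ψ : γ → ℂ}
    (hf : AEStronglyMeasurable f μ) (hψ : AEStronglyMeasurable ψ ν) :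
    eLpNorm (fun p : α × γ => f p.1 * ψ p.2) 2 (μ.prod ν) = eLpNorm f 2 μ * eLpNorm ψ 2 ν := by
  rw [eLpNorm_eq_lintegral_rpow_enorm_toReal (by norm_num) (by norm_num),
    eLpNorm_eq_lintegral_rpow_enorm_toReal (by norm_num) (by norm_num),
    eLpNorm_eq_lintegral_rpow_enorm_toReal (by norm_num) (by norm_num),
    ← ENNReal.mul_rpow_of_nonneg _ _ (by positivity), ← lintegral_prod_mul
      (hf.enorm.pow_const _) (hψ.enorm.pow_const _)]
  congr 1
  refine lintegral_congr fun p => ?_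
  rw [enorm_mul, ENNReal.mul_rpow_of_nonneg _ _ (by positivity)]

lemma eLpNorm_rel {d : ℕ} {β : ℝ} {f : Torus d → ℂ} {ψ : Vel d × Vel d → ℂ}
    (hf : AEStronglyMeasurable f (torusMeasure d)) (hψ : AEStronglyMeasurable ψ (velMeasure2 d β)) :
    eLpNorm (rel f ψ) 2 (phaseMeasure2 d β) =
      eLpNorm f 2 (torusMeasure d) * eLpNorm ψ 2 (velMeasure2 d β) := by
  have h : AEStronglyMeasurable (fun p : Torus d × (Vel d × Vel d) => f p.1 * ψ p.2)
      ((torusMeasure d).prod (velMeasure2 d β)) := hf.comp_fst.mul hψ.comp_snd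
  have e : rel f ψ = (fun p : Torus d × (Vel d × Vel d) => f p.1 * ψ p.2) ∘ relCoord := rfl
  rw [e, eLpNorm_comp_measurePreserving h (measurePreserving_relCoord d β),
    eLpNorm_two_prod_mul hf hψ]

lemma aestronglyMeasurable_rel {d : ℕ} {β : ℝ} {f : Torus d → ℂ} {ψ : Vel d × Vel d → ℂ}
    (hf : AEStronglyMeasurable f (torusMeasure d)) (hψ : AEStronglyMeasurable ψ (velMeasure2 d β)) :
    AEStronglyMeasurable (rel f ψ) (phaseMeasure2 d β) := by
  have h : AEStronglyMeasurable (fun p : Torus d × (Vel d × Vel d) => f p.1 * ψ p.2)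
      ((torusMeasure d).prod (velMeasure2 d β)) := hf.comp_fst.mul hψ.comp_snd
  exact h.comp_measurePreserving (measurePreserving_relCoord d β)

lemma memLp_rel {d : ℕ} {β : ℝ} {f : Torus d → ℂ} {ψ : Vel d × Vel d → ℂ}
    (hf : MemLp f 2 (torusMeasure d)) (hψ : MemLp ψ 2 (velMeasure2 d β)) :
    MemLp (rel f ψ) 2 (phaseMeasure2 d β) := by
  refine ⟨aestronglyMeasurable_rel hf.1 hψ.1, ?_⟩
  rw [eLpNorm_rel hf.1 hψ.1]
  exact ENNReal.mul_lt_top hf.2 hψ.2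

lemma memLp_mFourier {d : ℕ} (n : Fin d → ℤ) :
    MemLp (UnitAddTorus.mFourier n) 2 (torusMeasure d) :=
  MemLp.of_bound (UnitAddTorus.mFourier n).continuous.aestronglyMeasurable 1
    (ae_of_all _ fun x => (norm_mFourier_apply n x).le)

/-- The function `exp(i k·(x₀ - x₁)) ψ(v₀, v₁)` with `k = 2π n`. -/
def mode {d : ℕ} (n : Fin d → ℤ) (ψ : Vel d × Vel d → ℂ) : Phase d × Phase d → ℂ :=
  rel (UnitAddTorus.mFourier n) ψ

lemma memLp_mode {d : ℕ} {β : ℝ} (n : Fin d → ℤ) {ψ : Vel d × Vel d → ℂ}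
    (hψ : MemLp ψ 2 (velMeasure2 d β)) : MemLp (mode n ψ) 2 (phaseMeasure2 d β) :=
  memLp_rel (memLp_mFourier n) hψ

/-- `mode n ψ` as an element of `L²_β(𝔻²)`. -/
def modeLp {d : ℕ} {β : ℝ} (n : Fin d → ℤ) (ψ : Vel d × Vel d → ℂ)
    (hψ : MemLp ψ 2 (velMeasure2 d β)) : L2Phase2 d β :=
  (memLp_mode n hψ).toLp (mode n ψ)

lemma integral_mFourier_mul {d : ℕ} (m n : Fin d → ℤ) :
    ∫ x, UnitAddTorus.mFourier (-m) x * UnitAddTorus.mFourier n x ∂(torusMeasure d) =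
      if m = n then 1 else 0 := by
  have h := orthonormal_iff_ite.1 (torusBasis d).orthonormal m n
  rw [← h, L2.inner_def]
  refine integral_congr_ae ?_
  filter_upwards [coeFn_torusBasis m, coeFn_torusBasis n] with x h1 h2
  rw [h1, h2, RCLike.inner_apply, ← UnitAddTorus.mFourier_neg, mul_comm]

lemma norm_modeLp_sq {d : ℕ} {β : ℝ} (n : Fin d → ℤ) {ψ : Vel d × Vel d → ℂ}
    (hψ : MemLp ψ 2 (velMeasure2 d β)) :
    ‖modeLp n ψ hψ‖ ^ 2 = ∫ v, ‖ψ v‖ ^ 2 ∂(velMeasure2 d β) := by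
  have h1 : eLpNorm (UnitAddTorus.mFourier n) 2 (torusMeasure d) = 1 := by
    have : eLpNorm (UnitAddTorus.mFourier n) 2 (torusMeasure d) =
        eLpNorm (fun _ : Torus d => (1 : ℂ)) 2 (torusMeasure d) :=
      eLpNorm_congr_norm_ae (ae_of_all _ fun x => by simp [norm_mFourier_apply])
    rw [this, eLpNorm_const (1 : ℂ) (by norm_num) (NeZero.ne _)]
    simp
  have h2 : ‖modeLp n ψ hψ‖ = ‖hψ.toLp ψ‖ := by
    rw [modeLp, Lp.norm_toLp, Lp.norm_toLp, mode,
      eLpNorm_rel (memLp_mFourier n).1 hψ.1, h1, one_mul]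
  rw [h2, ← inner_self_eq_norm_sq (𝕜 := ℂ), L2.inner_def, ← integral_re (L2.integrable_inner _ _)]
  refine integral_congr_ae ?_
  filter_upwards [hψ.coeFn_toLp] with v hv
  rw [hv, inner_self_eq_norm_sq]

lemma inner_modeLp_of_ne {d : ℕ} {β : ℝ} {m n : Fin d → ℤ} (hmn : m ≠ n) {ψ χ : Vel d × Vel d → ℂ}
    (hψ : MemLp ψ 2 (velMeasure2 d β)) (hχ : MemLp χ 2 (velMeasure2 d β)) :
    inner ℂ (modeLp m ψ hψ) (modeLp n χ hχ) = 0 := by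
  rw [L2.inner_def]
  have e : ∫ z, inner ℂ (modeLp m ψ hψ z) (modeLp n χ hχ z) ∂(phaseMeasure2 d β) =
      ∫ z, rel (fun x => UnitAddTorus.mFourier (-m) x * UnitAddTorus.mFourier n x)
        (fun v => starRingEnd ℂ (ψ v) * χ v) z ∂(phaseMeasure2 d β) := by
    refine integral_congr_ae ?_
    filter_upwards [(memLp_mode m hψ).coeFn_toLp, (memLp_mode n hχ).coeFn_toLp] with z h1 h2
    rw [modeLp, modeLp, h1, h2, RCLike.inner_apply]
    simp only [mode, rel, map_mul, UnitAddTorus.mFourier_neg]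
    ring
  rw [e, integral_rel, integral_mFourier_mul, if_neg hmn, zero_mul]
  · exact (by fun_prop : Continuous _).aestronglyMeasurable
  · exact (Complex.continuous_conj.comp_aestronglyMeasurable hψ.1).mul hχ.1

/-- A series of modes with square-summable norms converges. -/
lemma summable_modeLp {d : ℕ} {β : ℝ} {ψ : (Fin d → ℤ) → Vel d × Vel d → ℂ}
    (hψ : ∀ n, MemLp (ψ n) 2 (velMeasure2 d β))
    (hs : Summable fun n => ∫ v, ‖ψ n v‖ ^ 2 ∂(velMeasure2 d β)) :
    Summable fun n => modeLp n (ψ n) (hψ n) := by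
  set F : (Fin d → ℤ) → L2Phase2 d β := fun n => modeLp n (ψ n) (hψ n)
  -- Each mode spans a line of its own and these lines are mutually orthogonal, so summability is
  -- that of the squared norms.
  have horth : OrthogonalFamily ℂ (fun n => (Submodule.span ℂ {F n} : Submodule ℂ (L2Phase2 d β)))
      fun n => (Submodule.span ℂ {F n}).subtypeₗᵢ := by
    refine OrthogonalFamily.of_pairwise fun m n hmn => ?_
    rw [Function.onFun, Submodule.isOrtho_span]
    intro u hu v hv
    rw [Set.mem_singleton_iff.1 hu, Set.mem_singleton_iff.1 hv]
    exact inner_modeLp_of_ne hmn (hψ m) (hψ n)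
  have h := (horth.summable_iff_norm_sq_summable
    fun n => ⟨F n, Submodule.mem_span_singleton_self _⟩).2 ?_
  · exact h
  · have e : ∀ n, ‖(⟨F n, Submodule.mem_span_singleton_self _⟩ :
        (Submodule.span ℂ {F n} : Submodule ℂ (L2Phase2 d β)))‖ ^ 2 =
        ∫ v, ‖ψ n v‖ ^ 2 ∂(velMeasure2 d β) := fun n => norm_modeLp_sq n (hψ n)
    simpa only [e] using hs

/-- The bilinear pairing with an `L²` function. -/
def pairing {α : Type*} [MeasurableSpace α] {μ : Measure α} (Φ : α → ℂ) (hΦ : MemLp Φ 2 μ) :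
    Lp ℂ 2 μ →L[ℂ] ℂ :=
  innerSL ℂ (hΦ.star.toLp (star Φ))

lemma pairing_apply {α : Type*} [MeasurableSpace α] {μ : Measure α} {Φ : α → ℂ}
    (hΦ : MemLp Φ 2 μ) (f : Lp ℂ 2 μ) : pairing Φ hΦ f = ∫ z, f z * Φ z ∂μ := by
  rw [pairing, innerSL_apply_apply, L2.inner_def]
  refine integral_congr_ae ?_
  filter_upwards [hΦ.star.coeFn_toLp] with z hz
  rw [hz]
  simp [RCLike.inner_apply]

lemma hasSum_integral_mode_mul {d : ℕ} {β : ℝ} {ψ : (Fin d → ℤ) → Vel d × Vel d → ℂ}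
    (hψ : ∀ n, MemLp (ψ n) 2 (velMeasure2 d β)) {H : L2Phase2 d β}
    (hH : HasSum (fun n => modeLp n (ψ n) (hψ n)) H) {Φ : Phase d × Phase d → ℂ}
    (hΦ : MemLp Φ 2 (phaseMeasure2 d β)) :
    HasSum (fun n => ∫ z, mode n (ψ n) z * Φ z ∂(phaseMeasure2 d β))
      (∫ z, H z * Φ z ∂(phaseMeasure2 d β)) := by
  have h := hH.mapL (pairing Φ hΦ)
  simp only [pairing_apply] at h
  refine h.congr_fun fun n => ?_
  refine integral_congr_ae ?_
  filter_upwards [(memLp_mode n (hψ n)).coeFn_toLp] with z hz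
  rw [modeLp, hz]

/-- The L² norm of f(x₀ - x₁)ψ(v₀, v₁) factors, so L² convergence of the Fourier series of f carries
over to 𝔻². This expands the source S₁²g in modes. -/
lemma hasSum_integral_rel_mul {d : ℕ} {β : ℝ} {f : Torus d → ℂ} (hf : MemLp f 2 (torusMeasure d))
    {ψ : Vel d × Vel d → ℂ} (hψ : MemLp ψ 2 (velMeasure2 d β)) {Φ : Phase d × Phase d → ℂ}
    (hΦ : MemLp Φ 2 (phaseMeasure2 d β)) :
    HasSum (fun n => UnitAddTorus.mFourierCoeff f n * ∫ z, mode n ψ z * Φ z ∂(phaseMeasure2 d β))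
      (∫ z, rel f ψ z * Φ z ∂(phaseMeasure2 d β)) := by
  have hr := memLp_rel hf hψ
  have hs : HasSum (fun n => UnitAddTorus.mFourierCoeff f n • modeLp n ψ hψ)
      (hr.toLp (rel f ψ)) := by
    rw [HasSum, Lp.tendsto_Lp_iff_tendsto_eLpNorm']
    have h1 := ENNReal.Tendsto.mul_const (tendsto_eLpNorm_sub_fourierSum hf)
      (b := eLpNorm ψ 2 (velMeasure2 d β)) (Or.inr hψ.2.ne)
    rw [zero_mul] at h1
    refine h1.congr fun s => ?_
    have hfm : AEStronglyMeasurable (fun x => f x - ∑ n ∈ s, UnitAddTorus.mFourierCoeff f n *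
        UnitAddTorus.mFourier n x) (torusMeasure d) :=
      hf.1.sub (by fun_prop : Continuous _).aestronglyMeasurable
    rw [← eLpNorm_rel hfm hψ.1, ← eLpNorm_neg]
    refine eLpNorm_congr_ae ?_
    have h3 : ∀ᵐ z ∂(phaseMeasure2 d β), ∀ n ∈ s, modeLp n ψ hψ z = mode n ψ z :=
      (Finset.eventually_all s).2 fun n _ => (memLp_mode n hψ).coeFn_toLp
    have h4 : ∀ᵐ z ∂(phaseMeasure2 d β), ∀ n ∈ s,
        (UnitAddTorus.mFourierCoeff f n • modeLp n ψ hψ : L2Phase2 d β) z =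
          UnitAddTorus.mFourierCoeff f n • modeLp n ψ hψ z :=
      (Finset.eventually_all s).2 fun n _ => Lp.coeFn_smul _ _
    filter_upwards [hr.coeFn_toLp, h3, h4,
      Lp.coeFn_fun_finsetSum s (fun n => UnitAddTorus.mFourierCoeff f n • modeLp n ψ hψ)]
      with z hz1 hz3 hz4 hz6
    rw [Pi.neg_apply, Pi.sub_apply, hz1, hz6]
    simp only [rel, sub_mul, Finset.sum_mul, neg_sub]
    congr 1
    refine Finset.sum_congr rfl fun n hn => ?_
    rw [hz4 n hn, hz3 n hn, smul_eq_mul, mode, rel, mul_assoc]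
  have h := hs.mapL (pairing Φ hΦ)
  simp only [map_smul, pairing_apply, smul_eq_mul] at h
  have e : ∫ z, (hr.toLp (rel f ψ)) z * Φ z ∂(phaseMeasure2 d β) =
      ∫ z, rel f ψ z * Φ z ∂(phaseMeasure2 d β) := by
    refine integral_congr_ae ?_
    filter_upwards [hr.coeFn_toLp] with z hz
    rw [hz]
  rw [e] at h
  refine h.congr_fun fun n => ?_
  congr 1
  refine integral_congr_ae ?_
  filter_upwards [(memLp_mode n hψ).coeFn_toLp] with z hz
  rw [modeLp, hz]

end LenardBalescu
end

noncomputable section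

namespace LenardBalescu

/-! ### Test functions and the free transport -/

instance (d : ℕ) : MeasurableAdd (Torus d × Torus d) where
  measurable_const_add _ := (continuous_const.add continuous_id).measurable
  measurable_add_const _ := (continuous_id.add continuous_const).measurable

instance (d : ℕ) : ((torusMeasure d).prod (torusMeasure d)).IsAddRightInvariant :=
  Measure.prod.instIsAddRightInvariant

/-- Test functions are smooth on the covering space; the quotient property brings continuity of φ
and of its transport down to 𝔻². -/
lemma isOpenQuotientMap_toTorus (d : ℕ) : IsOpenQuotientMap (toTorus (d := d)) := by
  have h1 : IsOpenQuotientMap (fun (y : Fin d → ℝ) (i : Fin d) => ((y i : ℝ) : UnitAddCircle)) :=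
    IsOpenQuotientMap.piMap fun _ => QuotientAddGroup.isOpenQuotientMap_mk
  exact h1.comp (EuclideanSpace.equiv (Fin d) ℝ).toHomeomorph.isOpenQuotientMap

lemma toTorus_add {d : ℕ} (x y : Vel d) : toTorus (x + y) = toTorus x + toTorus y := by
  funext i; simp [toTorus]

lemma toTorus_zero {d : ℕ} : toTorus (0 : Vel d) = 0 := by
  funext i; simp [toTorus]

/-- The covering of `𝔻²` by a vector space. -/
def phaseCover {d : ℕ} (y : (Vel d × Vel d) × (Vel d × Vel d)) : Phase d × Phase d :=
  ((toTorus y.1.1, y.1.2), (toTorus y.2.1, y.2.2))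

lemma isOpenQuotientMap_phaseCover (d : ℕ) : IsOpenQuotientMap (phaseCover (d := d)) := by
  have h1 : IsOpenQuotientMap (Prod.map (toTorus (d := d)) (id : Vel d → Vel d)) :=
    (isOpenQuotientMap_toTorus d).prodMap IsOpenQuotientMap.id
  exact h1.prodMap h1

/-- The free flow on `𝔻²`. -/
def freeFlow {d : ℕ} (s : ℝ) (z : Phase d × Phase d) : Phase d × Phase d :=
  ((z.1.1 + toTorus (s • z.1.2), z.1.2), (z.2.1 + toTorus (s • z.2.2), z.2.2))

lemma freeFlow_zero {d : ℕ} (z : Phase d × Phase d) : freeFlow 0 z = z := by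
  simp [freeFlow, toTorus_zero]

lemma freeFlow_add {d : ℕ} (s t : ℝ) (z : Phase d × Phase d) :
    freeFlow (s + t) z = freeFlow t (freeFlow s z) := by
  simp [freeFlow, add_smul, toTorus_add, add_assoc]

namespace IsTest

variable {d : ℕ} {φ : Phase d × Phase d → ℂ}

lemma continuous (h : IsTest φ) : Continuous φ :=
  (isOpenQuotientMap_phaseCover d).isQuotientMap.continuous_iff.2 h.smooth.continuous

lemma hasDerivAt_cover (h : IsTest φ) (y : (Vel d × Vel d) × (Vel d × Vel d)) :
    HasDerivAt (fun s : ℝ => φ (freeFlow s (phaseCover y)))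
      (fderiv ℝ (fun y => φ (phaseCover y)) y ((y.1.2, 0), (y.2.2, 0))) 0 := by
  have h1 : HasDerivAt (fun s : ℝ => y + s • (((y.1.2, 0), (y.2.2, 0)) :
      (Vel d × Vel d) × (Vel d × Vel d))) (((y.1.2, 0), (y.2.2, 0)) :
      (Vel d × Vel d) × (Vel d × Vel d)) 0 := by
    simpa using ((hasDerivAt_id (0 : ℝ)).smul_const (((y.1.2, 0), (y.2.2, 0)) :
      (Vel d × Vel d) × (Vel d × Vel d))).const_add y
  have h2 : HasFDerivAt (fun y => φ (phaseCover y)) (fderiv ℝ (fun y => φ (phaseCover y)) y)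
      (y + (0 : ℝ) • (((y.1.2, 0), (y.2.2, 0)) : (Vel d × Vel d) × (Vel d × Vel d))) := by
    rw [zero_smul, add_zero]
    exact (h.smooth.differentiable (by simp) y).hasFDerivAt
  have h3 := h2.comp_hasDerivAt (0 : ℝ) h1
  refine h3.congr_of_eventuallyEq (Eventually.of_forall fun s => ?_)
  simp [freeFlow, phaseCover, toTorus_add]

lemma hasDerivAt_zero (h : IsTest φ) (z : Phase d × Phase d) :
    HasDerivAt (fun s : ℝ => φ (freeFlow s z)) (transport φ z) 0 := by
  obtain ⟨y, rfl⟩ := (isOpenQuotientMap_phaseCover d).surjective z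
  exact (h.hasDerivAt_cover y).differentiableAt.hasDerivAt

/-- The group property of the flow moves the derivative at time 0 to every time s. -/
lemma hasDerivAt (h : IsTest φ) (z : Phase d × Phase d) (s : ℝ) :
    HasDerivAt (fun s : ℝ => φ (freeFlow s z)) (transport φ (freeFlow s z)) s := by
  have h1 := h.hasDerivAt_zero (freeFlow s z)
  have h2 : HasDerivAt (fun t : ℝ => t - s) 1 s := (hasDerivAt_id s).sub_const s
  have h3 := HasDerivAt.scomp (g₁ := fun t => φ (freeFlow t (freeFlow s z))) s
    (by simpa using h1) h2
  rw [one_smul] at h3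
  refine h3.congr_of_eventuallyEq (Eventually.of_forall fun t => ?_)
  simp [← freeFlow_add]

lemma continuous_transport (h : IsTest φ) : Continuous (transport φ) := by
  rw [(isOpenQuotientMap_phaseCover d).isQuotientMap.continuous_iff]
  have e : transport φ ∘ phaseCover = fun y : (Vel d × Vel d) × (Vel d × Vel d) =>
      fderiv ℝ (fun y => φ (phaseCover y)) y ((y.1.2, 0), (y.2.2, 0)) := by
    funext y
    exact (h.hasDerivAt_zero (phaseCover y)).unique (h.hasDerivAt_cover y)
  rw [e]
  have h1 : Continuous (fderiv ℝ (fun y => φ (phaseCover y))) :=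
    h.smooth.continuous_fderiv (by simp)
  exact h1.clm_apply (by fun_prop)

lemma hasCompactSupport_transport (h : IsTest φ) : HasCompactSupport (transport φ) := by
  refine h.compactSupport.of_isClosed_subset (isClosed_tsupport _)
    (closure_minimal (fun z hz => ?_) (isClosed_tsupport _))
  by_contra hn
  apply hz
  have h1 : φ =ᶠ[𝓝 z] 0 := notMem_tsupport_iff_eventuallyEq.1 hn
  have hc : Continuous fun s : ℝ => freeFlow s z := by
    have : Continuous (toTorus (d := d)) := (isOpenQuotientMap_toTorus d).continuous
    unfold freeFlow
    fun_prop
  have h2 : (fun s : ℝ => φ (freeFlow s z)) =ᶠ[𝓝 0] fun _ => 0 := by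
    have := hc.tendsto 0
    rw [freeFlow_zero] at this
    exact this.eventually h1
  exact (h.hasDerivAt_zero z).unique ((hasDerivAt_const (0 : ℝ) (0 : ℂ)).congr_of_eventuallyEq h2)

end IsTest

lemma exists_bound_of_continuous_compactSupport {α : Type*} [TopologicalSpace α] {f : α → ℂ}
    (hf : Continuous f) (hs : HasCompactSupport f) : ∃ C : ℝ, 0 ≤ C ∧ ∀ x, ‖f x‖ ≤ C := by
  obtain ⟨C, hC⟩ := hf.bounded_above_of_compact_support hs
  exact ⟨max C 0, le_max_right _ _, fun x => (hC x).trans (le_max_left _ _)⟩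

lemma memLp_of_continuous_compactSupport {d : ℕ} {β : ℝ} (hβ : 0 < β) {f : Phase d × Phase d → ℂ}
    (hf : Continuous f) (hs : HasCompactSupport f) : MemLp f 2 (phaseMeasure2 d β) := by
  have := isProbabilityMeasure_phaseMeasure2 d hβ
  obtain ⟨C, -, hC⟩ := exists_bound_of_continuous_compactSupport hf hs
  exact MemLp.of_bound hf.aestronglyMeasurable C (ae_of_all _ hC)

/-- The integral of exp(ik·(x₀ - x₁)) φ along the free flow is differentiated at s = 0 in two ways.
Under the integral sign the derivative falls on φ. By invariance of the Haar measure the flow acts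
on the exponential instead, and gives the factor exp(-is k·(v₀ - v₁)). -/
lemma integral_mFourier_mul_transport {d : ℕ} (n : Fin d → ℤ) {φ : Phase d × Phase d → ℂ}
    (hφ : IsTest φ) (v₀ v₁ : Vel d) :
    ∫ x : Torus d × Torus d, UnitAddTorus.mFourier n (x.1 - x.2) *
        transport φ ((x.1, v₀), (x.2, v₁)) ∂((torusMeasure d).prod (torusMeasure d)) =
      -(Complex.I * (inner ℝ (waveVec n) (v₀ - v₁) : ℝ)) *
      ∫ x : Torus d × Torus d, UnitAddTorus.mFourier n (x.1 - x.2) *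
        φ ((x.1, v₀), (x.2, v₁)) ∂((torusMeasure d).prod (torusMeasure d)) := by
  set μ := (torusMeasure d).prod (torusMeasure d)
  set pt : Torus d × Torus d → Phase d × Phase d := fun x => ((x.1, v₀), (x.2, v₁))
  have hpt : Continuous pt := by fun_prop
  set e : Torus d × Torus d → ℂ := fun x => UnitAddTorus.mFourier n (x.1 - x.2)
  have he : Continuous e := by fun_prop
  have hne : ∀ x, ‖e x‖ = 1 := fun x => norm_mFourier_apply _ _
  have hflow : ∀ s : ℝ, Continuous (freeFlow (d := d) s) := by
    intro s
    have : Continuous (toTorus (d := d)) := (isOpenQuotientMap_toTorus d).continuous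
    unfold freeFlow
    fun_prop
  obtain ⟨C, hC0, hC⟩ := exists_bound_of_continuous_compactSupport hφ.continuous_transport
    hφ.hasCompactSupport_transport
  obtain ⟨C', hC0', hC'⟩ := exists_bound_of_continuous_compactSupport hφ.continuous
    hφ.compactSupport
  have hder := hasDerivAt_integral_of_dominated_loc_of_deriv_le (μ := μ) (x₀ := (0 : ℝ))
    (F := fun s x => e x * φ (freeFlow s (pt x)))
    (F' := fun s x => e x * transport φ (freeFlow s (pt x))) (bound := fun _ => C)
    (Metric.ball_mem_nhds (0 : ℝ) one_pos)
    (Eventually.of_forall fun s =>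
      (he.mul (hφ.continuous.comp ((hflow s).comp hpt))).aestronglyMeasurable)
    (Integrable.of_bound (he.mul (hφ.continuous.comp ((hflow 0).comp hpt))).aestronglyMeasurable
      C' (ae_of_all _ fun x => by rw [norm_mul, hne, one_mul]; exact hC' _))
    (he.mul (hφ.continuous_transport.comp ((hflow 0).comp hpt))).aestronglyMeasurable
    (ae_of_all _ fun x s _ => by rw [norm_mul, hne, one_mul]; exact hC _)
    (integrable_const _)
    (ae_of_all _ fun x s _ => (hφ.hasDerivAt (pt x) s).const_mul (e x))
  have hd1 := hder.2
  simp only [freeFlow_zero] at hd1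
  have hA : ∀ s : ℝ, ∫ x, e x * φ (freeFlow s (pt x)) ∂μ =
      Complex.exp ((s : ℂ) * -(Complex.I * (inner ℝ (waveVec n) (v₀ - v₁) : ℝ))) *
        ∫ x, e x * φ (pt x) ∂μ := by
    intro s
    rw [← integral_const_mul, ← integral_add_right_eq_self (fun x =>
      Complex.exp ((s : ℂ) * -(Complex.I * (inner ℝ (waveVec n) (v₀ - v₁) : ℝ))) *
        (e x * φ (pt x))) ((toTorus (s • v₀), toTorus (s • v₁)) : Torus d × Torus d)]
    refine integral_congr_ae (ae_of_all _ fun x => ?_)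
    have h1 : e (x + (toTorus (s • v₀), toTorus (s • v₁))) =
        e x * Complex.exp ((s : ℂ) * (Complex.I * (inner ℝ (waveVec n) (v₀ - v₁) : ℝ))) := by
      simp only [e, Prod.fst_add, Prod.snd_add]
      have : x.1 + toTorus (s • v₀) - (x.2 + toTorus (s • v₁)) =
          (x.1 - x.2) + toTorus (s • (v₀ - v₁)) := by
        have h2 : toTorus (s • v₀) = toTorus (s • (v₀ - v₁)) + toTorus (s • v₁) := by
          rw [← toTorus_add, ← smul_add, sub_add_cancel]
        rw [h2]
        abel
      rw [this, mFourier_add_toTorus, inner_smul_right]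
      congr 2
      push_cast
      ring
    have h2 : pt (x + (toTorus (s • v₀), toTorus (s • v₁))) = freeFlow s (pt x) := rfl
    simp only [h1, h2]
    have h3 : Complex.exp ((s : ℂ) * -(Complex.I * (inner ℝ (waveVec n) (v₀ - v₁) : ℝ))) *
        Complex.exp ((s : ℂ) * (Complex.I * (inner ℝ (waveVec n) (v₀ - v₁) : ℝ))) = 1 := by
      rw [← Complex.exp_add, mul_neg, neg_add_cancel, Complex.exp_zero]
    linear_combination (-(e x * φ (freeFlow s (pt x)))) * h3
  have hd2 : HasDerivAt (fun s : ℝ => ∫ x, e x * φ (freeFlow s (pt x)) ∂μ)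
      (-(Complex.I * (inner ℝ (waveVec n) (v₀ - v₁) : ℝ)) * ∫ x, e x * φ (pt x) ∂μ) 0 := by
    simp only [hA]
    have h0 : HasDerivAt (fun s : ℝ => (s : ℂ) * -(Complex.I * (inner ℝ (waveVec n) (v₀ - v₁) : ℝ)))
        (1 * -(Complex.I * (inner ℝ (waveVec n) (v₀ - v₁) : ℝ))) 0 :=
      (Complex.ofRealCLM.hasDerivAt (x := 0)).mul_const _
    have h1 := h0.cexp.mul_const (∫ x, e x * φ (pt x) ∂μ)
    simpa using h1
  exact hd1.unique hd2

/-- An integral over `𝔻²`, positions first. -/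
lemma integral_phaseMeasure2_eq {d : ℕ} {β : ℝ} {F : Phase d × Phase d → ℂ}
    (hF : Integrable F (phaseMeasure2 d β)) :
    ∫ z, F z ∂(phaseMeasure2 d β) = ∫ v, ∫ x : Torus d × Torus d,
      F ((x.1, v.1), (x.2, v.2)) ∂((torusMeasure d).prod (torusMeasure d)) ∂(velMeasure2 d β) := by
  have hmp := measurePreserving_regroup d β
  set G : (Torus d × Torus d) × (Vel d × Vel d) → ℂ :=
    fun p => F ((p.1.1, p.2.1), (p.1.2, p.2.2))
  have hG : Integrable G (((torusMeasure d).prod (torusMeasure d)).prod (velMeasure2 d β)) := by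
    have hemb : MeasurableEmbedding (regroup (d := d)) := by
      refine MeasurableEmbedding.of_measurable_inverse hmp.measurable ?_
        (g := fun p => ((p.1.1, p.2.1), (p.1.2, p.2.2))) (by fun_prop) (fun z => rfl)
      have : Set.range (regroup (d := d)) = Set.univ :=
        Set.range_eq_univ.2 fun p => ⟨((p.1.1, p.2.1), (p.1.2, p.2.2)), rfl⟩
      rw [this]; exact MeasurableSet.univ
    exact (hmp.integrable_comp_emb hemb).1 hF
  have h1 : ∫ z, F z ∂(phaseMeasure2 d β) =
      ∫ p, G p ∂(((torusMeasure d).prod (torusMeasure d)).prod (velMeasure2 d β)) := by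
    rw [← hmp.map_eq, integral_map hmp.measurable.aemeasurable]
    · rfl
    · rw [hmp.map_eq]; exact hG.1
  rw [h1, integral_prod_symm _ hG]

lemma integral_mode_mul_transport {d : ℕ} {β : ℝ} (hβ : 0 < β) (n : Fin d → ℤ)
    {ψ : Vel d × Vel d → ℂ} (hψ : MemLp ψ 2 (velMeasure2 d β)) {φ : Phase d × Phase d → ℂ}
    (hφ : IsTest φ) :
    ∫ z, mode n ψ z * transport φ z ∂(phaseMeasure2 d β) =
      -∫ z, mode n (fun v => Complex.I * (inner ℝ (waveVec n) (v.1 - v.2) : ℝ) * ψ v) z * φ z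
        ∂(phaseMeasure2 d β) := by
  have hm := memLp_mode n hψ
  have i1 : Integrable (fun z => mode n ψ z * transport φ z) (phaseMeasure2 d β) :=
    hm.integrable_mul (memLp_of_continuous_compactSupport hβ hφ.continuous_transport
      hφ.hasCompactSupport_transport)
  have hkc : Continuous fun z : Phase d × Phase d =>
      Complex.I * (inner ℝ (waveVec n) (z.1.2 - z.2.2) : ℝ) * φ z := by
    have := hφ.continuous
    fun_prop
  have i2 : Integrable (fun z => mode n (fun v => Complex.I *
      (inner ℝ (waveVec n) (v.1 - v.2) : ℝ) * ψ v) z * φ z) (phaseMeasure2 d β) := by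
    refine (hm.integrable_mul (memLp_of_continuous_compactSupport hβ hkc
      hφ.compactSupport.mul_left)).congr (ae_of_all _ fun z => ?_)
    simp only [mode, rel, Pi.mul_apply]
    ring
  rw [integral_phaseMeasure2_eq i1, integral_phaseMeasure2_eq i2, ← integral_neg]
  refine integral_congr_ae (ae_of_all _ fun v => ?_)
  have h := integral_mFourier_mul_transport n hφ v.1 v.2
  have e1 : ∀ x : Torus d × Torus d, mode n ψ ((x.1, v.1), (x.2, v.2)) *
      transport φ ((x.1, v.1), (x.2, v.2)) = ψ v * (UnitAddTorus.mFourier n (x.1 - x.2) *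
        transport φ ((x.1, v.1), (x.2, v.2))) := by
    intro x; simp only [mode, rel]; ring
  have e2 : ∀ x : Torus d × Torus d, mode n (fun v => Complex.I *
      (inner ℝ (waveVec n) (v.1 - v.2) : ℝ) * ψ v) ((x.1, v.1), (x.2, v.2)) *
      φ ((x.1, v.1), (x.2, v.2)) = (Complex.I * (inner ℝ (waveVec n) (v.1 - v.2) : ℝ) * ψ v) *
      (UnitAddTorus.mFourier n (x.1 - x.2) * φ ((x.1, v.1), (x.2, v.2))) := by
    intro x; simp only [mode, rel]; ring
  simp only [e1, e2, integral_const_mul, h]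
  ring

end LenardBalescu
end

noncomputable section

namespace LenardBalescu

/-! ### The mean-field operator -/

instance (d : ℕ) : (torusMeasure d).IsNegInvariant :=
  Measure.IsAddHaarMeasure.isNegInvariant_of_regular _

/-- The kernel of the mean-field operator. -/
def mfKernel {d : ℕ} (β : ℝ) (W : Torus d → Vel d) (z zs : Phase d) : ℂ :=
  ((β * inner ℝ z.2 (W (z.1 - zs.1)) : ℝ) : ℂ)

/-- The transpose of the mean-field operator. -/
def meanFieldAdj {d : ℕ} (β : ℝ) (W : Torus d → Vel d) (φ : Phase d × Phase d → ℂ)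
    (z : Phase d × Phase d) : ℂ :=
  ∫ z₁, mfKernel β W z₁ z.2 * φ (z.1, z₁) ∂(phaseMeasure d β)

lemma measurePreserving_prod_right_comm {α : Type*} [MeasurableSpace α] (μ : Measure α)
    [SFinite μ] :
    MeasurePreserving (fun p : (α × α) × α => ((p.1.1, p.2), p.1.2)) ((μ.prod μ).prod μ)
      ((μ.prod μ).prod μ) := by
  have h1 := measurePreserving_prodAssoc μ μ μ
  have h2 : MeasurePreserving (Prod.map id Prod.swap) (μ.prod (μ.prod μ)) (μ.prod (μ.prod μ)) :=
    (MeasurePreserving.id μ).prod Measure.measurePreserving_swap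
  exact (measurePreserving_prodAssoc μ μ μ).symm.comp (h2.comp h1)

section MeanField

variable {d : ℕ} {β : ℝ} {V : Torus d → ℝ} {W : Torus d → Vel d} {K : ℝ≥0}

lemma measurePreserving_relPosition (hβ : 0 < β) :
    MeasurePreserving (fun p : (Phase d × Phase d) × Phase d => p.1.2.1 - p.2.1)
      ((phaseMeasure2 d β).prod (phaseMeasure d β)) (torusMeasure d) := by
  have := isProbabilityMeasure_phaseMeasure d hβ
  have := isProbabilityMeasure_velMeasure2 d hβ
  have h1 : MeasurePreserving (Prod.map Prod.snd id)
      ((phaseMeasure2 d β).prod (phaseMeasure d β)) (phaseMeasure2 d β) :=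
    (measurePreserving_snd (μ := phaseMeasure d β) (ν := phaseMeasure d β)).prod
      (MeasurePreserving.id (phaseMeasure d β))
  exact (measurePreserving_fst (ν := velMeasure2 d β)).comp
    ((measurePreserving_relCoord d β).comp h1)

lemma aestronglyMeasurable_mfKernel_mul (hβ : 0 < β) (h : IsW1Infty V W K)
    {φ : Phase d × Phase d → ℂ} (hφ : Continuous φ) :
    AEStronglyMeasurable (fun p : (Phase d × Phase d) × Phase d =>
      mfKernel β W p.1.2 p.2 * φ p.1) ((phaseMeasure2 d β).prod (phaseMeasure d β)) := by
  have h1 : AEStronglyMeasurable (fun p : (Phase d × Phase d) × Phase d => W (p.1.2.1 - p.2.1))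
      ((phaseMeasure2 d β).prod (phaseMeasure d β)) :=
    h.memLp_grad.1.comp_measurePreserving (measurePreserving_relPosition hβ)
  have h2 : AEStronglyMeasurable (fun p : (Phase d × Phase d) × Phase d => p.1.2.2)
      ((phaseMeasure2 d β).prod (phaseMeasure d β)) :=
    (measurable_snd.comp (measurable_snd.comp measurable_fst)).aestronglyMeasurable
  have h3 : AEStronglyMeasurable (fun p : (Phase d × Phase d) × Phase d => φ p.1)
      ((phaseMeasure2 d β).prod (phaseMeasure d β)) :=
    (hφ.aestronglyMeasurable (μ := phaseMeasure2 d β)).comp_fst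
  exact (Complex.continuous_ofReal.comp_aestronglyMeasurable ((h2.inner h1).const_mul β)).mul h3

/-- The kernel grows linearly in v₁, but φ has compact support and ∇V is bounded. -/
lemma exists_bound_mfKernel_mul (hβ : 0 < β) (h : IsW1Infty V W K)
    {φ : Phase d × Phase d → ℂ} (hφ : Continuous φ) (hφs : HasCompactSupport φ) :
    ∃ C : ℝ, 0 ≤ C ∧ ∀ᵐ p ∂((phaseMeasure2 d β).prod (phaseMeasure d β)),
      ‖mfKernel β W p.1.2 p.2 * φ p.1‖ ≤ C := by
  have hc : Continuous fun z : Phase d × Phase d => ((‖z.2.2‖ : ℝ) : ℂ) * φ z := by fun_prop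
  obtain ⟨C, hC0, hC⟩ := exists_bound_of_continuous_compactSupport hc hφs.mul_left
  refine ⟨β * K * C, by positivity, ?_⟩
  filter_upwards [(measurePreserving_relPosition hβ).quasiMeasurePreserving.ae
    (ae_norm_grad_le h)] with p hp
  have h1 := hC p.1
  rw [norm_mul, Complex.norm_real, norm_norm] at h1
  rw [norm_mul, mfKernel, Complex.norm_real, norm_mul, Real.norm_of_nonneg hβ.le]
  have h2 : ‖inner ℝ p.1.2.2 (W (p.1.2.1 - p.2.1))‖ ≤ ‖p.1.2.2‖ * K :=
    (norm_inner_le_norm _ _).trans (mul_le_mul_of_nonneg_left hp (norm_nonneg _))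
  calc β * ‖inner ℝ p.1.2.2 (W (p.1.2.1 - p.2.1))‖ * ‖φ p.1‖
      ≤ β * (‖p.1.2.2‖ * K) * ‖φ p.1‖ := by gcongr
    _ = β * K * (‖p.1.2.2‖ * ‖φ p.1‖) := by ring
    _ ≤ β * K * C := by gcongr

lemma measurePreserving_phase_right_comm (d : ℕ) (β : ℝ) :
    MeasurePreserving (fun p : (Phase d × Phase d) × Phase d => ((p.1.1, p.2), p.1.2))
      ((phaseMeasure2 d β).prod (phaseMeasure d β))
      ((phaseMeasure2 d β).prod (phaseMeasure d β)) := by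
  unfold phaseMeasure2
  exact measurePreserving_prod_right_comm (phaseMeasure d β)

lemma memLp_meanFieldAdj (hβ : 0 < β) (h : IsW1Infty V W K)
    {φ : Phase d × Phase d → ℂ} (hφ : Continuous φ) (hφs : HasCompactSupport φ) :
    MemLp (meanFieldAdj β W φ) 2 (phaseMeasure2 d β) := by
  have := isProbabilityMeasure_phaseMeasure d hβ
  have := isProbabilityMeasure_phaseMeasure2 d hβ
  obtain ⟨C, hC0, hC⟩ := exists_bound_mfKernel_mul hβ h hφ hφs
  have hmp := measurePreserving_phase_right_comm d β
  have hm := (aestronglyMeasurable_mfKernel_mul hβ h hφ).comp_measurePreserving hmp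
  have h1 := Measure.ae_ae_of_ae_prod (hmp.quasiMeasurePreserving.ae hC)
  have hm' : AEStronglyMeasurable (meanFieldAdj β W φ) (phaseMeasure2 d β) :=
    hm.integral_prod_right'
  refine MemLp.of_bound hm' C ?_
  filter_upwards [h1] with z hz
  refine (norm_integral_le_of_norm_le_const hz).trans ?_
  rw [probReal_univ, mul_one]

/-- Fubini on triples (z₀, z₁, z_*), followed by the exchange of z₁ and z_*. Once transposed, the
mean-field term is a continuous functional of G in L², so it passes through a series of modes. -/
lemma integral_meanField_mul (hβ : 0 < β) (h : IsW1Infty V W K)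
    {φ : Phase d × Phase d → ℂ} (hφ : Continuous φ) (hφs : HasCompactSupport φ)
    {G : Phase d × Phase d → ℂ} (hG : MemLp G 2 (phaseMeasure2 d β)) :
    Integrable (fun z => meanField β W G z * φ z) (phaseMeasure2 d β) ∧
    ∫ z, meanField β W G z * φ z ∂(phaseMeasure2 d β) =
      ∫ z, G z * meanFieldAdj β W φ z ∂(phaseMeasure2 d β) := by
  have := isProbabilityMeasure_phaseMeasure d hβ
  have := isProbabilityMeasure_phaseMeasure2 d hβ
  obtain ⟨C, hC0, hC⟩ := exists_bound_mfKernel_mul hβ h hφ hφs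
  set T : (Phase d × Phase d) × Phase d → ℂ := fun p =>
    mfKernel β W p.1.2 p.2 * φ p.1 * G (p.1.1, p.2) with hT
  have hq : MeasurePreserving (Prod.map Prod.fst id)
      ((phaseMeasure2 d β).prod (phaseMeasure d β)) (phaseMeasure2 d β) :=
    (measurePreserving_fst (μ := phaseMeasure d β) (ν := phaseMeasure d β)).prod
      (MeasurePreserving.id (phaseMeasure d β))
  have hGi : Integrable (fun p : (Phase d × Phase d) × Phase d => G (p.1.1, p.2))
      ((phaseMeasure2 d β).prod (phaseMeasure d β)) :=
    hq.integrable_comp_of_integrable (hG.integrable (by norm_num))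
  have hTi : Integrable T ((phaseMeasure2 d β).prod (phaseMeasure d β)) :=
    hGi.bdd_mul (aestronglyMeasurable_mfKernel_mul hβ h hφ) hC
  have hmp := measurePreserving_phase_right_comm d β
  have hTi' : Integrable (fun p : (Phase d × Phase d) × Phase d => T ((p.1.1, p.2), p.1.2))
      ((phaseMeasure2 d β).prod (phaseMeasure d β)) :=
    hmp.integrable_comp_of_integrable hTi
  have e1 : ∀ z, meanField β W G z * φ z = ∫ zs, T (z, zs) ∂(phaseMeasure d β) := by
    intro z
    rw [meanField, ← integral_mul_const]
    refine integral_congr_ae (ae_of_all _ fun zs => ?_)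
    simp only [hT, mfKernel]
    ring
  have e2 : ∀ z, G z * meanFieldAdj β W φ z =
      ∫ z₁, T ((z.1, z₁), z.2) ∂(phaseMeasure d β) := by
    intro z
    rw [meanFieldAdj, ← integral_const_mul]
    refine integral_congr_ae (ae_of_all _ fun zs => ?_)
    simp only [hT]
    ring
  simp only [e1, e2]
  refine ⟨hTi.integral_prod_left, ?_⟩
  rw [← integral_prod _ hTi]
  have h3 := integral_prod _ hTi'
  simp only at h3
  rw [← h3]
  have h4 : ∫ p, T ((p.1.1, p.2), p.1.2) ∂((phaseMeasure2 d β).prod (phaseMeasure d β)) =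
      ∫ p, T p ∂(Measure.map (fun p : (Phase d × Phase d) × Phase d => ((p.1.1, p.2), p.1.2))
        ((phaseMeasure2 d β).prod (phaseMeasure d β))) := by
    rw [integral_map hmp.measurable.aemeasurable]
    rw [hmp.map_eq]
    exact hTi.1
  rw [h4, hmp.map_eq]

lemma integral_inner_grad_mul_mFourier (h : IsW1Infty V W K) (hV : PosDefPotential V)
    (n : Fin d → ℤ) (w : Vel d) :
    ∫ y, ((inner ℝ w (W y) : ℝ) : ℂ) * UnitAddTorus.mFourier n y ∂(torusMeasure d) =
      -(Complex.I * (Vhat V n : ℝ) * (inner ℝ (waveVec n) w : ℝ)) := by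
  have e : ∀ y, ((inner ℝ w (W y) : ℝ) : ℂ) * UnitAddTorus.mFourier n y =
      ∑ j, ((w j : ℝ) : ℂ) * (UnitAddTorus.mFourier (-(-n)) y * ((W y j : ℝ) : ℂ)) := by
    intro y
    rw [PiLp.inner_apply, Complex.ofReal_sum, Finset.sum_mul]
    refine Finset.sum_congr rfl fun j _ => ?_
    rw [neg_neg]
    simp
    ring
  have hi : ∀ j, Integrable (fun y => UnitAddTorus.mFourier (-(-n)) y * ((W y j : ℝ) : ℂ))
      (torusMeasure d) := fun j =>
    (integrable_of_memLp_top (memLp_top_grad_coord h j)).bdd_mul (c := 1)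
      (UnitAddTorus.mFourier (-(-n))).continuous.aestronglyMeasurable
      (ae_of_all _ fun x => (norm_mFourier_apply _ x).le)
  simp only [e]
  rw [integral_finsetSum _ fun j _ => (hi j).const_mul _]
  have e2 : ∀ j, ∫ y, ((w j : ℝ) : ℂ) * (UnitAddTorus.mFourier (-(-n)) y * ((W y j : ℝ) : ℂ))
      ∂(torusMeasure d) = ((w j : ℝ) : ℂ) * (Complex.I * (-(waveVec n j) : ℝ) * (Vhat V n : ℝ)) := by
    intro j
    rw [integral_const_mul, ← mFourierCoeff_eq_integral_torusMeasure, mFourierCoeff_grad h hV,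
      waveVec_neg, Vhat_neg]
    simp
  simp only [e2]
  rw [PiLp.inner_apply, Complex.ofReal_sum, Finset.mul_sum, ← Finset.sum_neg_distrib]
  refine Finset.sum_congr rfl fun j _ => ?_
  simp
  ring

/-- Convolving with ∇V multiplies the exponential by the Fourier coefficient of ∇V at -k, hence the
minus sign. Of the velocity profile only its average in the second variable is seen. -/
lemma meanField_mode (h : IsW1Infty V W K) (hV : PosDefPotential V) (n : Fin d → ℤ)
    (ψ : Vel d × Vel d → ℂ) :
    meanField β W (mode n ψ) = mode n (fun v =>
      -(Complex.I * (β * Vhat V n : ℝ) * (inner ℝ (waveVec n) v.2 : ℝ)) *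
        ∫ w, ψ (v.1, w) ∂(maxwell d β)) := by
  funext z
  have e : meanField β W (mode n ψ) z = ∫ zs : Phase d,
      (((β * inner ℝ z.2.2 (W (z.2.1 - zs.1)) : ℝ) : ℂ) * UnitAddTorus.mFourier n (z.1.1 - zs.1)) *
        ψ (z.1.2, zs.2) ∂((torusMeasure d).prod (maxwell d β)) := by
    rw [meanField, phaseMeasure]
    refine integral_congr_ae (ae_of_all _ fun zs => ?_)
    simp only [mode, rel]
    ring
  rw [e, integral_prod_mul (fun xs => ((β * inner ℝ z.2.2 (W (z.2.1 - xs)) : ℝ) : ℂ) *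
    UnitAddTorus.mFourier n (z.1.1 - xs)) (fun w => ψ (z.1.2, w)),
    ← integral_sub_left_eq_self _ (torusMeasure d) z.2.1]
  have e2 : ∀ y, ((β * inner ℝ z.2.2 (W (z.2.1 - (z.2.1 - y))) : ℝ) : ℂ) *
      UnitAddTorus.mFourier n (z.1.1 - (z.2.1 - y)) =
      (β * UnitAddTorus.mFourier n (z.1.1 - z.2.1)) *
        (((inner ℝ z.2.2 (W y) : ℝ) : ℂ) * UnitAddTorus.mFourier n y) := by
    intro y
    rw [sub_sub_cancel, show z.1.1 - (z.2.1 - y) = (z.1.1 - z.2.1) + y by abel, mFourier_add_arg]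
    push_cast
    ring
  simp only [e2]
  rw [integral_const_mul, integral_inner_grad_mul_mFourier h hV]
  simp only [mode, rel]
  push_cast
  ring

end MeanField

end LenardBalescu
end

noncomputable section

namespace LenardBalescu

/-! ### The Fourier modes of the resolvent -/

/-- The complex number `k · w`. -/
def cdot {d : ℕ} (k : Vel d) (w : CVec d) : ℂ := inner ℂ (toC k) w

lemma norm_toC {d : ℕ} (w : Vel d) : ‖toC w‖ = ‖w‖ := by
  simp [EuclideanSpace.norm_eq, toC]

lemma cdot_eq_sum {d : ℕ} (k : Vel d) (w : CVec d) : cdot k w = ∑ j, ((k j : ℝ) : ℂ) * w j := by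
  simp [cdot, PiLp.inner_apply, toC, mul_comm]

lemma norm_cdot_le {d : ℕ} (k : Vel d) (w : CVec d) : ‖cdot k w‖ ≤ ‖k‖ * ‖w‖ :=
  (norm_inner_le_norm _ _).trans_eq (by rw [norm_toC])

lemma cdot_toC {d : ℕ} (k w : Vel d) : cdot k (toC w) = (inner ℝ k w : ℝ) := by
  rw [cdot_eq_sum, PiLp.inner_apply, Complex.ofReal_sum]
  refine Finset.sum_congr rfl fun j _ => ?_
  simp [toC, mul_comm]

lemma cdot_zero_left {d : ℕ} (w : CVec d) : cdot 0 w = 0 := by simp [cdot_eq_sum]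

lemma cdot_neg_left {d : ℕ} (k : Vel d) (w : CVec d) : cdot (-k) w = -cdot k w := by
  simp [cdot_eq_sum]

/-- The argument `(ω - k·v) / |k|` of the plasma functions. -/
def plasmaArg {d : ℕ} (ω : ℂ) (k v : Vel d) : ℂ := (ω - (inner ℝ k v : ℝ)) / ‖k‖

/-- The dispersion function at frequency `ω - k·v`. -/
def dispersion {d : ℕ} (β : ℝ) (V : Torus d → ℝ) (ω : ℂ) (n : Fin d → ℤ) (v : Vel d) : ℂ :=
  1 + ((β * Vhat V n : ℝ) : ℂ) * plasmaZ β (plasmaArg ω (waveVec n) v)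

/-- The density of the mode `n` of the resolvent, augmented by `b`. -/
def density {d : ℕ} (β : ℝ) (V : Torus d → ℝ) (a : Vel d → CVec d) (b : Vel d → ℂ) (ω : ℂ)
    (n : Fin d → ℤ) (v : Vel d) : ℂ :=
  (b v + Complex.I * (Vhat V n : ℝ) * cdot (waveVec n) (a v) *
    (gaussLaplace β (plasmaArg ω (waveVec n) v) / ‖waveVec n‖)) / dispersion β V ω n v

/-- The mode `n` of the resolvent. -/
def resolventMode {d : ℕ} (β : ℝ) (V : Torus d → ℝ) (a : Vel d → CVec d) (b : Vel d → ℂ) (ω : ℂ)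
    (n : Fin d → ℤ) (v : Vel d × Vel d) : ℂ :=
  -(Vhat V n : ℝ) * (cdot (waveVec n) (a v.1) +
    β * (inner ℝ (waveVec n) v.2 : ℝ) * density β V a b ω n v.1) *
    (ω - (inner ℝ (waveVec n) v.1 : ℝ) + (inner ℝ (waveVec n) v.2 : ℝ))⁻¹

section ResolventMode

variable {d : ℕ} {β : ℝ} {V : Torus d → ℝ} {W : Torus d → Vel d} {K : ℝ≥0}
  {a : Vel d → CVec d} {b : Vel d → ℂ} {ω : ℂ}

lemma im_plasmaArg_nonneg (hω : 0 ≤ ω.im) (k v : Vel d) : 0 ≤ (plasmaArg ω k v).im := by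
  rw [plasmaArg, Complex.div_ofReal_im]
  exact div_nonneg (by simpa using hω) (norm_nonneg _)

lemma continuous_plasmaArg (ω : ℂ) (k : Vel d) : Continuous (plasmaArg ω k) := by
  unfold plasmaArg; fun_prop

lemma continuous_gaussLaplace_plasmaArg (hβ : 0 < β) (hω : 0 ≤ ω.im) (k : Vel d) :
    Continuous fun v => gaussLaplace β (plasmaArg ω k v) :=
  (continuousOn_gaussLaplace hβ).comp_continuous (continuous_plasmaArg ω k)
    fun v => im_plasmaArg_nonneg hω k v

lemma continuous_plasmaZ_plasmaArg (hβ : 0 < β) (hω : 0 ≤ ω.im) (k : Vel d) :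
    Continuous fun v => plasmaZ β (plasmaArg ω k v) :=
  (continuousOn_plasmaZ hβ).comp_continuous (continuous_plasmaArg ω k)
    fun v => im_plasmaArg_nonneg hω k v

lemma continuous_dispersion (hβ : 0 < β) (hω : 0 ≤ ω.im) (n : Fin d → ℤ) :
    Continuous (dispersion β V ω n) := by
  have := continuous_plasmaZ_plasmaArg hβ hω (waveVec n)
  unfold dispersion
  fun_prop

/-- The dispersion functions are uniformly bounded below. -/
lemma exists_le_norm_dispersion (d : ℕ) (hβ : 0 < β) (K : ℝ≥0) :
    ∃ δ : ℝ, 0 < δ ∧ ∀ (V : Torus d → ℝ) (W : Torus d → Vel d), IsW1Infty V W K →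
      PosDefPotential V → ∀ ω : ℂ, 0 ≤ ω.im → ∀ n v, δ ≤ ‖dispersion β V ω n v‖ := by
  -- By `Vhat_le` the coefficient βV̂(k) ranges in [0, βK], so δ depends only on β and K.
  obtain ⟨δ, hδ, h⟩ := exists_lower_bound_dispersion hβ (β * K)
  refine ⟨δ, hδ, fun V W hW hV ω hω n v => h _ (mul_nonneg hβ.le (hV n).1) ?_ _
    (im_plasmaArg_nonneg hω _ _)⟩
  exact mul_le_mul_of_nonneg_left (Vhat_le hW n) hβ.le

lemma dispersion_ne_zero (hβ : 0 < β) (h : IsW1Infty V W K) (hV : PosDefPotential V)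
    (hω : 0 ≤ ω.im) (n : Fin d → ℤ) (v : Vel d) : dispersion β V ω n v ≠ 0 := by
  obtain ⟨δ, hδ, hd⟩ := exists_le_norm_dispersion d hβ K
  exact norm_pos_iff.1 (hδ.trans_le (hd V W h hV ω hω n v))

lemma aestronglyMeasurable_cdot {α : Type*} [MeasurableSpace α] {μ : Measure α}
    {f : α → CVec d} (hf : AEStronglyMeasurable f μ) (k : Vel d) :
    AEStronglyMeasurable (fun x => cdot k (f x)) μ :=
  (aestronglyMeasurable_const (b := toC k)).inner hf

lemma aestronglyMeasurable_density (hβ : 0 < β) (hω : 0 ≤ ω.im) (n : Fin d → ℤ)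
    (ha : AEStronglyMeasurable a (maxwell d β)) (hb : AEStronglyMeasurable b (maxwell d β)) :
    AEStronglyMeasurable (density β V a b ω n) (maxwell d β) := by
  have h1 := (continuous_gaussLaplace_plasmaArg hβ hω (waveVec n)).aestronglyMeasurable
    (μ := maxwell d β)
  have h2 := (continuous_dispersion (V := V) hβ hω n).measurable.inv.aestronglyMeasurable
    (μ := maxwell d β)
  exact (hb.add (((aestronglyMeasurable_cdot ha (waveVec n)).const_mul _).mul
    (h1.mul aestronglyMeasurable_const))).mul h2

/-- A bound for the density of the modes, uniform in the frequency. -/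
lemma exists_norm_density_le (d : ℕ) (hβ : 0 < β) (K : ℝ≥0) :
    ∃ C : ℝ, 0 ≤ C ∧ ∀ (V : Torus d → ℝ) (W : Torus d → Vel d), IsW1Infty V W K →
      PosDefPotential V → ∀ (a : Vel d → CVec d) (b : Vel d → ℂ) (ω : ℂ), 0 ≤ ω.im →
      ∀ n v, ‖density β V a b ω n v‖ ≤ C * (‖a v‖ + ‖b v‖) := by
  obtain ⟨δ, hδ, hd⟩ := exists_le_norm_dispersion d hβ K
  have hg := gaussMoment_nonneg β 0
  refine ⟨(1 + K * gaussMoment β 0) / δ, by positivity, fun V W h hV a b ω hω n v => ?_⟩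
  have h1 := hd V W h hV ω hω n v
  rw [density, norm_div, div_mul_eq_mul_div]
  refine div_le_div₀ (by positivity) ?_ hδ h1
  have h2 : ‖cdot (waveVec n) (a v)‖ / ‖waveVec n‖ ≤ ‖a v‖ :=
    div_le_of_le_mul₀ (norm_nonneg _) (norm_nonneg _)
      ((norm_cdot_le _ _).trans_eq (mul_comm _ _))
  have h3 : ‖Complex.I * (Vhat V n : ℝ) * cdot (waveVec n) (a v) *
      (gaussLaplace β (plasmaArg ω (waveVec n) v) / ‖waveVec n‖)‖ ≤
      K * ‖a v‖ * gaussMoment β 0 := by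
    have e : ‖Complex.I * (Vhat V n : ℝ) * cdot (waveVec n) (a v) *
      (gaussLaplace β (plasmaArg ω (waveVec n) v) / ‖waveVec n‖)‖ =
      Vhat V n * (‖cdot (waveVec n) (a v)‖ / ‖waveVec n‖) *
        ‖gaussLaplace β (plasmaArg ω (waveVec n) v)‖ := by
      simp only [norm_mul, norm_div, Complex.norm_I, Complex.norm_real, norm_norm,
        Real.norm_of_nonneg (show 0 ≤ Vhat V n from (hV n).1)]
      ring
    rw [e]
    have := Vhat_le h n
    have := norm_gaussLaplace_le hβ (im_plasmaArg_nonneg hω (waveVec n) v)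
    gcongr
  calc _ ≤ ‖b v‖ + K * ‖a v‖ * gaussMoment β 0 := (norm_add_le _ _).trans (by gcongr)
    _ ≤ (1 + K * gaussMoment β 0) * (‖a v‖ + ‖b v‖) := by
      have e1 : 0 ≤ (K : ℝ) * gaussMoment β 0 * ‖b v‖ := by positivity
      have e2 := norm_nonneg (a v)
      linarith

lemma im_sub_ofReal (ω : ℂ) (x : ℝ) : (ω - x).im = ω.im := by simp

lemma memLp_norm_add_norm (ha : MemLp a 2 (maxwell d β)) (hb : MemLp b 2 (maxwell d β)) :
    MemLp (fun v => ‖a v‖ + ‖b v‖) 2 (maxwell d β) :=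
  ha.norm.add hb.norm

/-- Fed into the second-moment bound, the constant 1 shows that |v| itself is square integrable. -/
lemma hasWeakPartial_one (d : ℕ) (j : Fin d) :
    HasWeakPartial j (fun _ : Vel d => (1 : ℝ)) (fun _ => 0) := by
  intro η hη hηs
  simp only [one_mul, zero_mul, integral_zero, neg_zero]
  have h := integral_mul_fderiv_eq_neg_fderiv_mul_of_integrable (μ := (volume : Measure (Vel d)))
    (f := fun _ : Vel d => (1 : ℝ)) (g := η) (v := EuclideanSpace.single j (1 : ℝ))
  simp only [fderiv_fun_const, Pi.zero_apply, _root_.zero_apply, zero_mul, one_mul,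
    integral_zero, neg_zero] at h
  exact h (integrable_zero _ _ _) ((continuous_velPartial hη j).integrable_of_hasCompactSupport
    (hasCompactSupport_velPartial hηs j)) (hη.continuous.integrable_of_hasCompactSupport hηs)
    (fun x _ => differentiableAt_const _) (fun x _ => (hη.differentiable (by simp)) x)

lemma memLp_norm_id (d : ℕ) (hβ : 0 < β) : MemLp (fun v : Vel d => ‖v‖) 2 (maxwell d β) := by
  have := isProbabilityMeasure_maxwell d hβ
  have h1 : ∀ j : Fin d, MemLp (fun v : Vel d => v j) 2 (maxwell d β) := fun j => by
    simpa using memLp_coord_mul_of_hasWeakPartial hβ (memLp_const 1) (memLp_const 0)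
      (hasWeakPartial_one d j)
  have h2 : MemLp (fun v : Vel d => ∑ j, ‖v j‖) 2 (maxwell d β) :=
    memLp_finsetSum _ fun j _ => (h1 j).norm
  refine h2.mono (by fun_prop) (ae_of_all _ fun v => ?_)
  rw [norm_norm, Real.norm_of_nonneg (Finset.sum_nonneg fun _ _ => norm_nonneg _)]
  calc ‖v‖ = ‖∑ j, EuclideanSpace.single j (v j)‖ := by
        congr 1
        ext i
        simp [Finset.sum_apply, Pi.single_apply]
    _ ≤ ∑ j, ‖v j‖ := (norm_sum_le _ _).trans_eq (by simp)

lemma memLp_prod_mul {f : Vel d → ℝ} {h : Vel d → ℝ} (hf : MemLp f 2 (maxwell d β))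
    (hh : MemLp h 2 (maxwell d β)) :
    MemLp (fun v : Vel d × Vel d => f v.1 * h v.2) 2 (velMeasure2 d β) := by
  have e : eLpNorm (fun v : Vel d × Vel d => f v.1 * h v.2) 2 (velMeasure2 d β) =
      eLpNorm (fun v : Vel d × Vel d => (f v.1 : ℂ) * (h v.2 : ℂ)) 2 (velMeasure2 d β) :=
    eLpNorm_congr_norm_ae (ae_of_all _ fun v => by simp)
  refine ⟨hf.1.comp_fst.mul hh.1.comp_snd, ?_⟩
  rw [e, velMeasure2, eLpNorm_two_prod_mul (Complex.continuous_ofReal.comp_aestronglyMeasurable hf.1)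
    (Complex.continuous_ofReal.comp_aestronglyMeasurable hh.1)]
  exact ENNReal.mul_lt_top hf.ofReal.2 hh.ofReal.2

/-- The square-integrable majorant of the modes of the resolvent. -/
lemma exists_norm_resolventMode_le (hβ : 0 < β) (h : IsW1Infty V W K) (hV : PosDefPotential V)
    (hω : 0 < ω.im) (ha : MemLp a 2 (maxwell d β)) (hb : MemLp b 2 (maxwell d β)) :
    ∃ Ψ : Vel d × Vel d → ℝ, MemLp Ψ 2 (velMeasure2 d β) ∧ ∀ n v,
      ‖resolventMode β V a b ω n v‖ ≤ ‖waveVec n‖ * Vhat V n * Ψ v := by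
  have := isProbabilityMeasure_maxwell d hβ
  obtain ⟨C, hC0, hC⟩ := exists_norm_density_le d hβ K
  have hab := memLp_norm_add_norm ha hb
  have h1 := memLp_prod_mul hab (memLp_const (1 : ℝ) (p := 2) (μ := maxwell d β))
  have h2 := memLp_prod_mul hab (memLp_norm_id d hβ)
  -- The factor 1/Im ω blows up at the real axis: this majorant serves for existence at fixed ω, not
  -- for the limit.
  refine ⟨_, ((h1.add (h2.const_mul (β * C))).const_mul ω.im⁻¹), fun n v => ?_⟩
  have hVn : 0 ≤ Vhat V n := (hV n).1
  have hD := hC V W h hV a b ω hω.le n v.1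
  have hi := norm_inv_add_ofReal_le (ξ := ω - (inner ℝ (waveVec n) v.1 : ℝ))
    (by rwa [im_sub_ofReal]) (inner ℝ (waveVec n) v.2)
  rw [im_sub_ofReal] at hi
  have hk : ‖inner ℝ (waveVec n) v.2‖ ≤ ‖waveVec n‖ * ‖v.2‖ := norm_inner_le_norm _ _
  rw [resolventMode, norm_mul, norm_mul, norm_neg, Complex.norm_real, Real.norm_of_nonneg hVn]
  have h3 : ‖cdot (waveVec n) (a v.1) +
      β * (inner ℝ (waveVec n) v.2 : ℝ) * density β V a b ω n v.1‖ ≤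
      ‖waveVec n‖ * ((‖a v.1‖ + ‖b v.1‖) * 1 + β * C * ((‖a v.1‖ + ‖b v.1‖) * ‖v.2‖)) := by
    refine (norm_add_le _ _).trans ?_
    rw [norm_mul, norm_mul, Complex.norm_real, Complex.norm_real, Real.norm_of_nonneg hβ.le]
    calc _ ≤ ‖waveVec n‖ * ‖a v.1‖ + β * (‖waveVec n‖ * ‖v.2‖) * (C * (‖a v.1‖ + ‖b v.1‖)) := by
          gcongr
          exact norm_cdot_le _ _
      _ ≤ _ := by
          nlinarith [mul_nonneg (norm_nonneg (waveVec n)) (norm_nonneg (b v.1))]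
  calc _ ≤ Vhat V n * (‖waveVec n‖ * ((‖a v.1‖ + ‖b v.1‖) * 1 +
        β * C * ((‖a v.1‖ + ‖b v.1‖) * ‖v.2‖))) * ω.im⁻¹ := by gcongr
    _ = _ := by
      simp only [Pi.add_apply]
      ring

lemma aestronglyMeasurable_resolventMode (hβ : 0 < β) (hω : 0 < ω.im) (n : Fin d → ℤ)
    (ha : MemLp a 2 (maxwell d β)) (hb : MemLp b 2 (maxwell d β)) :
    AEStronglyMeasurable (resolventMode β V a b ω n) (velMeasure2 d β) := by
  have h1 := (aestronglyMeasurable_cdot ha.1 (waveVec n)).comp_fst (ν := maxwell d β)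
  have h2 := (aestronglyMeasurable_density (V := V) hβ hω.le n ha.1 hb.1).comp_fst
    (ν := maxwell d β)
  have h3 : AEStronglyMeasurable (fun v : Vel d × Vel d =>
      (β : ℂ) * (inner ℝ (waveVec n) v.2 : ℝ)) (velMeasure2 d β) :=
    (by fun_prop : Continuous _).aestronglyMeasurable
  have h4 : AEStronglyMeasurable (fun v : Vel d × Vel d =>
      (ω - (inner ℝ (waveVec n) v.1 : ℝ) + (inner ℝ (waveVec n) v.2 : ℝ))⁻¹) (velMeasure2 d β) :=
    (by fun_prop : Continuous fun v : Vel d × Vel d =>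
      (ω - (inner ℝ (waveVec n) v.1 : ℝ) + (inner ℝ (waveVec n) v.2 : ℝ))).measurable.inv.aestronglyMeasurable
  exact ((h1.add (h3.mul h2)).const_mul _).mul h4

lemma memLp_resolventMode (hβ : 0 < β) (h : IsW1Infty V W K) (hV : PosDefPotential V)
    (hω : 0 < ω.im) (ha : MemLp a 2 (maxwell d β)) (hb : MemLp b 2 (maxwell d β))
    (n : Fin d → ℤ) : MemLp (resolventMode β V a b ω n) 2 (velMeasure2 d β) := by
  obtain ⟨Ψ, hΨ, hle⟩ := exists_norm_resolventMode_le hβ h hV hω ha hb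
  exact (hΨ.const_mul (‖waveVec n‖ * Vhat V n)).mono
    (aestronglyMeasurable_resolventMode hβ hω n ha hb)
    (ae_of_all _ fun v => (hle n v).trans (le_abs_self _))

lemma summable_integral_sq_resolventMode (hβ : 0 < β) (h : IsW1Infty V W K)
    (hV : PosDefPotential V) (hω : 0 < ω.im) (ha : MemLp a 2 (maxwell d β))
    (hb : MemLp b 2 (maxwell d β)) :
    Summable fun n => ∫ v, ‖resolventMode β V a b ω n v‖ ^ 2 ∂(velMeasure2 d β) := by
  obtain ⟨Ψ, hΨ, hle⟩ := exists_norm_resolventMode_le hβ h hV hω ha hb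
  refine Summable.of_nonneg_of_le (fun n => integral_nonneg fun v => by positivity) (fun n => ?_)
    ((summable_sq_waveVec_mul_Vhat h hV).1.mul_right (∫ v, Ψ v ^ 2 ∂(velMeasure2 d β)))
  rw [← integral_const_mul]
  refine integral_mono_of_nonneg (ae_of_all _ fun v => by positivity)
    (hΨ.integrable_sq.const_mul _) (ae_of_all _ fun v => ?_)
  calc ‖resolventMode β V a b ω n v‖ ^ 2 ≤ (‖waveVec n‖ * Vhat V n * Ψ v) ^ 2 := by
        gcongr
        exact hle n v
    _ = _ := by ring

/-- The density of the resolvent. -/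
lemma integral_resolventMode (hβ : 0 < β) (h : IsW1Infty V W K) (hV : PosDefPotential V)
    (hω : 0 < ω.im) {n : Fin d → ℤ} (hn : waveVec n ≠ 0) (v : Vel d) :
    ∫ w, resolventMode β V a b ω n (v, w) ∂(maxwell d β) = density β V a b ω n v - b v := by
  have := isProbabilityMeasure_maxwell d hβ
  set ξ : ℂ := ω - (inner ℝ (waveVec n) v : ℝ) with hξ
  have hξi : 0 < ξ.im := by rwa [hξ, im_sub_ofReal]
  have hε := dispersion_ne_zero hβ h hV hω.le n v
  have i1 := integrable_inv_add_inner hβ hξi (waveVec n)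
  have i2 : Integrable (fun w => ((inner ℝ (waveVec n) w : ℝ) : ℂ) *
      (ξ + (inner ℝ (waveVec n) w : ℝ))⁻¹) (maxwell d β) := by
    have : ∀ w, ((inner ℝ (waveVec n) w : ℝ) : ℂ) * (ξ + (inner ℝ (waveVec n) w : ℝ))⁻¹ =
        1 - ξ * (ξ + (inner ℝ (waveVec n) w : ℝ))⁻¹ := by
      intro w
      have := add_ofReal_ne_zero hξi (inner ℝ (waveVec n) w)
      field_simp
      ring
    simp only [this]
    exact (integrable_const 1).sub (i1.const_mul ξ)
  have e : ∀ w, resolventMode β V a b ω n (v, w) =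
      (-(Vhat V n : ℝ) * cdot (waveVec n) (a v)) * (ξ + (inner ℝ (waveVec n) w : ℝ))⁻¹ +
      (-(Vhat V n : ℝ) * β * density β V a b ω n v) * (((inner ℝ (waveVec n) w : ℝ) : ℂ) *
        (ξ + (inner ℝ (waveVec n) w : ℝ))⁻¹) := by
    intro w
    simp only [resolventMode, hξ]
    ring
  simp only [e]
  rw [integral_add (i1.const_mul _) (i2.const_mul _), integral_const_mul, integral_const_mul,
    integral_inv_add_inner hβ hξi hn, integral_inner_mul_inv_add_inner hβ hξi hn]
  -- The density is by definition the solution of this scalar equation, which is the consistency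
  -- condition for the average of the mode.
  have e3 : density β V a b ω n v * dispersion β V ω n v = b v + Complex.I * (Vhat V n : ℝ) *
      cdot (waveVec n) (a v) * (gaussLaplace β (ξ / ‖waveVec n‖) / ‖waveVec n‖) := by
    rw [density, div_mul_cancel₀ _ hε]
    rfl
  have e4 : dispersion β V ω n v =
      1 + ((β * Vhat V n : ℝ) : ℂ) * plasmaZ β (ξ / ‖waveVec n‖) := rfl
  rw [e4] at e3
  push_cast at e3
  linear_combination -e3

/-- The equation solved by the modes. -/
lemma resolventMode_equation (hβ : 0 < β) (h : IsW1Infty V W K) (hV : PosDefPotential V)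
    (hω : 0 < ω.im) (n : Fin d → ℤ) (v : Vel d × Vel d) :
    Complex.I * (inner ℝ (waveVec n) (v.1 - v.2) : ℝ) * resolventMode β V a b ω n v =
      Complex.I * (Vhat V n : ℝ) * (cdot (waveVec n) (a v.1) +
        β * (inner ℝ (waveVec n) v.2 : ℝ) * b v.1) +
      Complex.I * ω * resolventMode β V a b ω n v -
      -(Complex.I * (β * Vhat V n : ℝ) * (inner ℝ (waveVec n) v.2 : ℝ)) *
        ∫ w, resolventMode β V a b ω n (v.1, w) ∂(maxwell d β) := by
  by_cases hn : waveVec n = 0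
  · simp [resolventMode, hn, cdot_zero_left]
  rw [integral_resolventMode hβ h hV hω hn]
  have hξi : 0 < (ω - (inner ℝ (waveVec n) v.1 : ℝ)).im := by rwa [im_sub_ofReal]
  have hne := add_ofReal_ne_zero hξi (inner ℝ (waveVec n) v.2)
  have e : resolventMode β V a b ω n v *
      (ω - (inner ℝ (waveVec n) v.1 : ℝ) + (inner ℝ (waveVec n) v.2 : ℝ)) =
      -(Vhat V n : ℝ) * (cdot (waveVec n) (a v.1) +
        β * (inner ℝ (waveVec n) v.2 : ℝ) * density β V a b ω n v.1) := by
    rw [resolventMode, inv_mul_cancel_right₀ hne]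
  rw [inner_sub_right]
  push_cast
  linear_combination -Complex.I * e

end ResolventMode

end LenardBalescu
end

noncomputable section

namespace LenardBalescu

/-! ### Existence of the resolvent -/

section Existence

variable {d : ℕ} {β : ℝ} {hβ : 0 < β} {V : Torus d → ℝ} {W : Torus d → Vel d} {K : ℝ≥0}
  {ω : ℂ} (g : H1 d hβ)

lemma memLp_val : MemLp (val g) 2 (maxwell d β) := Lp.memLp _

lemma memLp_grad : MemLp (grad g) 2 (maxwell d β) := Lp.memLp _

lemma gradStar_apply (v : Vel d) (j : Fin d) :
    gradStar g v j = grad g v j - β * (((v j : ℝ) : ℂ) * val g v) := by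
  simp only [gradStar, PiLp.sub_apply, PiLp.smul_apply, smul_eq_mul, toC]
  ring

/-- Not part of the definition of H¹_β: it relies on the second moment of g. -/
lemma memLp_gradStar : MemLp (gradStar g) 2 (maxwell d β) := by
  refine MemLp.of_eval_piLp fun j => ?_
  simp only [gradStar_apply]
  exact (memLp_coord (memLp_grad g) j).sub ((memLp_coord_mul_val g j).const_mul _)

/-- The velocity factor of the component `j` of `S₁² g`. -/
def sourceFactor (j : Fin d) (v : Vel d × Vel d) : ℂ :=
  gradStar g v.1 j + β * (val g v.1 * ((v.2 j : ℝ) : ℂ))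

lemma memLp_complex_prod_mul {f h : Vel d → ℂ} (hf : MemLp f 2 (maxwell d β))
    (hh : MemLp h 2 (maxwell d β)) :
    MemLp (fun v : Vel d × Vel d => f v.1 * h v.2) 2 (velMeasure2 d β) := by
  refine ⟨hf.1.comp_fst.mul hh.1.comp_snd, ?_⟩
  rw [velMeasure2, eLpNorm_two_prod_mul hf.1 hh.1]
  exact ENNReal.mul_lt_top hf.2 hh.2

include hβ in
lemma memLp_coord_id (j : Fin d) : MemLp (fun v : Vel d => ((v j : ℝ) : ℂ)) 2 (maxwell d β) :=
  (memLp_norm_id d hβ).mono (by fun_prop) (ae_of_all _ fun v => by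
    simpa using PiLp.norm_apply_le v j)

lemma memLp_sourceFactor (j : Fin d) : MemLp (sourceFactor g j) 2 (velMeasure2 d β) := by
  have := isProbabilityMeasure_maxwell d hβ
  have h1 := memLp_complex_prod_mul (memLp_coord (memLp_gradStar g) j)
    (memLp_const (1 : ℂ) (p := 2) (μ := maxwell d β))
  simp only [mul_one] at h1
  exact h1.add ((memLp_complex_prod_mul (memLp_val g) (memLp_coord_id (hβ := hβ) j)).const_mul _)

lemma S12_eq_sum (z : Phase d × Phase d) :
    S12 W g z = ∑ j, rel (fun x => ((W x j : ℝ) : ℂ)) (sourceFactor g j) z := by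
  rw [S12, ← cdot, cdot_eq_sum]
  refine Finset.sum_congr rfl fun j _ => ?_
  simp only [rel, sourceFactor, PiLp.add_apply, PiLp.smul_apply, smul_eq_mul, toC]
  ring

lemma memLp_two_grad_coord (h : IsW1Infty V W K) (j : Fin d) :
    MemLp (fun x => ((W x j : ℝ) : ℂ)) 2 (torusMeasure d) :=
  (memLp_top_grad_coord h j).mono_exponent le_top

lemma memLp_S12 (h : IsW1Infty V W K) : MemLp (S12 W g) 2 (phaseMeasure2 d β) := by
  have e : S12 W g = fun z => ∑ j, rel (fun x => ((W x j : ℝ) : ℂ)) (sourceFactor g j) z :=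
    funext (S12_eq_sum g)
  rw [e]
  exact memLp_finsetSum _ fun j _ => memLp_rel (memLp_two_grad_coord h j) (memLp_sourceFactor g j)

/-- The mode `n` of `S₁² g`. -/
def sourceMode (V : Torus d → ℝ) (n : Fin d → ℤ) (v : Vel d × Vel d) : ℂ :=
  Complex.I * (Vhat V n : ℝ) * (cdot (waveVec n) (gradStar g v.1) +
    β * (inner ℝ (waveVec n) v.2 : ℝ) * val g v.1)

lemma sourceMode_eq_sum (n : Fin d → ℤ) (v : Vel d × Vel d) :
    sourceMode g V n v =
      ∑ j, Complex.I * (waveVec n j : ℝ) * (Vhat V n : ℝ) * sourceFactor g j v := by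
  rw [sourceMode, cdot_eq_sum, PiLp.inner_apply, Complex.ofReal_sum, Finset.mul_sum,
    Finset.sum_mul, ← Finset.sum_add_distrib, Finset.mul_sum]
  refine Finset.sum_congr rfl fun j _ => ?_
  simp [sourceFactor]
  ring

lemma memLp_sourceMode (n : Fin d → ℤ) : MemLp (sourceMode g V n) 2 (velMeasure2 d β) := by
  have e : sourceMode g V n = fun v =>
      ∑ j, Complex.I * (waveVec n j : ℝ) * (Vhat V n : ℝ) * sourceFactor g j v :=
    funext (sourceMode_eq_sum g n)
  rw [e]
  exact memLp_finsetSum _ fun j _ => (memLp_sourceFactor g j).const_mul _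

/-- S₁²g is a finite sum of products ∂_jV(x₀ - x₁) times a velocity factor, each of which expands in
modes. -/
lemma hasSum_integral_S12_mul (h : IsW1Infty V W K) (hV : PosDefPotential V)
    {Φ : Phase d × Phase d → ℂ} (hΦ : MemLp Φ 2 (phaseMeasure2 d β)) :
    HasSum (fun n => ∫ z, mode n (sourceMode g V n) z * Φ z ∂(phaseMeasure2 d β))
      (∫ z, S12 W g z * Φ z ∂(phaseMeasure2 d β)) := by
  have i1 : ∀ j, Integrable (fun z => rel (fun x => ((W x j : ℝ) : ℂ)) (sourceFactor g j) z * Φ z)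
      (phaseMeasure2 d β) := fun j =>
    (memLp_rel (memLp_two_grad_coord h j) (memLp_sourceFactor g j)).integrable_mul hΦ
  have i2 : ∀ n j, Integrable (fun z => mode n (sourceFactor g j) z * Φ z) (phaseMeasure2 d β) :=
    fun n j => (memLp_mode n (memLp_sourceFactor g j)).integrable_mul hΦ
  have e1 : ∫ z, S12 W g z * Φ z ∂(phaseMeasure2 d β) =
      ∑ j, ∫ z, rel (fun x => ((W x j : ℝ) : ℂ)) (sourceFactor g j) z * Φ z
        ∂(phaseMeasure2 d β) := by
    simp only [S12_eq_sum, Finset.sum_mul]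
    exact integral_finsetSum _ fun j _ => i1 j
  have e2 : ∀ n, ∫ z, mode n (sourceMode g V n) z * Φ z ∂(phaseMeasure2 d β) =
      ∑ j, UnitAddTorus.mFourierCoeff (fun x => ((W x j : ℝ) : ℂ)) n *
        ∫ z, mode n (sourceFactor g j) z * Φ z ∂(phaseMeasure2 d β) := by
    intro n
    have e3 : ∀ z, mode n (sourceMode g V n) z * Φ z =
        ∑ j, Complex.I * (waveVec n j : ℝ) * (Vhat V n : ℝ) *
          (mode n (sourceFactor g j) z * Φ z) := by
      intro z
      simp only [mode, rel, sourceMode_eq_sum]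
      rw [Finset.mul_sum, Finset.sum_mul]
      refine Finset.sum_congr rfl fun j _ => ?_
      ring
    simp only [e3]
    rw [integral_finsetSum _ fun j _ => (i2 n j).const_mul _]
    refine Finset.sum_congr rfl fun j _ => ?_
    rw [integral_const_mul, mFourierCoeff_grad h hV]
  rw [e1]
  simp only [e2]
  exact hasSum_sum fun j _ =>
    hasSum_integral_rel_mul (memLp_two_grad_coord h j) (memLp_sourceFactor g j) hΦ

/-- The solution of the resolvent equation, as a sum of modes. -/
def resolventSol (hW : IsW1Infty V W K) (hV : PosDefPotential V) (hω : 0 < ω.im) :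
    L2Phase2 d β :=
  ∑' n, modeLp n (resolventMode β V (gradStar g) (val g) ω n)
    (memLp_resolventMode hβ hW hV hω (memLp_gradStar g) (memLp_val g) n)

lemma hasSum_resolventSol (hW : IsW1Infty V W K) (hV : PosDefPotential V) (hω : 0 < ω.im) :
    HasSum (fun n => modeLp n (resolventMode β V (gradStar g) (val g) ω n)
      (memLp_resolventMode hβ hW hV hω (memLp_gradStar g) (memLp_val g) n))
      (resolventSol g hW hV hω) :=
  (summable_modeLp _ (summable_integral_sq_resolventMode hβ hW hV hω (memLp_gradStar g)
    (memLp_val g))).hasSum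

lemma natCast_add_one_sub_one_div {N : ℕ} (hN : 1 ≤ N) : ((N : ℝ) + 1 - 1) / N = 1 := by
  have : (N : ℝ) ≠ 0 := by positivity
  field_simp
  ring

/-- The right-hand side F must be S₁²g + iωH. With the mean-field term transposed, every term of the
weak equation is a continuous functional on L², so both sides are series over n. It suffices to
compare the n-th terms, and this is `resolventMode_equation`. -/
lemma solvesResolvent_resolventSol (hW : IsW1Infty V W K) (hV : PosDefPotential V)
    (hω : 0 < ω.im) {N : ℕ} (hN : 1 ≤ N) :
    SolvesResolvent N W ω (S12 W g) (resolventSol g hW hV hω) := by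
  set H := resolventSol g hW hV hω with hH
  set ψ := resolventMode β V (gradStar g) (val g) ω with hψd
  have hψ : ∀ n, MemLp (ψ n) 2 (velMeasure2 d β) :=
    memLp_resolventMode hβ hW hV hω (memLp_gradStar g) (memLp_val g)
  have hsum : HasSum (fun n => modeLp n (ψ n) (hψ n)) H := hasSum_resolventSol g hW hV hω
  have hS := memLp_S12 g hW
  refine ⟨hS.toLp (S12 W g) + (Complex.I * ω) • H, fun φ hφ => ?_, ?_⟩
  swap
  · rw [add_sub_cancel_right]
    exact hS.coeFn_toLp
  have hφ2 := memLp_of_continuous_compactSupport hβ hφ.continuous hφ.compactSupport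
  have hτ2 := memLp_of_continuous_compactSupport hβ hφ.continuous_transport
    hφ.hasCompactSupport_transport
  have hmf := integral_meanField_mul hβ hW hφ.continuous hφ.compactSupport (Lp.memLp H)
  have hadj := memLp_meanFieldAdj hβ hW hφ.continuous hφ.compactSupport
  have iS : Integrable (fun z => S12 W g z * φ z) (phaseMeasure2 d β) := hS.integrable_mul hφ2
  have iH : Integrable (fun z => H z * φ z) (phaseMeasure2 d β) :=
    (Lp.memLp H).integrable_mul hφ2
  have iSH : Integrable (fun z => S12 W g z * φ z + Complex.I * ω * (H z * φ z))
      (phaseMeasure2 d β) := iS.add (iH.const_mul _)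
  have hR : ∫ z, ((hS.toLp (S12 W g) + (Complex.I * ω) • H : L2Phase2 d β) z -
      ((((N : ℝ) + 1 - 1) / N : ℝ) : ℂ) * meanField β W H z) * φ z ∂(phaseMeasure2 d β) =
      ∫ z, S12 W g z * φ z ∂(phaseMeasure2 d β) +
      Complex.I * ω * ∫ z, H z * φ z ∂(phaseMeasure2 d β) -
      ∫ z, H z * meanFieldAdj β W φ z ∂(phaseMeasure2 d β) := by
    rw [← hmf.2, ← integral_const_mul, ← integral_add iS (iH.const_mul _),
      ← integral_sub iSH hmf.1, natCast_add_one_sub_one_div hN]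
    refine integral_congr_ae ?_
    filter_upwards [hS.coeFn_toLp, Lp.coeFn_add (hS.toLp (S12 W g)) ((Complex.I * ω) • H),
      Lp.coeFn_smul (Complex.I * ω) H] with z h1 h2 h3
    rw [h2, Pi.add_apply, h1, h3, Pi.smul_apply, smul_eq_mul]
    push_cast
    ring
  have s1 := hasSum_integral_mode_mul hψ hsum hτ2
  have s2 := ((hasSum_integral_S12_mul g hW hV hφ2).add
    ((hasSum_integral_mode_mul hψ hsum hφ2).mul_left (Complex.I * ω))).sub
    (hasSum_integral_mode_mul hψ hsum hadj)
  rw [hR]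
  refine (s1.congr_fun ?_).unique s2.neg
  intro n
  have hmfn := integral_meanField_mul hβ hW hφ.continuous hφ.compactSupport
    (memLp_mode n (hψ n))
  have iSn : Integrable (fun z => mode n (sourceMode g V n) z * φ z) (phaseMeasure2 d β) :=
    (memLp_mode n (memLp_sourceMode g n)).integrable_mul hφ2
  have iHn : Integrable (fun z => mode n (ψ n) z * φ z) (phaseMeasure2 d β) :=
    (memLp_mode n (hψ n)).integrable_mul hφ2
  have iSHn : Integrable (fun z => mode n (sourceMode g V n) z * φ z +
      Complex.I * ω * (mode n (ψ n) z * φ z)) (phaseMeasure2 d β) := iSn.add (iHn.const_mul _)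
  rw [integral_mode_mul_transport hβ n (hψ n) hφ, ← hmfn.2, ← integral_const_mul,
    ← integral_add iSn (iHn.const_mul _), ← integral_sub iSHn hmfn.1]
  congr 1
  refine integral_congr_ae (ae_of_all _ fun z => ?_)
  simp only [meanField_mode hW hV]
  simp only [mode, rel, hψd]
  have e := resolventMode_equation (a := gradStar g) (b := val g) hβ hW hV hω n (z.1.2, z.2.2)
  simp only at e
  simp only [sourceMode, e]
  ring

end Existence

end LenardBalescu
end

noncomputable section

namespace LenardBalescu

/-! ### Double Fourier coefficients -/

lemma memLp_integral_prod {α γ : Type*} [MeasurableSpace α] [MeasurableSpace γ] {μ : Measure α}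
    {ν : Measure γ} [SFinite μ] [IsProbabilityMeasure ν] {F : α × γ → ℂ}
    (hF : MemLp F 2 (μ.prod ν)) : MemLp (fun x => ∫ y, F (x, y) ∂ν) 2 μ := by
  refine memLp_two_iff_lintegral.2 ⟨hF.1.integral_prod_right', ?_⟩
  obtain ⟨hm, hlt⟩ := memLp_two_iff_lintegral.1 hF
  rw [lintegral_prod _ (hm.enorm.pow_const 2)] at hlt
  refine lt_of_le_of_lt (lintegral_mono_ae ?_) hlt
  filter_upwards [hm.prodMk_left] with x hx
  have h1 : ‖∫ y, F (x, y) ∂ν‖ₑ ≤ eLpNorm (fun y => F (x, y)) 1 ν := by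
    rw [eLpNorm_one_eq_lintegral_enorm]
    exact enorm_integral_le_lintegral_enorm _
  have h2 : eLpNorm (fun y => F (x, y)) 1 ν ≤ eLpNorm (fun y => F (x, y)) 2 ν :=
    eLpNorm_le_eLpNorm_of_exponent_le (by norm_num) hx
  have h3 : eLpNorm (fun y => F (x, y)) 2 ν ^ 2 = ∫⁻ y, ‖F (x, y)‖ₑ ^ 2 ∂ν := by
    rw [eLpNorm_eq_lintegral_rpow_enorm_toReal (by norm_num) (by norm_num), ← ENNReal.rpow_natCast,
      ← ENNReal.rpow_mul]
    norm_num
  rw [← h3]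
  gcongr
  exact h1.trans h2

lemma memLp_prodMk_left {α γ : Type*} [MeasurableSpace α] [MeasurableSpace γ] {μ : Measure α}
    {ν : Measure γ} [SFinite μ] [SFinite ν] {F : α × γ → ℂ}
    (hF : MemLp F 2 (μ.prod ν)) : ∀ᵐ x ∂μ, MemLp (fun y => F (x, y)) 2 ν := by
  obtain ⟨hm, hlt⟩ := memLp_two_iff_lintegral.1 hF
  rw [lintegral_prod _ (hm.enorm.pow_const 2)] at hlt
  filter_upwards [hm.prodMk_left, ae_lt_top' (hm.enorm.pow_const 2).lintegral_prod_right' hlt.ne]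
    with x h1 h2
  exact memLp_two_iff_lintegral.2 ⟨h1, h2⟩

/-- A function on `𝕋^d × 𝕋^d` with vanishing Fourier coefficients vanishes. -/
lemma ae_eq_zero_of_double_mFourierCoeff {d : ℕ} {f : Torus d × Torus d → ℂ}
    (hf : MemLp f 2 ((torusMeasure d).prod (torusMeasure d)))
    (h : ∀ m n, ∫ x, f x * (UnitAddTorus.mFourier (-m) x.1 * UnitAddTorus.mFourier (-n) x.2)
      ∂((torusMeasure d).prod (torusMeasure d)) = 0) :
    f =ᵐ[(torusMeasure d).prod (torusMeasure d)] 0 := by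
  have hmul : ∀ n, MemLp (fun x : Torus d × Torus d => f x * UnitAddTorus.mFourier (-n) x.2) 2
      ((torusMeasure d).prod (torusMeasure d)) := fun n => by
    refine hf.mono (hf.1.mul (by fun_prop : Continuous _).aestronglyMeasurable)
      (ae_of_all _ fun x => ?_)
    rw [norm_mul, norm_mFourier_apply, mul_one]
  -- One variable at a time: the partial coefficient in y is a square-integrable function of x, all
  -- of whose own coefficients vanish.
  have h1 : ∀ n, (fun x => ∫ y, f (x, y) * UnitAddTorus.mFourier (-n) y ∂(torusMeasure d))
      =ᵐ[torusMeasure d] 0 := by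
    intro n
    refine ae_eq_zero_of_mFourierCoeff (memLp_integral_prod (hmul n)) fun m => ?_
    rw [mFourierCoeff_eq_integral_torusMeasure, ← h m n, integral_prod]
    · refine integral_congr_ae (ae_of_all _ fun x => ?_)
      simp only
      rw [← integral_const_mul]
      refine integral_congr_ae (ae_of_all _ fun y => ?_)
      simp only
      ring
    · refine (hf.integrable (by norm_num)).mono
        (hf.1.mul (by fun_prop : Continuous _).aestronglyMeasurable) (ae_of_all _ fun x => ?_)
      rw [norm_mul, norm_mul, norm_mFourier_apply, norm_mFourier_apply, mul_one, mul_one]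
  have h2 : ∀ᵐ x ∂(torusMeasure d), ∀ᵐ y ∂(torusMeasure d), f (x, y) = 0 := by
    filter_upwards [ae_all_iff.2 h1, memLp_prodMk_left hf] with x hx hx2
    refine ae_eq_zero_of_mFourierCoeff hx2 fun n => ?_
    rw [mFourierCoeff_eq_integral_torusMeasure]
    simpa only [mul_comm, Pi.zero_apply] using hx n
  have h3 := (hf.1.enorm).lintegral_prod_right'
  have h4 : ∫⁻ x, ‖f x‖ₑ ∂((torusMeasure d).prod (torusMeasure d)) = 0 := by
    rw [lintegral_prod _ hf.1.enorm, lintegral_eq_zero_iff' h3]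
    filter_upwards [h2] with x hx
    rw [Pi.zero_apply]
    refine (lintegral_congr_ae ?_).trans lintegral_zero
    filter_upwards [hx] with y hy
    rw [hy, enorm_zero]
  filter_upwards [(lintegral_eq_zero_iff' hf.1.enorm).1 h4] with x hx
  simpa using hx

/-- The function `exp(-i k₀·x₀) exp(-i k₁·x₁) θ(v₀, v₁)` on `𝔻²`. -/
def planeWave {d : ℕ} (m n : Fin d → ℤ) (θ : Vel d × Vel d → ℂ) (z : Phase d × Phase d) : ℂ :=
  UnitAddTorus.mFourier (-m) z.1.1 * UnitAddTorus.mFourier (-n) z.2.1 * θ (z.1.2, z.2.2)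

/-- The Fourier coefficient in both positions. -/
def coeff2 {d : ℕ} (G : Phase d × Phase d → ℂ) (m n : Fin d → ℤ) (v : Vel d × Vel d) : ℂ :=
  ∫ x : Torus d × Torus d, G ((x.1, v.1), (x.2, v.2)) *
    (UnitAddTorus.mFourier (-m) x.1 * UnitAddTorus.mFourier (-n) x.2)
    ∂((torusMeasure d).prod (torusMeasure d))

section

variable {d : ℕ} {β : ℝ} {V : Torus d → ℝ} {W : Torus d → Vel d} {K : ℝ≥0}
  {ω : ℂ} {G : Phase d × Phase d → ℂ}

lemma measurePreserving_velocity_first (d : ℕ) (β : ℝ) :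
    MeasurePreserving (fun p : (Vel d × Vel d) × (Torus d × Torus d) =>
      ((p.2.1, p.1.1), (p.2.2, p.1.2)))
      ((velMeasure2 d β).prod ((torusMeasure d).prod (torusMeasure d))) (phaseMeasure2 d β) := by
  let e : Phase d × Phase d ≃ᵐ (Torus d × Torus d) × (Vel d × Vel d) :=
    { toFun := regroup
      invFun := fun p => ((p.1.1, p.2.1), (p.1.2, p.2.2))
      left_inv := fun _ => rfl
      right_inv := fun _ => rfl
      measurable_toFun := (measurePreserving_regroup d 0).measurable
      measurable_invFun := by
        change Measurable fun p : (Torus d × Torus d) × (Vel d × Vel d) =>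
          (((p.1.1, p.2.1), (p.1.2, p.2.2)) : Phase d × Phase d)
        fun_prop }
  have h : MeasurePreserving e _ _ := measurePreserving_regroup d β
  exact (h.symm e).comp Measure.measurePreserving_swap

lemma memLp_velocity_first (hG : MemLp G 2 (phaseMeasure2 d β)) :
    MemLp (fun p : (Vel d × Vel d) × (Torus d × Torus d) => G ((p.2.1, p.1.1), (p.2.2, p.1.2))) 2
      ((velMeasure2 d β).prod ((torusMeasure d).prod (torusMeasure d))) :=
  hG.comp_measurePreserving (measurePreserving_velocity_first d β)

lemma memLp_coeff2 (hG : MemLp G 2 (phaseMeasure2 d β)) (m n : Fin d → ℤ) :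
    MemLp (coeff2 G m n) 2 (velMeasure2 d β) := by
  have h := memLp_velocity_first hG
  refine memLp_integral_prod (F := fun p : (Vel d × Vel d) × (Torus d × Torus d) =>
    G ((p.2.1, p.1.1), (p.2.2, p.1.2)) *
    (UnitAddTorus.mFourier (-m) p.2.1 * UnitAddTorus.mFourier (-n) p.2.2)) (h.mono (h.1.mul ?_)
    (ae_of_all _ fun x => ?_))
  · exact ((by fun_prop : Continuous fun x : Torus d × Torus d => UnitAddTorus.mFourier (-m) x.1 *
      UnitAddTorus.mFourier (-n) x.2).aestronglyMeasurable
      (μ := (torusMeasure d).prod (torusMeasure d))).comp_snd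
  · rw [norm_mul, norm_mul, norm_mFourier_apply, norm_mFourier_apply, mul_one, mul_one]

/-- The frequencies are countable, so for almost every pair of velocities all coefficients of the
section in the positions vanish at once. -/
lemma ae_eq_zero_of_coeff2 (hG : MemLp G 2 (phaseMeasure2 d β))
    (h : ∀ m n, coeff2 G m n =ᵐ[velMeasure2 d β] 0) : G =ᵐ[phaseMeasure2 d β] 0 := by
  have h1 := memLp_velocity_first hG
  have h2 : ∀ᵐ v ∂(velMeasure2 d β), ∀ᵐ x ∂((torusMeasure d).prod (torusMeasure d)),
      G ((x.1, v.1), (x.2, v.2)) = 0 := by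
    have h3 : ∀ᵐ v ∂(velMeasure2 d β), ∀ m n, coeff2 G m n v = 0 :=
      ae_all_iff.2 fun m => ae_all_iff.2 fun n => h m n
    filter_upwards [h3, memLp_prodMk_left h1] with v hv hv2
    exact ae_eq_zero_of_double_mFourierCoeff hv2 hv
  have h4 : eLpNorm G 1 (phaseMeasure2 d β) = 0 := by
    rw [← eLpNorm_comp_measurePreserving hG.1 (measurePreserving_velocity_first d β),
      eLpNorm_one_eq_lintegral_enorm]
    have hm := h1.1.enorm
    refine (lintegral_prod _ hm).trans ?_
    rw [lintegral_eq_zero_iff' hm.lintegral_prod_right']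
    filter_upwards [h2] with v hv
    rw [Pi.zero_apply]
    refine (lintegral_congr_ae ?_).trans lintegral_zero
    filter_upwards [hv] with y hy
    rw [hy, enorm_zero]
  exact (eLpNorm_eq_zero_iff hG.1 one_ne_zero).1 h4

lemma aestronglyMeasurable_planeWave (m n : Fin d → ℤ) {θ : Vel d × Vel d → ℂ}
    (hθ : AEStronglyMeasurable θ (velMeasure2 d β)) :
    AEStronglyMeasurable (planeWave m n θ) (phaseMeasure2 d β) := by
  have h1 := ((measurePreserving_snd (μ := (torusMeasure d).prod (torusMeasure d))
    (ν := velMeasure2 d β)).comp (measurePreserving_regroup d β))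
  exact (by fun_prop : Continuous fun z : Phase d × Phase d => UnitAddTorus.mFourier (-m) z.1.1 *
    UnitAddTorus.mFourier (-n) z.2.1).aestronglyMeasurable.mul (hθ.comp_measurePreserving h1)

lemma memLp_planeWave (m n : Fin d → ℤ) {θ : Vel d × Vel d → ℂ}
    (hθ : MemLp θ 2 (velMeasure2 d β)) : MemLp (planeWave m n θ) 2 (phaseMeasure2 d β) := by
  have h1 := ((measurePreserving_snd (μ := (torusMeasure d).prod (torusMeasure d))
    (ν := velMeasure2 d β)).comp (measurePreserving_regroup d β))
  refine (hθ.comp_measurePreserving h1).mono (aestronglyMeasurable_planeWave m n hθ.1)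
    (ae_of_all _ fun z => ?_)
  rw [planeWave, norm_mul, norm_mul, norm_mFourier_apply, norm_mFourier_apply, one_mul, one_mul]
  rfl

lemma integral_mul_planeWave (hG : MemLp G 2 (phaseMeasure2 d β)) (m n : Fin d → ℤ)
    {θ : Vel d × Vel d → ℂ} (hθ : MemLp θ 2 (velMeasure2 d β)) :
    ∫ z, G z * planeWave m n θ z ∂(phaseMeasure2 d β) =
      ∫ v, coeff2 G m n v * θ v ∂(velMeasure2 d β) := by
  have hi : Integrable (fun z => G z * planeWave m n θ z) (phaseMeasure2 d β) :=
    hG.integrable_mul (memLp_planeWave m n hθ)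
  rw [integral_phaseMeasure2_eq hi]
  refine integral_congr_ae (ae_of_all _ fun v => ?_)
  simp only [coeff2]
  rw [← integral_mul_const]
  refine integral_congr_ae (ae_of_all _ fun x => ?_)
  simp only [planeWave]
  ring

lemma isTest_planeWave (m n : Fin d → ℤ) {ψ : Vel d × Vel d → ℝ}
    (hψ : ContDiff ℝ (⊤ : ℕ∞) ψ) (hψs : HasCompactSupport ψ) :
    IsTest (planeWave m n (fun v => ((ψ v : ℝ) : ℂ))) := by
  refine ⟨?_, ?_⟩
  · have h1 := (contDiff_mFourier_toTorus (-m)).comp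
      (contDiff_fst.fst : ContDiff ℝ (⊤ : ℕ∞) fun y : (Vel d × Vel d) × (Vel d × Vel d) => y.1.1)
    have h2 := (contDiff_mFourier_toTorus (-n)).comp
      (contDiff_snd.fst : ContDiff ℝ (⊤ : ℕ∞) fun y : (Vel d × Vel d) × (Vel d × Vel d) => y.2.1)
    have h3 := Complex.ofRealCLM.contDiff.comp (hψ.comp
      (by fun_prop : ContDiff ℝ (⊤ : ℕ∞) fun y : (Vel d × Vel d) × (Vel d × Vel d) =>
        (y.1.2, y.2.2)))
    exact (h1.mul h2).mul h3
  · have hK : IsCompact ((fun p : (Torus d × Torus d) × (Vel d × Vel d) =>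
        (((p.1.1, p.2.1), (p.1.2, p.2.2)) : Phase d × Phase d)) ''
        (Set.univ ×ˢ tsupport ψ)) :=
      (isCompact_univ.prod hψs).image (by fun_prop)
    refine HasCompactSupport.intro hK fun z hz => ?_
    have : ψ (z.1.2, z.2.2) = 0 := by
      by_contra hne
      exact hz ⟨((z.1.1, z.2.1), (z.1.2, z.2.2)), ⟨Set.mem_univ _, subset_tsupport _ hne⟩, rfl⟩
    simp [planeWave, this]

lemma transport_planeWave (m n : Fin d → ℤ) (θ : Vel d × Vel d → ℂ) :
    transport (planeWave m n θ) = planeWave m n (fun v =>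
      -(Complex.I * ((inner ℝ (waveVec m) v.1 : ℝ) + (inner ℝ (waveVec n) v.2 : ℝ))) * θ v) := by
  funext z
  have h1 := hasDerivAt_mFourier_line (-m) z.1.1 z.1.2 0
  have h2 := hasDerivAt_mFourier_line (-n) z.2.1 z.2.2 0
  have h3 := ((h1.mul h2).mul_const (θ (z.1.2, z.2.2))).deriv
  have e : transport (planeWave m n θ) z = deriv ((fun s : ℝ =>
      UnitAddTorus.mFourier (-m) (z.1.1 + toTorus (s • z.1.2))) * (fun s : ℝ =>
      UnitAddTorus.mFourier (-n) (z.2.1 + toTorus (s • z.2.2))) * fun _ => θ (z.1.2, z.2.2)) 0 :=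
    rfl
  rw [e]
  refine h3.trans ?_
  simp only [zero_smul, toTorus_zero, add_zero, waveVec_neg, inner_neg_left, planeWave]
  push_cast
  ring

lemma integral_mFourier_mul_grad_sub (h : IsW1Infty V W K) (hV : PosDefPotential V)
    (n : Fin d → ℤ) (x₁ : Torus d) (j : Fin d) :
    Integrable (fun x => UnitAddTorus.mFourier (-n) x * ((W (x - x₁) j : ℝ) : ℂ))
      (torusMeasure d) ∧
    ∫ x, UnitAddTorus.mFourier (-n) x * ((W (x - x₁) j : ℝ) : ℂ) ∂(torusMeasure d) =
      UnitAddTorus.mFourier (-n) x₁ * (Complex.I * (waveVec n j : ℝ) * (Vhat V n : ℝ)) := by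
  have h1 : Integrable (fun x => UnitAddTorus.mFourier (-n) x * ((W x j : ℝ) : ℂ))
      (torusMeasure d) :=
    (integrable_of_memLp_top (memLp_top_grad_coord h j)).bdd_mul (c := 1)
      (UnitAddTorus.mFourier (-n)).continuous.aestronglyMeasurable
      (ae_of_all _ fun x => (norm_mFourier_apply _ x).le)
  have e : ∀ x, UnitAddTorus.mFourier (-n) x * ((W (x - x₁) j : ℝ) : ℂ) =
      UnitAddTorus.mFourier (-n) x₁ *
        (UnitAddTorus.mFourier (-n) (x - x₁) * ((W (x - x₁) j : ℝ) : ℂ)) := by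
    intro x
    rw [← mul_assoc, ← mFourier_add_arg, add_sub_cancel]
  simp only [e]
  refine ⟨(h1.comp_sub_right x₁).const_mul _, ?_⟩
  rw [integral_const_mul, integral_sub_right_eq_self (μ := torusMeasure d)
    (fun x => UnitAddTorus.mFourier (-n) x * ((W x j : ℝ) : ℂ)),
    ← mFourierCoeff_eq_integral_torusMeasure, mFourierCoeff_grad h hV]

lemma meanFieldAdj_planeWave (hβ : 0 < β) (h : IsW1Infty V W K) (hV : PosDefPotential V)
    (m n : Fin d → ℤ) {θ : Vel d × Vel d → ℂ} (hθ : Continuous θ) (hθs : HasCompactSupport θ) :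
    meanFieldAdj β W (planeWave m n θ) = planeWave m n (fun v =>
      Complex.I * (β * Vhat V n : ℝ) *
        ∫ w, θ (v.1, w) * (inner ℝ (waveVec n) w : ℝ) ∂(maxwell d β)) := by
  have := isProbabilityMeasure_maxwell d hβ
  funext z
  have hθi : ∀ j : Fin d, Integrable (fun w => θ (z.1.2, w) * ((w j : ℝ) : ℂ)) (maxwell d β) := by
    intro j
    obtain ⟨C, -, hC⟩ := exists_bound_of_continuous_compactSupport
      (by fun_prop : Continuous fun v : Vel d × Vel d => θ v * ((v.2 j : ℝ) : ℂ)) hθs.mul_right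
    exact Integrable.of_bound (by fun_prop : Continuous _).aestronglyMeasurable C
      (ae_of_all _ fun w => hC (z.1.2, w))
  have e : ∀ p : Phase d, mfKernel β W p z.2 * planeWave m n θ (z.1, p) =
      ∑ j, UnitAddTorus.mFourier (-m) z.1.1 * β *
        ((UnitAddTorus.mFourier (-n) p.1 * ((W (p.1 - z.2.1) j : ℝ) : ℂ)) *
        (θ (z.1.2, p.2) * ((p.2 j : ℝ) : ℂ))) := by
    intro p
    simp only [mfKernel, planeWave, PiLp.inner_apply]
    rw [Finset.mul_sum, Complex.ofReal_sum, Finset.sum_mul]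
    refine Finset.sum_congr rfl fun j _ => ?_
    simp
    ring
  have hi := fun j => integral_mFourier_mul_grad_sub h hV n z.2.1 j
  simp only [meanFieldAdj, e]
  simp only [planeWave]
  rw [phaseMeasure, integral_finsetSum _ fun j _ =>
    (((hi j).1.mul_prod (hθi j)).const_mul (UnitAddTorus.mFourier (-m) z.1.1 * β))]
  have e2 : ∀ w : Vel d, θ (z.1.2, w) * (inner ℝ (waveVec n) w : ℝ) =
      ∑ j, ((waveVec n j : ℝ) : ℂ) * (θ (z.1.2, w) * ((w j : ℝ) : ℂ)) := by
    intro w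
    rw [PiLp.inner_apply, Complex.ofReal_sum, Finset.mul_sum]
    refine Finset.sum_congr rfl fun j _ => ?_
    simp
    ring
  simp only [e2]
  rw [integral_finsetSum _ fun j _ => (hθi j).const_mul _, Finset.mul_sum, Finset.mul_sum]
  refine Finset.sum_congr rfl fun j _ => ?_
  rw [integral_const_mul, integral_const_mul, integral_prod_mul
    (fun x => UnitAddTorus.mFourier (-n) x * ((W (x - z.2.1) j : ℝ) : ℂ))
    (fun w => θ (z.1.2, w) * ((w j : ℝ) : ℂ)), (hi j).2]
  push_cast
  ring

/-! ### The transposed weak equation and uniqueness of the resolvent -/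

/-- The weak equation `F = i L₂ G`, with the mean-field term transposed. -/
lemma isIL2_iff (hβ : 0 < β) (hW : IsW1Infty V W K) {N : ℕ} (hN : 1 ≤ N) (G F : L2Phase2 d β) :
    IsIL2 N W G F ↔ ∀ φ : Phase d × Phase d → ℂ, IsTest φ →
      ∫ z, G z * transport φ z ∂(phaseMeasure2 d β) + ∫ z, F z * φ z ∂(phaseMeasure2 d β) -
        ∫ z, G z * meanFieldAdj β W φ z ∂(phaseMeasure2 d β) = 0 := by
  refine forall₂_congr fun φ hφ => ?_
  have hφ2 := memLp_of_continuous_compactSupport hβ hφ.continuous hφ.compactSupport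
  have hmf := integral_meanField_mul hβ hW hφ.continuous hφ.compactSupport (Lp.memLp G)
  have iF : Integrable (fun z => F z * φ z) (phaseMeasure2 d β) :=
    (Lp.memLp F).integrable_mul hφ2
  have e : ∫ z, (F z - ((((N : ℝ) + 1 - 1) / N : ℝ) : ℂ) * meanField β W G z) * φ z
      ∂(phaseMeasure2 d β) = ∫ z, F z * φ z ∂(phaseMeasure2 d β) -
        ∫ z, G z * meanFieldAdj β W φ z ∂(phaseMeasure2 d β) := by
    rw [← hmf.2, ← integral_sub iF hmf.1, natCast_add_one_sub_one_div hN]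
    refine integral_congr_ae (ae_of_all _ fun z => ?_)
    simp only [Complex.ofReal_one]
    ring
  rw [e]
  constructor <;> intro h' <;> linear_combination h'

lemma IsIL2.sub (hβ : 0 < β) (hW : IsW1Infty V W K) {N : ℕ} (hN : 1 ≤ N)
    {G₁ F₁ G₂ F₂ : L2Phase2 d β} (h₁ : IsIL2 N W G₁ F₁) (h₂ : IsIL2 N W G₂ F₂) :
    IsIL2 N W (G₁ - G₂) (F₁ - F₂) := by
  rw [isIL2_iff hβ hW hN] at *
  intro φ hφ
  have hφ2 := memLp_of_continuous_compactSupport hβ hφ.continuous hφ.compactSupport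
  have hτ2 := memLp_of_continuous_compactSupport hβ hφ.continuous_transport
    hφ.hasCompactSupport_transport
  have hadj := memLp_meanFieldAdj hβ hW hφ.continuous hφ.compactSupport
  have e₁ := h₁ φ hφ
  have e₂ := h₂ φ hφ
  rw [← pairing_apply hτ2, ← pairing_apply hφ2, ← pairing_apply hadj] at *
  rw [map_sub, map_sub, map_sub]
  linear_combination e₁ - e₂

lemma memLp_inner_left (hβ : 0 < β) (k : Vel d) :
    MemLp (fun v : Vel d => ((inner ℝ k v : ℝ) : ℂ)) 2 (maxwell d β) := by
  refine ((memLp_norm_id d hβ).const_mul ‖k‖).mono (by fun_prop) (ae_of_all _ fun v => ?_)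
  rw [Complex.norm_real, norm_mul, norm_norm, norm_norm]
  exact norm_inner_le_norm _ _

/-- The Fourier coefficients of a solution of the homogeneous resolvent equation. -/
lemma coeff2_equation (hβ : 0 < β) (hW : IsW1Infty V W K) (hV : PosDefPotential V) {N : ℕ}
    (hN : 1 ≤ N) {G : L2Phase2 d β} (hG : IsIL2 N W G ((Complex.I * ω) • G)) (m n : Fin d → ℤ) :
    ∀ᵐ v ∂(velMeasure2 d β),
      (ω - (inner ℝ (waveVec m) v.1 : ℝ) - (inner ℝ (waveVec n) v.2 : ℝ)) * coeff2 G m n v =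
      (β * Vhat V n : ℝ) * ((∫ w, coeff2 G m n (v.1, w) ∂(maxwell d β)) *
        (inner ℝ (waveVec n) v.2 : ℝ)) := by
  have := isProbabilityMeasure_maxwell d hβ
  have := isProbabilityMeasure_velMeasure2 d hβ
  have hc := memLp_coeff2 (Lp.memLp G) m n
  set c := coeff2 G m n with hcd
  set ρ : Vel d → ℂ := fun v => ∫ w, c (v, w) ∂(maxwell d β) with hρd
  have hρ : MemLp ρ 2 (maxwell d β) := memLp_integral_prod hc
  have hone : MemLp (fun _ : Vel d => (1 : ℂ)) 2 (maxwell d β) := memLp_const 1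
  have hlin : MemLp (fun v : Vel d × Vel d =>
      ω - (inner ℝ (waveVec m) v.1 : ℝ) - (inner ℝ (waveVec n) v.2 : ℝ)) 2 (velMeasure2 d β) := by
    have h1 := memLp_complex_prod_mul (memLp_inner_left hβ (waveVec m)) hone
    have h2 := memLp_complex_prod_mul hone (memLp_inner_left hβ (waveVec n))
    simp only [mul_one, one_mul] at h1 h2
    exact ((memLp_const ω).sub h1).sub h2
  have hρk : MemLp (fun v : Vel d × Vel d => ρ v.1 * (inner ℝ (waveVec n) v.2 : ℝ)) 2
      (velMeasure2 d β) := memLp_complex_prod_mul hρ (memLp_inner_left hβ (waveVec n))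
  have i1 : Integrable (fun v : Vel d × Vel d =>
      (ω - (inner ℝ (waveVec m) v.1 : ℝ) - (inner ℝ (waveVec n) v.2 : ℝ)) * c v)
      (velMeasure2 d β) := hlin.integrable_mul hc
  have i2 : Integrable (fun v : Vel d × Vel d => ρ v.1 * (inner ℝ (waveVec n) v.2 : ℝ))
      (velMeasure2 d β) := hρk.integrable (by norm_num)
  have i3 : Integrable (fun v : Vel d × Vel d =>
      (ω - (inner ℝ (waveVec m) v.1 : ℝ) - (inner ℝ (waveVec n) v.2 : ℝ)) * c v -
      (β * Vhat V n : ℝ) * (ρ v.1 * (inner ℝ (waveVec n) v.2 : ℝ))) (velMeasure2 d β) :=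
    i1.sub (i2.const_mul _)
  -- It is enough to integrate the difference of both sides against smooth compactly supported ψ;
  -- the corresponding test function on 𝔻² is a plane wave times ψ.
  have hz := ae_eq_zero_of_integral_contDiff_smul_eq_zero i3.locallyIntegrable ?_
  · filter_upwards [hz] with v hv
    exact sub_eq_zero.1 hv
  intro ψ hψ hψs
  set θ : Vel d × Vel d → ℂ := fun v => ((ψ v : ℝ) : ℂ) with hθd
  have hθc : Continuous θ := Complex.continuous_ofReal.comp hψ.continuous
  have hθs : HasCompactSupport θ := hψs.comp_left (g := Complex.ofReal) rfl
  obtain ⟨B, -, hB⟩ := exists_bound_of_continuous_compactSupport hθc hθs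
  have hkc : Continuous fun v : Vel d × Vel d => θ v * (inner ℝ (waveVec n) v.2 : ℝ) := by
    fun_prop
  obtain ⟨B', -, hB'⟩ := exists_bound_of_continuous_compactSupport hkc hθs.mul_right
  have hφ : IsTest (planeWave m n θ) := isTest_planeWave m n hψ hψs
  have heq := (isIL2_iff hβ hW hN _ _).1 hG _ hφ
  set Q : Vel d → ℂ := fun v => ∫ w, θ (v, w) * (inner ℝ (waveVec n) w : ℝ) ∂(maxwell d β) with hQ
  have hθ2 : MemLp θ 2 (velMeasure2 d β) :=
    MemLp.of_bound hθc.aestronglyMeasurable B (ae_of_all _ hB)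
  have hkθ2 : MemLp (fun v : Vel d × Vel d => θ v * (inner ℝ (waveVec n) v.2 : ℝ)) 2
      (velMeasure2 d β) := MemLp.of_bound hkc.aestronglyMeasurable B' (ae_of_all _ hB')
  have hQ2 : MemLp Q 2 (maxwell d β) := memLp_integral_prod hkθ2
  have hQ2' : MemLp (fun v : Vel d × Vel d => Complex.I * (β * Vhat V n : ℝ) * Q v.1) 2
      (velMeasure2 d β) := by
    have h1 := memLp_complex_prod_mul hQ2 hone
    simp only [mul_one] at h1
    exact h1.const_mul _
  have hτ2 : MemLp (fun v : Vel d × Vel d => -(Complex.I * ((inner ℝ (waveVec m) v.1 : ℝ) +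
      (inner ℝ (waveVec n) v.2 : ℝ))) * θ v) 2 (velMeasure2 d β) := by
    have hcτ : Continuous fun v : Vel d × Vel d => -(Complex.I * (((inner ℝ (waveVec m) v.1 : ℝ) : ℂ) +
      (inner ℝ (waveVec n) v.2 : ℝ))) * θ v := by fun_prop
    obtain ⟨B₂, -, hB₂⟩ := exists_bound_of_continuous_compactSupport hcτ hθs.mul_left
    exact MemLp.of_bound hcτ.aestronglyMeasurable B₂ (ae_of_all _ hB₂)
  have eF : ∫ z, ((Complex.I * ω) • G : L2Phase2 d β) z * planeWave m n θ z
      ∂(phaseMeasure2 d β) = Complex.I * ω * ∫ v, c v * θ v ∂(velMeasure2 d β) := by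
    rw [hcd, ← integral_mul_planeWave (Lp.memLp G) m n hθ2, ← integral_const_mul]
    refine integral_congr_ae ?_
    filter_upwards [Lp.coeFn_smul (Complex.I * ω) G] with z hz
    rw [hz, Pi.smul_apply, smul_eq_mul, mul_assoc]
  rw [transport_planeWave, meanFieldAdj_planeWave hβ hW hV m n hθc hθs,
    integral_mul_planeWave (Lp.memLp G) m n hτ2, integral_mul_planeWave (Lp.memLp G) m n hQ2',
    eF, ← hcd] at heq
  have j1 : Integrable (fun v => c v * (Complex.I * (β * Vhat V n : ℝ) * Q v.1))
      (velMeasure2 d β) := hc.integrable_mul hQ2'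
  have j2 : Integrable (fun v : Vel d × Vel d => ρ v.1 * (θ v * (inner ℝ (waveVec n) v.2 : ℝ)))
      (velMeasure2 d β) := by
    have h1 := memLp_complex_prod_mul hρ hone
    simp only [mul_one] at h1
    exact h1.integrable_mul hkθ2
  -- Fubini moves the average over the second velocity from the test function to c.
  have eQ : ∫ v, c v * (Complex.I * (β * Vhat V n : ℝ) * Q v.1) ∂(velMeasure2 d β) =
      Complex.I * (β * Vhat V n : ℝ) *
        ∫ v, ρ v.1 * (θ v * (inner ℝ (waveVec n) v.2 : ℝ)) ∂(velMeasure2 d β) := by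
    rw [velMeasure2, integral_prod _ j1, integral_prod _ j2, ← integral_const_mul]
    refine integral_congr_ae (ae_of_all _ fun v => ?_)
    simp only
    rw [integral_mul_const, integral_const_mul]
    simp only [hρd, hQ]
    ring
  have j3 : Integrable (fun v => c v * (-(Complex.I * ((inner ℝ (waveVec m) v.1 : ℝ) +
      (inner ℝ (waveVec n) v.2 : ℝ))) * θ v)) (velMeasure2 d β) := hc.integrable_mul hτ2
  have j4 : Integrable (fun v => c v * θ v) (velMeasure2 d β) := hc.integrable_mul hθ2
  have j34 : Integrable (fun v => c v * (-(Complex.I * ((inner ℝ (waveVec m) v.1 : ℝ) +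
      (inner ℝ (waveVec n) v.2 : ℝ))) * θ v) + Complex.I * ω * (c v * θ v)) (velMeasure2 d β) :=
    j3.add (j4.const_mul _)
  rw [eQ, ← integral_const_mul, ← integral_const_mul, ← integral_add j3 (j4.const_mul _),
    ← integral_sub j34 (j2.const_mul _)] at heq
  have hfin : ∫ v, Complex.I * (ψ v • ((ω - (inner ℝ (waveVec m) v.1 : ℝ) -
      (inner ℝ (waveVec n) v.2 : ℝ)) * c v -
      (β * Vhat V n : ℝ) * (ρ v.1 * (inner ℝ (waveVec n) v.2 : ℝ)))) ∂(velMeasure2 d β) = 0 := by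
    rw [← heq]
    refine integral_congr_ae (ae_of_all _ fun v => ?_)
    simp only [Complex.real_smul, hθd]
    ring
  rw [integral_const_mul] at hfin
  exact (mul_eq_zero.1 hfin).resolve_left Complex.I_ne_zero

/-- Divided by the nonvanishing factor ω - k_m·v₀ - k_n·v₁ and averaged over v₁, the coefficient
equation becomes ρ(1 + βV̂ Z(ξ/|k_n|)) = 0 with ξ = ω - k_m·v₀ in the upper half-plane. Hence ρ = 0,
and then the coefficient itself is zero. -/
lemma ae_coeff2_eq_zero (hβ : 0 < β) (hW : IsW1Infty V W K) (hV : PosDefPotential V) {N : ℕ}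
    (hN : 1 ≤ N) (hω : 0 < ω.im) {G : L2Phase2 d β} (hG : IsIL2 N W G ((Complex.I * ω) • G))
    (m n : Fin d → ℤ) : coeff2 G m n =ᵐ[velMeasure2 d β] 0 := by
  have := isProbabilityMeasure_maxwell d hβ
  have heq := coeff2_equation hβ hW hV hN hG m n
  have hξ : ∀ v : Vel d, 0 < (ω - (inner ℝ (waveVec m) v : ℝ)).im := fun v => by
    rwa [im_sub_ofReal]
  have hne : ∀ v : Vel d × Vel d,
      ω - (inner ℝ (waveVec m) v.1 : ℝ) - (inner ℝ (waveVec n) v.2 : ℝ) ≠ 0 := by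
    intro v
    have := add_ofReal_ne_zero (hξ v.1) (-(inner ℝ (waveVec n) v.2))
    rwa [Complex.ofReal_neg, ← sub_eq_add_neg] at this
  -- The first alternative is k_n = 0, where the right-hand side of the equation vanishes whatever
  -- the average is.
  have hρ : ∀ᵐ v ∂(maxwell d β), inner ℝ (waveVec n) =
      (fun _ : Vel d => (0 : ℝ)) ∨ ∫ w, coeff2 G m n (v, w) ∂(maxwell d β) = 0 := by
    by_cases hn : waveVec n = 0
    · exact ae_of_all _ fun v => Or.inl (by ext; simp [hn])
    have hn' : waveVec (-n) ≠ 0 := by simpa using hn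
    filter_upwards [Measure.ae_ae_of_ae_prod heq] with v hv
    right
    set ρ := ∫ w, coeff2 G m n (v, w) ∂(maxwell d β) with hρ
    set ξ := ω - (inner ℝ (waveVec m) v : ℝ) with hξd
    have e1 : ρ = ∫ w, -((β * Vhat V n : ℝ) * ρ) * (((inner ℝ (waveVec (-n)) w : ℝ) : ℂ) *
        (ξ + (inner ℝ (waveVec (-n)) w : ℝ))⁻¹) ∂(maxwell d β) := by
      rw [hρ]
      refine integral_congr_ae ?_
      filter_upwards [hv] with w hw
      have h0 : ξ - (inner ℝ (waveVec n) w : ℝ) ≠ 0 := hne (v, w)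
      rw [waveVec_neg, inner_neg_left, Complex.ofReal_neg, ← sub_eq_add_neg, ← hρ]
      field_simp
      linear_combination hw
    rw [integral_const_mul, integral_inner_mul_inv_add_inner hβ (hξ v) hn'] at e1
    -- The frequency is ξ and the velocity 0, so that the argument of Z is exactly ξ/|k|.
    have hε := dispersion_ne_zero hβ hW hV (hξ v).le (-n) 0
    simp only [dispersion, plasmaArg, inner_zero_right, Complex.ofReal_zero, sub_zero, ← hξd,
      Vhat_neg] at hε
    have e2 : ρ * (1 + ((β * Vhat V n : ℝ) : ℂ) * plasmaZ β (ξ / ‖waveVec (-n)‖)) = 0 := by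
      linear_combination e1
    exact (mul_eq_zero.1 e2).resolve_right hε
  have hρ2 : ∀ᵐ v ∂(velMeasure2 d β), inner ℝ (waveVec n) =
      (fun _ : Vel d => (0 : ℝ)) ∨ ∫ w, coeff2 G m n (v.1, w) ∂(maxwell d β) = 0 :=
    (Measure.quasiMeasurePreserving_fst (μ := maxwell d β) (ν := maxwell d β)).ae hρ
  filter_upwards [heq, hρ2] with v h1 h2
  have h3 : (ω - (inner ℝ (waveVec m) v.1 : ℝ) - (inner ℝ (waveVec n) v.2 : ℝ)) *
      coeff2 G m n v = 0 := by
    rw [h1]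
    rcases h2 with h2 | h2 <;> simp [h2]
  exact (mul_eq_zero.1 h3).resolve_left (hne v)

/-- Uniqueness of the resolvent. -/
lemma SolvesResolvent.unique (hβ : 0 < β) (hW : IsW1Infty V W K) (hV : PosDefPotential V) {N : ℕ}
    (hN : 1 ≤ N) (hω : 0 < ω.im) {S : Phase d × Phase d → ℂ} {H₁ H₂ : L2Phase2 d β}
    (h₁ : SolvesResolvent N W ω S H₁) (h₂ : SolvesResolvent N W ω S H₂) : H₁ = H₂ := by
  obtain ⟨F₁, hF₁, hS₁⟩ := h₁
  obtain ⟨F₂, hF₂, hS₂⟩ := h₂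
  have e : F₁ - (Complex.I * ω) • H₁ = F₂ - (Complex.I * ω) • H₂ :=
    Lp.ext (hS₁.trans hS₂.symm)
  have e2 : F₁ - F₂ = (Complex.I * ω) • (H₁ - H₂) := by
    rw [smul_sub]
    rw [sub_eq_sub_iff_add_eq_add] at e ⊢
    rw [e, add_comm]
  have h := hF₁.sub hβ hW hN hF₂
  rw [e2] at h
  have h0 := ae_eq_zero_of_coeff2 (Lp.memLp (H₁ - H₂))
    (ae_coeff2_eq_zero hβ hW hV hN hω h)
  exact sub_eq_zero.1 ((Lp.eq_zero_iff_ae_eq_zero).2 h0)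

end

end LenardBalescu
end

noncomputable section

namespace LenardBalescu

/-! ### The flux -/

/-- The contribution of the mode `n` to the flux. -/
def fluxTerm {d : ℕ} (β : ℝ) (V : Torus d → ℝ) (a : Vel d → CVec d) (b : Vel d → ℂ) (ω : ℂ)
    (v : Vel d) (n : Fin d → ℤ) : CVec d :=
  (-(Complex.I * (Vhat V n : ℝ)) * (density β V a b ω n v - b v)) • toC (waveVec n)

/-- The vector field whose image under `(∇_v - βv)·` is the average of `M₂¹ (iL₂ - iω)⁻¹ S₁² g`. -/
def flux {d : ℕ} (β : ℝ) (V : Torus d → ℝ) (a : Vel d → CVec d) (b : Vel d → ℂ) (ω : ℂ)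
    (v : Vel d) : CVec d :=
  ∑' n, fluxTerm β V a b ω v n

lemma toC_zero {d : ℕ} : toC (0 : Vel d) = 0 := by
  ext i; simp [toC]

section Flux

variable {d : ℕ} {β : ℝ} {V : Torus d → ℝ} {W : Torus d → Vel d} {K : ℝ≥0}
  {a : Vel d → CVec d} {b : Vel d → ℂ} {ω : ℂ}

/-- The bound of the terms of the flux, uniform in the frequency. -/
lemma exists_norm_fluxTerm_le (d : ℕ) (hβ : 0 < β) (K : ℝ≥0) :
    ∃ C : ℝ, 0 ≤ C ∧ ∀ (V : Torus d → ℝ) (W : Torus d → Vel d), IsW1Infty V W K →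
      PosDefPotential V → ∀ (a : Vel d → CVec d) (b : Vel d → ℂ) (ω : ℂ), 0 ≤ ω.im →
      ∀ v n, ‖fluxTerm β V a b ω v n‖ ≤
        ‖waveVec n‖ ^ 2 * Vhat V n ^ 2 * (C * (‖a v‖ + ‖b v‖)) := by
  obtain ⟨δ, hδ, hd⟩ := exists_le_norm_dispersion d hβ K
  have hg0 := gaussMoment_nonneg β 0
  have hg1 := gaussMoment_nonneg β 1
  refine ⟨(gaussMoment β 0 + gaussMoment β 1) / δ, by positivity, fun V W h hV a b ω hω v n => ?_⟩
  by_cases hn : waveVec n = 0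
  · simp [fluxTerm, hn, toC_zero]
  have hk := one_le_norm_waveVec hn
  have hV0 : 0 ≤ Vhat V n := (hV n).1
  have hD := hd V W h hV ω hω n v
  have hε := dispersion_ne_zero hβ h hV hω n v
  -- Subtracting b cancels the part of the density without a factor V̂(k). The flux term is
  -- therefore quadratic in V̂(k), which is what makes the series converge.
  have h1 : density β V a b ω n v - b v = (Vhat V n : ℝ) *
      (Complex.I * (cdot (waveVec n) (a v) / ‖waveVec n‖) *
        gaussLaplace β (plasmaArg ω (waveVec n) v) -
      β * plasmaZ β (plasmaArg ω (waveVec n) v) * b v) / dispersion β V ω n v := by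
    rw [density, div_sub' hε]
    congr 1
    rw [dispersion]
    push_cast
    ring
  have h2 : ‖cdot (waveVec n) (a v) / ‖waveVec n‖‖ ≤ ‖a v‖ := by
    rw [norm_div, Complex.norm_real, norm_norm]
    exact div_le_of_le_mul₀ (norm_nonneg _) (norm_nonneg _)
      ((norm_cdot_le _ _).trans_eq (mul_comm _ _))
  have hF := norm_gaussLaplace_le hβ (im_plasmaArg_nonneg hω (waveVec n) v)
  have hZ := norm_plasmaZ_le hβ (im_plasmaArg_nonneg hω (waveVec n) v)
  have h3 : ‖density β V a b ω n v - b v‖ ≤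
      Vhat V n * ((gaussMoment β 0 + gaussMoment β 1) * (‖a v‖ + ‖b v‖)) / δ := by
    rw [h1, norm_div, norm_mul, Complex.norm_real, Real.norm_of_nonneg hV0]
    refine div_le_div₀ (by positivity) (mul_le_mul_of_nonneg_left ?_ hV0) hδ hD
    refine (norm_sub_le _ _).trans ?_
    rw [norm_mul, norm_mul, norm_mul, norm_mul, Complex.norm_I, one_mul, Complex.norm_real,
      Real.norm_of_nonneg hβ.le]
    calc _ ≤ ‖a v‖ * gaussMoment β 0 + β * (β⁻¹ * gaussMoment β 1) * ‖b v‖ := by gcongr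
      _ = ‖a v‖ * gaussMoment β 0 + gaussMoment β 1 * ‖b v‖ := by
        rw [mul_inv_cancel_left₀ hβ.ne']
      _ ≤ _ := by
        have := mul_nonneg hg1 (norm_nonneg (a v))
        have := mul_nonneg hg0 (norm_nonneg (b v))
        linarith
  rw [fluxTerm, norm_smul, norm_mul, norm_neg, norm_mul, Complex.norm_I, one_mul,
    Complex.norm_real, Real.norm_of_nonneg hV0, norm_toC]
  -- One factor |k| comes from the vector k, and |k| ≤ |k|² because |k| ≥ 1.
  calc _ ≤ Vhat V n * (Vhat V n * ((gaussMoment β 0 + gaussMoment β 1) * (‖a v‖ + ‖b v‖)) / δ) *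
        ‖waveVec n‖ ^ 2 := by
        gcongr
        nlinarith
    _ = _ := by ring

lemma summable_fluxTerm (hβ : 0 < β) (hW : IsW1Infty V W K) (hV : PosDefPotential V)
    (hω : 0 ≤ ω.im) (v : Vel d) : Summable (fluxTerm β V a b ω v) := by
  obtain ⟨C, -, hC⟩ := exists_norm_fluxTerm_le d hβ K
  exact ((summable_sq_waveVec_mul_Vhat hW hV).1.mul_right _).of_norm_bounded
    fun n => hC V W hW hV a b ω hω v n

/-- The bound of the flux, uniform in the frequency. -/
lemma exists_norm_flux_le (d : ℕ) (hβ : 0 < β) (K : ℝ≥0) :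
    ∃ C : ℝ, 0 ≤ C ∧ ∀ (V : Torus d → ℝ) (W : Torus d → Vel d), IsW1Infty V W K →
      PosDefPotential V → ∀ (a : Vel d → CVec d) (b : Vel d → ℂ) (ω : ℂ), 0 ≤ ω.im →
      ∀ v, ‖flux β V a b ω v‖ ≤ C * (‖a v‖ + ‖b v‖) := by
  obtain ⟨C, hC0, hC⟩ := exists_norm_fluxTerm_le d hβ K
  refine ⟨K ^ 2 * C, by positivity, fun V W hW hV a b ω hω v => ?_⟩
  obtain ⟨hs, hle⟩ := summable_sq_waveVec_mul_Vhat hW hV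
  calc ‖flux β V a b ω v‖ ≤ ∑' n, ‖waveVec n‖ ^ 2 * Vhat V n ^ 2 * (C * (‖a v‖ + ‖b v‖)) :=
        tsum_of_norm_bounded (hs.mul_right _).hasSum fun n => hC V W hW hV a b ω hω v n
    _ = (∑' n, ‖waveVec n‖ ^ 2 * Vhat V n ^ 2) * (C * (‖a v‖ + ‖b v‖)) := tsum_mul_right
    _ ≤ K ^ 2 * (C * (‖a v‖ + ‖b v‖)) := by gcongr
    _ = _ := by ring

lemma aestronglyMeasurable_fluxTerm (hβ : 0 < β) (hω : 0 ≤ ω.im)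
    (ha : AEStronglyMeasurable a (maxwell d β)) (hb : AEStronglyMeasurable b (maxwell d β))
    (n : Fin d → ℤ) :
    AEStronglyMeasurable (fun v => fluxTerm β V a b ω v n) (maxwell d β) :=
  (((aestronglyMeasurable_density hβ hω n ha hb).sub hb).const_mul _).smul_const _

lemma aestronglyMeasurable_flux (hβ : 0 < β) (hW : IsW1Infty V W K) (hV : PosDefPotential V)
    (hω : 0 ≤ ω.im) (ha : AEStronglyMeasurable a (maxwell d β))
    (hb : AEStronglyMeasurable b (maxwell d β)) :
    AEStronglyMeasurable (flux β V a b ω) (maxwell d β) := by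
  refine aestronglyMeasurable_of_tendsto_ae (u := atTop)
    (f := fun (s : Finset (Fin d → ℤ)) v => ∑ n ∈ s, fluxTerm β V a b ω v n) (fun s => ?_)
    (ae_of_all _ fun v => (summable_fluxTerm hβ hW hV hω v).hasSum)
  exact s.aestronglyMeasurable_fun_sum fun n _ => aestronglyMeasurable_fluxTerm hβ hω ha hb n

lemma memLp_flux (hβ : 0 < β) (hW : IsW1Infty V W K) (hV : PosDefPotential V)
    (hω : 0 ≤ ω.im) (ha : MemLp a 2 (maxwell d β)) (hb : MemLp b 2 (maxwell d β)) :
    MemLp (flux β V a b ω) 2 (maxwell d β) := by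
  obtain ⟨C, -, hC⟩ := exists_norm_flux_le d hβ K
  exact ((memLp_norm_add_norm ha hb).const_mul C).mono
    (aestronglyMeasurable_flux hβ hW hV hω ha.1 hb.1)
    (ae_of_all _ fun v => (hC V W hW hV a b ω hω v).trans (le_abs_self _))

lemma hasSum_integral_inner_fluxTerm (hβ : 0 < β) (hW : IsW1Infty V W K)
    (hV : PosDefPotential V) (hω : 0 ≤ ω.im) (ha : MemLp a 2 (maxwell d β))
    (hb : MemLp b 2 (maxwell d β)) {q : Vel d → CVec d} (hq : MemLp q 2 (maxwell d β)) :
    HasSum (fun n => ∫ v, inner ℂ (q v) (fluxTerm β V a b ω v n) ∂(maxwell d β))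
      (∫ v, inner ℂ (q v) (flux β V a b ω v) ∂(maxwell d β)) := by
  obtain ⟨C, -, hC⟩ := exists_norm_fluxTerm_le d hβ K
  have hb' : ∀ n v, ‖inner ℂ (q v) (fluxTerm β V a b ω v n)‖ ≤
      ‖waveVec n‖ ^ 2 * Vhat V n ^ 2 * (‖q v‖ * (C * (‖a v‖ + ‖b v‖))) := fun n v =>
    calc _ ≤ ‖q v‖ * (‖waveVec n‖ ^ 2 * Vhat V n ^ 2 * (C * (‖a v‖ + ‖b v‖))) :=
          (norm_inner_le_norm _ _).trans
            (mul_le_mul_of_nonneg_left (hC V W hW hV a b ω hω v n) (norm_nonneg _))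
      _ = _ := by ring
  have hi : Integrable (fun v => ‖q v‖ * (C * (‖a v‖ + ‖b v‖))) (maxwell d β) :=
    hq.norm.integrable_mul ((memLp_norm_add_norm ha hb).const_mul C)
  have hint : ∀ n, Integrable (fun v => inner ℂ (q v) (fluxTerm β V a b ω v n)) (maxwell d β) :=
    fun n => (hi.const_mul _).mono' (hq.1.inner (aestronglyMeasurable_fluxTerm hβ hω ha.1 hb.1 n))
      (ae_of_all _ (hb' n))
  have h := hasSum_integral_of_summable_integral_norm hint ?_
  · have e : ∀ v, inner ℂ (q v) (flux β V a b ω v) =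
        ∑' n, inner ℂ (q v) (fluxTerm β V a b ω v n) := fun v =>
      ((innerSL ℂ (q v)).hasSum (summable_fluxTerm hβ hW hV hω v).hasSum).tsum_eq.symm
    simpa only [e] using h
  · refine Summable.of_nonneg_of_le (fun n => integral_nonneg fun v => norm_nonneg _) (fun n => ?_)
      ((summable_sq_waveVec_mul_Vhat hW hV).1.mul_right
        (∫ v, ‖q v‖ * (C * (‖a v‖ + ‖b v‖)) ∂(maxwell d β)))
    rw [← integral_const_mul]
    exact integral_mono (hint n).norm (hi.const_mul _) (hb' n)

end Flux

/-! ### The average of M₂¹ applied to the resolvent, by duality -/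

section Pairing

variable {d : ℕ} {β : ℝ} {hβ : 0 < β} {V : Torus d → ℝ} {W : Torus d → Vel d} {K : ℝ≥0}
  {ω : ℂ}

/-- The velocity factor of the transposed operator `M₂¹`. -/
def gradFactor (φ : H1 d hβ) (j : Fin d) (v : Vel d × Vel d) : ℂ :=
  starRingEnd ℂ (grad φ v.1 j)

lemma memLp_gradFactor (φ : H1 d hβ) (j : Fin d) :
    MemLp (gradFactor φ j) 2 (velMeasure2 d β) := by
  have := isProbabilityMeasure_maxwell d hβ
  have h1 := memLp_complex_prod_mul (memLp_coord (memLp_grad φ) j).star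
    (memLp_const (1 : ℂ) (p := 2) (μ := maxwell d β))
  simp only [mul_one] at h1
  exact h1

lemma inner_grad_smul_eq_sum (φ : H1 d hβ) (c : ℂ) (z : Phase d × Phase d) :
    inner ℂ (grad φ z.1.2) (c • toC (W (z.1.1 - z.2.1))) =
      ∑ j, c * rel (fun x => ((W x j : ℝ) : ℂ)) (gradFactor φ j) z := by
  rw [PiLp.inner_apply]
  refine Finset.sum_congr rfl fun j _ => ?_
  simp [rel, gradFactor, toC]
  ring

/-- Integrating the mode k against ∂_jV(x₀ - x₁) selects the Fourier coefficient of ∂_jV at -k. -/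
lemma integral_mode_mul_rel (hW : IsW1Infty V W K) (hV : PosDefPotential V)
    (n : Fin d → ℤ) {ψ χ : Vel d × Vel d → ℂ} (hψ : MemLp ψ 2 (velMeasure2 d β))
    (hχ : MemLp χ 2 (velMeasure2 d β)) (j : Fin d) :
    ∫ z, mode n ψ z * rel (fun x => ((W x j : ℝ) : ℂ)) χ z ∂(phaseMeasure2 d β) =
      -(Complex.I * (waveVec n j : ℝ) * (Vhat V n : ℝ)) *
        ∫ v, ψ v * χ v ∂(velMeasure2 d β) := by
  have e : ∀ z, mode n ψ z * rel (fun x => ((W x j : ℝ) : ℂ)) χ z =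
      rel (fun x => UnitAddTorus.mFourier (-(-n)) x * ((W x j : ℝ) : ℂ)) (fun v => ψ v * χ v) z := by
    intro z
    simp only [mode, rel, neg_neg]
    ring
  simp only [e]
  have hm : AEStronglyMeasurable (fun x => UnitAddTorus.mFourier (-(-n)) x * ((W x j : ℝ) : ℂ))
      (torusMeasure d) := (UnitAddTorus.mFourier (-(-n))).continuous.aestronglyMeasurable.mul
    (memLp_top_grad_coord hW j).1
  have hm' : AEStronglyMeasurable (fun v => ψ v * χ v) (velMeasure2 d β) := hψ.1.mul hχ.1
  rw [integral_rel hm hm', ← mFourierCoeff_eq_integral_torusMeasure,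
    mFourierCoeff_grad hW hV, waveVec_neg, Vhat_neg]
  simp

lemma natCast_sub_zero_div {N : ℕ} (hN : 1 ≤ N) : ((N : ℝ) - 0) / N = 1 := by
  have : (N : ℝ) ≠ 0 := by positivity
  rw [sub_zero, div_self this]

/-- The space average of `M₂¹ (iL₂ - iω)⁻¹ S₁² g` is `(∇_v - βv) · flux`. -/
lemma avgM21Pairing_resolventSol (g : H1 d hβ) (hW : IsW1Infty V W K) (hV : PosDefPotential V)
    (hω : 0 < ω.im) {N : ℕ} (hN : 1 ≤ N) (φ : H1 d hβ) :
    avgM21Pairing N W (resolventSol g hW hV hω) φ =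
      divPairing (flux β V (gradStar g) (val g) ω) φ := by
  set H := resolventSol g hW hV hω
  set Φ : Phase d × Phase d → ℂ := fun z =>
    ∑ j, rel (fun x => ((W x j : ℝ) : ℂ)) (gradFactor φ j) z with hΦd
  have hΦj : ∀ j, MemLp (rel (fun x => ((W x j : ℝ) : ℂ)) (gradFactor φ j)) 2
      (phaseMeasure2 d β) := fun j => memLp_rel (memLp_two_grad_coord hW j) (memLp_gradFactor φ j)
  have hΦ : MemLp Φ 2 (phaseMeasure2 d β) := memLp_finsetSum _ fun j _ => hΦj j
  have hψ := fun n => memLp_resolventMode hβ hW hV hω (memLp_gradStar g) (memLp_val g) n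
  have s1 := hasSum_integral_mode_mul hψ (hasSum_resolventSol g hW hV hω) hΦ
  have s2 := hasSum_integral_inner_fluxTerm hβ hW hV hω.le (memLp_gradStar g) (memLp_val g)
    (memLp_grad φ)
  rw [avgM21Pairing, natCast_sub_zero_div hN, Complex.ofReal_one, one_mul, divPairing]
  have e0 : ∫ z, inner ℂ (grad φ z.1.2) (H z • toC (W (z.1.1 - z.2.1))) ∂(phaseMeasure2 d β) =
      ∫ z, H z * Φ z ∂(phaseMeasure2 d β) := by
    simp only [inner_grad_smul_eq_sum, hΦd, Finset.mul_sum]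
  rw [e0]
  congr 1
  refine (s1.congr_fun fun n => ?_).unique s2
  set ψ := resolventMode β V (gradStar g) (val g) ω n
  have e1 : ∫ z, mode n ψ z * Φ z ∂(phaseMeasure2 d β) =
      ∑ j, -(Complex.I * (waveVec n j : ℝ) * (Vhat V n : ℝ)) *
        ∫ v, ψ v * gradFactor φ j v ∂(velMeasure2 d β) := by
    have hi : ∀ j, Integrable (fun z => mode n ψ z * rel (fun x => ((W x j : ℝ) : ℂ))
        (gradFactor φ j) z) (phaseMeasure2 d β) := fun j =>
      (memLp_mode n (hψ n)).integrable_mul (hΦj j)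
    simp only [hΦd, Finset.mul_sum]
    rw [integral_finsetSum _ fun j _ => hi j]
    exact Finset.sum_congr rfl fun j _ =>
      integral_mode_mul_rel hW hV n (hψ n) (memLp_gradFactor φ j) j
  by_cases hn : waveVec n = 0
  · simp [e1, hn, fluxTerm, toC_zero]
  -- The test factor does not involve the second velocity, so only the density of the mode enters.
  have e2 : ∀ j, ∫ v, ψ v * gradFactor φ j v ∂(velMeasure2 d β) =
      ∫ v, (density β V (gradStar g) (val g) ω n v - val g v) * starRingEnd ℂ (grad φ v j)
        ∂(maxwell d β) := by
    intro j
    have hi : Integrable (fun v => ψ v * gradFactor φ j v)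
      ((maxwell d β).prod (maxwell d β)) := (hψ n).integrable_mul (memLp_gradFactor φ j)
    rw [velMeasure2, integral_prod _ hi]
    refine integral_congr_ae (ae_of_all _ fun v => ?_)
    simp only [gradFactor]
    rw [integral_mul_const, integral_resolventMode hβ hW hV hω hn]
  have hρ : MemLp (fun v => density β V (gradStar g) (val g) ω n v - val g v) 2
      (maxwell d β) := by
    have := isProbabilityMeasure_maxwell d hβ
    refine (memLp_integral_prod (hψ n)).ae_eq (ae_of_all _ fun v => ?_)
    exact integral_resolventMode hβ hW hV hω hn v
  have hi : ∀ j, Integrable (fun v => (density β V (gradStar g) (val g) ω n v - val g v) *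
      starRingEnd ℂ (grad φ v j)) (maxwell d β) := fun j =>
    hρ.integrable_mul (memLp_coord (memLp_grad φ) j).star
  rw [e1]
  have e3 : ∀ v, inner ℂ (grad φ v) (fluxTerm β V (gradStar g) (val g) ω v n) =
      ∑ j, -(Complex.I * (waveVec n j : ℝ) * (Vhat V n : ℝ)) *
        ((density β V (gradStar g) (val g) ω n v - val g v) * starRingEnd ℂ (grad φ v j)) := by
    intro v
    rw [PiLp.inner_apply]
    refine Finset.sum_congr rfl fun j _ => ?_
    simp [fluxTerm, toC]
    ring
  simp only [e3]
  rw [integral_finsetSum _ fun j _ => (hi j).const_mul _]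
  refine Finset.sum_congr rfl fun j _ => ?_
  rw [e2, integral_const_mul]

end Pairing

end LenardBalescu
end

noncomputable section

namespace LenardBalescu

/-! ### The limit of the flux -/

section Limit

variable {d : ℕ} {β : ℝ} {V : Torus d → ℝ} {W : Torus d → Vel d} {K : ℝ≥0}
  {a : Vel d → CVec d} {b : Vel d → ℂ}

/-- F and Z are continuous up to the real axis and the dispersion function has no zero there. So the
term is continuous on the closed half-plane, and ω may approach 0 in any manner from above. -/
lemma tendsto_fluxTerm (hβ : 0 < β) (hW : IsW1Infty V W K) (hV : PosDefPotential V) (v : Vel d)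
    (n : Fin d → ℤ) :
    Tendsto (fun ω => fluxTerm β V a b ω v n) (𝓝[{ω : ℂ | 0 < ω.im}] 0)
      (𝓝 (fluxTerm β V a b 0 v n)) := by
  have hmaps : Set.MapsTo (fun ω => plasmaArg ω (waveVec n) v) {ω : ℂ | 0 ≤ ω.im}
      {z : ℂ | 0 ≤ z.im} := fun ω hω => im_plasmaArg_nonneg hω _ _
  have hc : ContinuousOn (fun ω => plasmaArg ω (waveVec n) v) {ω : ℂ | 0 ≤ ω.im} := by
    unfold plasmaArg
    fun_prop
  have h1 := (continuousOn_gaussLaplace hβ).comp hc hmaps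
  have h2 := (continuousOn_plasmaZ hβ).comp hc hmaps
  have h3 : ContinuousOn (fun ω => dispersion β V ω n v) {ω : ℂ | 0 ≤ ω.im} :=
    continuousOn_const.add (continuousOn_const.mul h2)
  have h4 : ContinuousOn (fun ω => fluxTerm β V a b ω v n) {ω : ℂ | 0 ≤ ω.im} :=
    (continuousOn_const.mul (((continuousOn_const.add (continuousOn_const.mul
      (h1.div_const _))).div h3 fun ω hω => dispersion_ne_zero hβ hW hV hω n v).sub
        continuousOn_const)).smul continuousOn_const
  exact ((h4 0 (by simp)).mono fun ω (hω : 0 < ω.im) => show 0 ≤ ω.im from hω.le)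

/-- Dominated convergence for the series: the majorant |k|² V̂(k)² (C (|a| + |b|)) is free of ω. -/
lemma tendsto_flux (hβ : 0 < β) (hW : IsW1Infty V W K) (hV : PosDefPotential V) (v : Vel d) :
    Tendsto (fun ω => flux β V a b ω v) (𝓝[{ω : ℂ | 0 < ω.im}] 0) (𝓝 (flux β V a b 0 v)) := by
  obtain ⟨C, -, hC⟩ := exists_norm_fluxTerm_le d hβ K
  refine tendsto_tsum_of_dominated_convergence
    ((summable_sq_waveVec_mul_Vhat hW hV).1.mul_right (C * (‖a v‖ + ‖b v‖)))
    (fun n => tendsto_fluxTerm hβ hW hV v n) ?_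
  filter_upwards [self_mem_nhdsWithin] with ω hω n
  exact hC V W hW hV a b ω (le_of_lt hω) v n

lemma tendsto_integral_sq_flux_sub (hβ : 0 < β) (hW : IsW1Infty V W K) (hV : PosDefPotential V)
    (ha : MemLp a 2 (maxwell d β)) (hb : MemLp b 2 (maxwell d β)) :
    Tendsto (fun ω => ∫ v, ‖flux β V a b ω v - flux β V a b 0 v‖ ^ 2 ∂(maxwell d β))
      (𝓝[{ω : ℂ | 0 < ω.im}] 0) (𝓝 0) := by
  obtain ⟨C, hC0, hC⟩ := exists_norm_flux_le d hβ K
  suffices h : Tendsto (fun ω => ∫ v, ‖flux β V a b ω v - flux β V a b 0 v‖ ^ 2 ∂(maxwell d β))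
      (𝓝[{ω : ℂ | 0 < ω.im}] 0) (𝓝 (∫ _ : Vel d, (0 : ℝ) ∂(maxwell d β))) by
    simpa using h
  refine tendsto_integral_filter_of_dominated_convergence
    (fun v => (2 * C * (‖a v‖ + ‖b v‖)) ^ 2) ?_ ?_
    ((memLp_norm_add_norm ha hb).const_mul (2 * C)).integrable_sq (ae_of_all _ fun v => ?_)
  · filter_upwards [self_mem_nhdsWithin] with ω hω
    exact ((memLp_flux hβ hW hV (le_of_lt hω) ha hb).1.sub
      (memLp_flux hβ hW hV (by simp) ha hb).1).norm.pow 2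
  · filter_upwards [self_mem_nhdsWithin] with ω hω
    refine ae_of_all _ fun v => ?_
    rw [norm_pow, norm_norm]
    have h1 := hC V W hW hV a b ω (le_of_lt hω) v
    have h2 := hC V W hW hV a b 0 (by simp) v
    have h3 := norm_sub_le (flux β V a b ω v) (flux β V a b 0 v)
    exact pow_le_pow_left₀ (norm_nonneg _) (by linarith) 2
  · have h1 := ((tendsto_flux (a := a) (b := b) hβ hW hV v).sub_const
      (flux β V a b 0 v)).norm.pow 2
    simpa using h1

/-! ### Symmetrization of the flux at zero frequency, and the limiting kernel -/

lemma plasmaArg_zero (k v : Vel d) :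
    plasmaArg 0 k v = -(((inner ℝ k v / ‖k‖ : ℝ)) : ℂ) := by
  simp [plasmaArg, neg_div]

lemma kernelCoef_eq (hβ : 0 < β) {N : ℕ} (hN : 1 ≤ N) (v : Vel d) {n : Fin d → ℤ}
    (hn : waveVec n ≠ 0) :
    kernelCoef β V N v n = Vhat V n ^ 2 *
      ((gaussLaplace β ((inner ℝ (waveVec n) v / ‖waveVec n‖ : ℝ) : ℂ)).re / ‖waveVec n‖) /
      ‖1 + ((β * Vhat V n : ℝ) : ℂ) *
        plasmaZ β ((inner ℝ (waveVec n) v / ‖waveVec n‖ : ℝ) : ℂ)‖ ^ 2 := by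
  rw [kernelCoef, epsPlus_eq hβ V hN hn, ← pi_mul_deltaAvg hβ hn]
  ring

/-- Algebraic identity behind the symmetrization of the flux. -/
lemma add_conj_div_eq {F Z E : ℂ} {c x : ℝ} (hZ : Z = 1 + Complex.I * x * F)
    (hE : E = 1 + c * Z) (hE0 : E ≠ 0) (s y : ℂ) :
    (s * starRingEnd ℂ F + Complex.I * y * starRingEnd ℂ Z) / starRingEnd ℂ E +
      (s * F - Complex.I * y * Z) / E =
      2 * ((F.re / ‖E‖ ^ 2 : ℝ) : ℂ) * ((1 + c) * s + x * y) := by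
  have hE1 : starRingEnd ℂ E ≠ 0 := (map_ne_zero _).2 hE0
  have hn : ((‖E‖ ^ 2 : ℝ) : ℂ) = starRingEnd ℂ E * E := by
    rw [← Complex.normSq_eq_norm_sq, Complex.normSq_eq_conj_mul_self]
  have hF : 2 * ((F.re : ℝ) : ℂ) = F + starRingEnd ℂ F := by
    rw [Complex.add_conj]; push_cast; ring
  rw [Complex.ofReal_div, hn]
  -- With E = 1 + c + icxF, the |F|² terms cancel in conj(F) E + F conj(E), leaving 2(1 + c) Re F.
  -- The |Z|² terms cancel in conj(Z) E - Z conj(E) = conj(Z) - Z, which is -2ix Re F.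
  have e : (s * starRingEnd ℂ F + Complex.I * y * starRingEnd ℂ Z) * E +
      (s * F - Complex.I * y * Z) * starRingEnd ℂ E =
      2 * ((F.re : ℝ) : ℂ) * ((1 + c) * s + x * y) := by
    rw [hF, hE, hZ]
    simp only [map_add, map_mul, map_one, Complex.conj_ofReal, Complex.conj_I]
    linear_combination (-(x : ℂ) * y * (F + starRingEnd ℂ F)) * Complex.I_sq
  rw [div_add_div _ _ hE1 hE0, mul_comm (starRingEnd ℂ E) (s * F - _), e]
  ring

/-- The symmetrized flux at zero frequency. -/
lemma fluxTerm_add_neg (hβ : 0 < β) (hW : IsW1Infty V W K) (hV : PosDefPotential V) {N : ℕ}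
    (hN : 1 ≤ N) (v : Vel d) (n : Fin d → ℤ) :
    fluxTerm β V a b 0 v n + fluxTerm β V a b 0 v (-n) =
      (2 : ℂ) • (((kernelCoef β V N v n : ℝ) : ℂ) * (cdot (waveVec n) (a v + (β * b v) • toC v) +
        ((β * Vhat V n : ℝ) : ℂ) * cdot (waveVec n) (a v))) • toC (waveVec n) := by
  by_cases hn : waveVec n = 0
  · simp [fluxTerm, hn, toC_zero]
  set k := waveVec n with hk
  have hkn : (‖k‖ : ℂ) ≠ 0 := by exact_mod_cast (norm_pos_iff.2 hn).ne'
  set x : ℝ := inner ℝ k v / ‖k‖ with hx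
  set F := gaussLaplace β (x : ℂ) with hF
  set Z := plasmaZ β (x : ℂ) with hZ
  set E : ℂ := 1 + ((β * Vhat V n : ℝ) : ℂ) * Z with hE
  -- The arguments for k and -k are -x and x. The values of F, Z and the dispersion function for k
  -- are thus the conjugates of those for -k.
  have hp : plasmaArg 0 k v = -(x : ℂ) := plasmaArg_zero k v
  have hp' : plasmaArg 0 (-k) v = (x : ℂ) := by
    rw [plasmaArg_zero, inner_neg_left, norm_neg, neg_div, Complex.ofReal_neg, neg_neg]
  have hd1 : dispersion β V 0 n v = starRingEnd ℂ E := by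
    rw [dispersion, ← hk, hp, plasmaZ_neg_ofReal, hE, map_add, map_mul, map_one,
      Complex.conj_ofReal]
  have hd2 : dispersion β V 0 (-n) v = E := by
    rw [dispersion, waveVec_neg, ← hk, hp', Vhat_neg]
  have hE0 : E ≠ 0 := hd2 ▸ dispersion_ne_zero hβ hW hV (by simp) (-n) v
  have hE1 : starRingEnd ℂ E ≠ 0 := (map_ne_zero _).2 hE0
  have key := add_conj_div_eq (F := F) (Z := Z) (E := E) (c := β * Vhat V n) (x := x) rfl hE hE0
    (cdot k (a v) / ‖k‖) (β * b v)
  have hkv : ((inner ℝ k v : ℝ) : ℂ) = x * ‖k‖ := by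
    rw [hx]; push_cast; field_simp
  have e1 : density β V a b 0 n v - b v = Complex.I * (Vhat V n : ℝ) *
      ((cdot k (a v) / ‖k‖ * starRingEnd ℂ F + Complex.I * (β * b v) * starRingEnd ℂ Z) /
        starRingEnd ℂ E) := by
    rw [density, hd1, ← hk, hp, gaussLaplace_neg_ofReal, div_sub' hE1,
      ← mul_div_assoc (Complex.I * (Vhat V n : ℝ))]
    congr 1
    rw [hE, map_add, map_mul, map_one, Complex.conj_ofReal]
    push_cast
    linear_combination (-(Vhat V n : ℂ) * β * b v * starRingEnd ℂ Z) * Complex.I_sq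
  have e2 : density β V a b 0 (-n) v - b v = -(Complex.I * (Vhat V n : ℝ)) *
      ((cdot k (a v) / ‖k‖ * F - Complex.I * (β * b v) * Z) / E) := by
    rw [density, hd2, waveVec_neg, ← hk, hp', Vhat_neg, cdot_neg_left, norm_neg, div_sub' hE0,
      ← mul_div_assoc (-(Complex.I * (Vhat V n : ℝ)))]
    congr 1
    rw [hE]
    push_cast
    linear_combination (-(Vhat V n : ℂ) * β * b v * Z) * Complex.I_sq
  have hcd : cdot k (a v + (β * b v) • toC v) = cdot k (a v) + β * b v * (x * ‖k‖) := by
    rw [← hkv, ← cdot_toC, cdot, cdot, cdot, inner_add_right, inner_smul_right]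
  have htoC : toC (-k) = -toC k := by ext i; simp [toC]
  rw [fluxTerm, fluxTerm, e1, e2, waveVec_neg, ← hk, htoC, Vhat_neg, smul_neg, ← sub_eq_add_neg,
    ← sub_smul, smul_smul, hcd, kernelCoef_eq hβ hN v hn, ← hk, ← hx, ← hF, ← hZ, ← hE]
  congr 1
  have e3 : ((Vhat V n ^ 2 * (F.re / ‖k‖) / ‖E‖ ^ 2 : ℝ) : ℂ) =
      (Vhat V n : ℂ) ^ 2 / ‖k‖ * ((F.re / ‖E‖ ^ 2 : ℝ) : ℂ) := by
    push_cast
    field_simp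
  rw [e3]
  generalize ((F.re / ‖E‖ ^ 2 : ℝ) : ℂ) = P at *
  generalize (cdot k (a v) / ‖k‖ * starRingEnd ℂ F + Complex.I * (β * b v) * starRingEnd ℂ Z) /
        starRingEnd ℂ E = A at *
  generalize (cdot k (a v) / ‖k‖ * F - Complex.I * (β * b v) * Z) / E = B at *
  have e4 : cdot k (a v) = cdot k (a v) / ‖k‖ * ‖k‖ := (div_mul_cancel₀ _ hkn).symm
  rw [e4]
  generalize cdot k (a v) / ‖k‖ = S at *
  have e5 : (Vhat V n : ℂ) ^ 2 / ‖k‖ * P * (S * ‖k‖ + β * b v * (x * ‖k‖) +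
      ((β * Vhat V n : ℝ) : ℂ) * (S * ‖k‖)) =
      (Vhat V n : ℂ) ^ 2 * P * ((1 + ((β * Vhat V n : ℝ) : ℂ)) * S + x * (β * b v)) := by
    field_simp
    ring
  rw [e5]
  linear_combination (Vhat V n : ℂ) ^ 2 * key - (Vhat V n : ℂ) ^ 2 * (A + B) * Complex.I_sq

lemma applyMat_smul_vecMulVec (t : ℝ) (k : Vel d) (w : CVec d) :
    applyMat (t • Matrix.vecMulVec k.ofLp k.ofLp) w = ((t : ℂ) * cdot k w) • toC k := by
  ext i
  simp only [applyMat, Matrix.mulVec, dotProduct, Matrix.map_apply, Matrix.smul_apply,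
    Matrix.vecMulVec_apply, smul_eq_mul, cdot_eq_sum, PiLp.smul_apply, toC, Finset.mul_sum,
    Finset.sum_mul]
  refine Finset.sum_congr rfl fun j _ => ?_
  push_cast
  ring

lemma continuous_applyMat (w : CVec d) : Continuous fun A : Matrix (Fin d) (Fin d) ℝ =>
    applyMat A w := by
  unfold applyMat Matrix.mulVec dotProduct
  refine (PiLp.continuous_toLp 2 _).comp (continuous_pi fun i => ?_)
  refine continuous_finsetSum _ fun j _ => Continuous.mul ?_ continuous_const
  exact Complex.continuous_ofReal.comp ((continuous_apply j).comp (continuous_apply i))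

/-- `applyMat` as an additive map of the matrix. -/
def applyMatHom (w : CVec d) : Matrix (Fin d) (Fin d) ℝ →+ CVec d where
  toFun A := applyMat A w
  map_zero' := by ext i; simp [applyMat]
  map_add' A B := by
    ext i
    simp [applyMat, Matrix.mulVec, dotProduct, add_mul, Finset.sum_add_distrib]

lemma exists_abs_kernelCoef_le (hβ : 0 < β) (hW : IsW1Infty V W K) (hV : PosDefPotential V)
    {N : ℕ} (hN : 1 ≤ N) : ∃ C : ℝ, 0 ≤ C ∧ ∀ (v : Vel d) (n : Fin d → ℤ), waveVec n ≠ 0 →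
      |kernelCoef β V N v n| ≤ C * Vhat V n ^ 2 := by
  obtain ⟨δ, hδ, hd⟩ := exists_lower_bound_dispersion hβ (β * K)
  have hg := gaussMoment_nonneg β 0
  refine ⟨gaussMoment β 0 / δ ^ 2, by positivity, fun v n hn => ?_⟩
  rw [kernelCoef_eq hβ hN v hn]
  set x : ℝ := inner ℝ (waveVec n) v / ‖waveVec n‖
  have h1 := hd (β * Vhat V n) (mul_nonneg hβ.le (hV n).1)
    (mul_le_mul_of_nonneg_left (Vhat_le hW n) hβ.le) (x : ℂ) (by simp)
  have h2 : |(gaussLaplace β (x : ℂ)).re| ≤ gaussMoment β 0 :=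
    (Complex.abs_re_le_norm _).trans (norm_gaussLaplace_le hβ (by simp))
  have hk := one_le_norm_waveVec hn
  rw [abs_div, abs_mul, abs_div, abs_norm, abs_of_nonneg (sq_nonneg (Vhat V n)),
    abs_of_nonneg (sq_nonneg ‖_‖)]
  calc _ ≤ Vhat V n ^ 2 * (gaussMoment β 0 / 1) / δ ^ 2 := by gcongr
    _ = _ := by ring

lemma summable_kernel (hβ : 0 < β) (hW : IsW1Infty V W K) (hV : PosDefPotential V)
    {N : ℕ} (hN : 1 ≤ N) (v : Vel d) {c : (Fin d → ℤ) → ℝ} {B : ℝ} (hc : ∀ n, |c n| ≤ B) :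
    Summable fun n : Fin d → ℤ => (c n * kernelCoef β V N v n) •
      Matrix.vecMulVec (waveVec n).ofLp (waveVec n).ofLp := by
  obtain ⟨C, hC0, hC⟩ := exists_abs_kernelCoef_le hβ hW hV hN
  have hB : 0 ≤ B := (abs_nonneg _).trans (hc 0)
  refine Pi.summable.2 fun i => Pi.summable.2 fun j => ?_
  refine ((summable_sq_waveVec_mul_Vhat hW hV).1.mul_left (B * C)).of_norm_bounded fun n => ?_
  by_cases hn : waveVec n = 0
  · simp [hn]
  have h1 := PiLp.norm_apply_le (waveVec n) i
  have h2 := PiLp.norm_apply_le (waveVec n) j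
  change ‖(c n * kernelCoef β V N v n) * (waveVec n i * waveVec n j)‖ ≤ _
  rw [norm_mul, norm_mul, norm_mul]
  calc _ ≤ B * (C * Vhat V n ^ 2) * (‖waveVec n‖ * ‖waveVec n‖) := by
        gcongr
        · exact hc n
        · exact hC v n hn
    _ = _ := by ring

lemma abs_beta_mul_Vhat_le (hβ : 0 < β) (hW : IsW1Infty V W K) (hV : PosDefPotential V)
    (n : Fin d → ℤ) : |β * Vhat V n| ≤ β * K := by
  have h0 : 0 ≤ Vhat V n := (hV n).1
  rw [abs_of_nonneg (mul_nonneg hβ.le h0)]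
  exact mul_le_mul_of_nonneg_left (Vhat_le hW n) hβ.le

lemma hasSum_applyMat_kernelSum (hβ : 0 < β) (hW : IsW1Infty V W K) (hV : PosDefPotential V)
    {N : ℕ} (hN : 1 ≤ N) (v : Vel d) {c : (Fin d → ℤ) → ℝ} {B : ℝ} (hc : ∀ n, |c n| ≤ B)
    (w : CVec d) :
    HasSum (fun n => (((c n * kernelCoef β V N v n : ℝ) : ℂ) * cdot (waveVec n) w) •
      toC (waveVec n)) (applyMat (kernelSum β V N c v) w) := by
  have h := (summable_kernel hβ hW hV hN v hc).hasSum.map (applyMatHom w) (continuous_applyMat w)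
  refine h.congr_fun fun n => ?_
  exact (applyMat_smul_vecMulVec _ _ _).symm

end Limit

/-! ### Identification of the limit, and divergences in the dual space -/

section LimitFlux

variable {d : ℕ} {β : ℝ} {hβ : 0 < β} {V : Torus d → ℝ} {W : Torus d → Vel d} {K : ℝ≥0}

/-- Adding the series of the flux to its reflection k ↦ -k yields twice the asserted kernels, by
`fluxTerm_add_neg`. The gradient reappears through (∇ - βv)g + βvg = ∇g. -/
lemma limitFlux_eq_flux (g : H1 d hβ) (hW : IsW1Infty V W K) (hV : PosDefPotential V) {N : ℕ}
    (hN : 1 ≤ N) : limitFlux V N g = flux β V (gradStar g) (val g) 0 := by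
  funext v
  have h1 := hasSum_applyMat_kernelSum hβ hW hV hN v (c := fun _ => 1) (B := 1) (by simp)
    (grad g v)
  have h2 := hasSum_applyMat_kernelSum hβ hW hV hN v (abs_beta_mul_Vhat_le hβ hW hV)
    (gradStar g v)
  have hL := (h1.add h2).const_smul (2 : ℂ)
  have hf := (summable_fluxTerm (a := gradStar g) (b := val g) (ω := 0) hβ hW hV
    (by simp) v).hasSum
  have hf' := (Equiv.neg (Fin d → ℤ)).hasSum_iff.2 hf
  have hgs : grad g v = gradStar g v + ((β : ℂ) * val g v) • toC v := by
    rw [gradStar, sub_add_cancel]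
  have h3 := (hf.add hf').unique (hL.congr_fun fun n => ?_)
  · rw [← two_smul ℂ] at h3
    exact ((smul_right_injective _ (two_ne_zero (α := ℂ))) h3).symm
  · have h4 := fluxTerm_add_neg (a := gradStar g) (b := val g) hβ hW hV hN v n
    simp only [Function.comp_apply, Equiv.neg_apply]
    rw [h4, ← hgs, ← add_smul]
    congr 2
    push_cast
    ring

/-- The functional `(∇_v - βv) · F`. -/
def divFunctional (hβ : 0 < β) (F : Lp (CVec d) 2 (maxwell d β)) : Hneg1 d hβ :=
  -((innerSLFlip ℂ F).comp ((WithLp.sndL 2 ℂ (Lp ℂ 2 (maxwell d β))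
    (Lp (CVec d) 2 (maxwell d β))).comp (H1 d hβ).subtypeL))

lemma divFunctional_apply {F : Vel d → CVec d} (hF : MemLp F 2 (maxwell d β)) (φ : H1 d hβ) :
    divFunctional hβ (hF.toLp F) φ = divPairing F φ := by
  have e : divFunctional hβ (hF.toLp F) φ = -inner ℂ (WithLp.snd φ.val) (hF.toLp F) := rfl
  rw [e, divPairing, L2.inner_def]
  congr 1
  refine integral_congr_ae ?_
  filter_upwards [hF.coeFn_toLp] with v hv
  rw [hv]
  rfl

/-- The H¹_β norm dominates the L²_β norm of the gradient, so the divergence is 1-Lipschitz from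
L²_β to H⁻¹_β. -/
lemma dist_divFunctional_le (F G : Lp (CVec d) 2 (maxwell d β)) :
    dist (divFunctional hβ F) (divFunctional hβ G) ≤ ‖F - G‖ := by
  refine (dist_eq_norm (divFunctional hβ F) (divFunctional hβ G)).trans_le ?_
  refine ContinuousLinearMap.opNorm_le_bound _ (norm_nonneg _) fun φ => ?_
  have e : (divFunctional hβ F - divFunctional hβ G) φ = -inner ℂ (WithLp.snd φ.val) (F - G) := by
    rw [inner_sub_right, neg_sub]
    have e1 : (divFunctional hβ F - divFunctional hβ G) φ =
      -inner ℂ (WithLp.snd φ.val) F - -inner ℂ (WithLp.snd φ.val) G := rfl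
    rw [e1]
    ring
  rw [e, norm_neg, mul_comm]
  refine (norm_inner_le_norm _ _).trans (mul_le_mul_of_nonneg_right ?_ (norm_nonneg _))
  have h := WithLp.prod_norm_sq_eq_of_L2 φ.val
  have h2 : ‖WithLp.snd φ.val‖ ^ 2 ≤ ‖φ.val‖ ^ 2 := by
    rw [h]
    exact le_add_of_nonneg_left (sq_nonneg _)
  exact (pow_le_pow_iff_left₀ (norm_nonneg _) (norm_nonneg _) two_ne_zero).1 h2

lemma norm_toLp_sq {F : Vel d → CVec d} (hF : MemLp F 2 (maxwell d β)) :
    ‖hF.toLp F‖ ^ 2 = ∫ v, ‖F v‖ ^ 2 ∂(maxwell d β) := by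
  rw [← inner_self_eq_norm_sq (𝕜 := ℂ), L2.inner_def, ← integral_re (L2.integrable_inner _ _)]
  refine integral_congr_ae ?_
  filter_upwards [hF.coeFn_toLp] with v hv
  rw [hv, inner_self_eq_norm_sq]

end LimitFlux

end LenardBalescu
end

/-! ### Convergence in the dual space and conclusion -/

noncomputable section

namespace LenardBalescu

section Final

variable {d : ℕ} {β : ℝ} {hβ : 0 < β} {V : Torus d → ℝ} {W : Torus d → Vel d} {K : ℝ≥0}

lemma norm_add_norm_le_bracket (g : H1 d hβ) (v : Vel d) :
    ‖gradStar g v‖ + ‖val g v‖ ≤ 2 * bracket g v := by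
  have h1 : ‖val g v‖ ≤ bracket g v :=
    Real.le_sqrt_of_sq_le (le_add_of_nonneg_right (sq_nonneg _))
  have h2 : ‖gradStar g v‖ ≤ bracket g v :=
    Real.le_sqrt_of_sq_le (le_add_of_nonneg_left (sq_nonneg _))
  linarith

open Classical in
/-- The resolvent, extended by zero outside the upper half-plane. -/
def resolventExt (g : H1 d hβ) (hW : IsW1Infty V W K) (hV : PosDefPotential V) (ω : ℂ) :
    L2Phase2 d β :=
  if hω : 0 < ω.im then resolventSol g hW hV hω else 0

open Classical in
/-- The divergence of the flux, extended by zero outside the closed upper half-plane. -/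
def divFlux (g : H1 d hβ) (hW : IsW1Infty V W K) (hV : PosDefPotential V) (ω : ℂ) : Hneg1 d hβ :=
  if hω : 0 ≤ ω.im then
    divFunctional hβ ((memLp_flux hβ hW hV hω (memLp_gradStar g) (memLp_val g)).toLp _)
  else 0

lemma divFlux_apply (g : H1 d hβ) (hW : IsW1Infty V W K) (hV : PosDefPotential V) {ω : ℂ}
    (hω : 0 ≤ ω.im) (φ : H1 d hβ) :
    divFlux g hW hV ω φ = divPairing (flux β V (gradStar g) (val g) ω) φ := by
  rw [divFlux, dif_pos hω, divFunctional_apply]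

lemma dist_divFlux_le (g : H1 d hβ) (hW : IsW1Infty V W K) (hV : PosDefPotential V) {ω : ℂ}
    (hω : 0 ≤ ω.im) :
    dist (divFlux g hW hV ω) (divFlux g hW hV 0) ≤
      √(∫ v, ‖flux β V (gradStar g) (val g) ω v - flux β V (gradStar g) (val g) 0 v‖ ^ 2
        ∂(maxwell d β)) := by
  have h0 : (0 : ℝ) ≤ (0 : ℂ).im := by simp
  have m1 := memLp_flux hβ hW hV hω (memLp_gradStar g) (memLp_val g)
  have m0 := memLp_flux hβ hW hV h0 (memLp_gradStar g) (memLp_val g)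
  rw [divFlux, divFlux, dif_pos hω, dif_pos h0]
  refine (dist_divFunctional_le _ _).trans (Real.le_sqrt_of_sq_le ?_)
  rw [← MemLp.toLp_sub, norm_toLp_sq]
  rfl

/-- Convergence of the fluxes in `H⁻¹_β(ℝ^d)`. -/
lemma tendsto_divFlux (g : H1 d hβ) (hW : IsW1Infty V W K) (hV : PosDefPotential V) :
    Tendsto (fun ω => dist (divFlux g hW hV ω) (divFlux g hW hV 0)) (𝓝[{ω : ℂ | 0 < ω.im}] 0)
      (𝓝 0) := by
  have h := (Real.continuous_sqrt.tendsto 0).comp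
    (tendsto_integral_sq_flux_sub hβ hW hV (memLp_gradStar g) (memLp_val g))
  rw [Real.sqrt_zero] at h
  refine squeeze_zero' (Eventually.of_forall fun ω => dist_nonneg) ?_ h
  filter_upwards [self_mem_nhdsWithin] with ω hω
  exact dist_divFlux_le g hW hV (le_of_lt hω)

end Final

end LenardBalescu
end

open LenardBalescu
theorem proposition5p4 (d : ℕ) (hd : 1 ≤ d) (β : ℝ) (hβ : 0 < β) (K : ℝ≥0) :
    ∃ C : ℝ, ∀ (V : Torus d → ℝ) (W : Torus d → Vel d),
      IsW1Infty V W K → PosDefPotential V →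
      -- the boundary values of the dispersion function exist and do not vanish,
      -- and the sums over `k` converge
      (∀ (N : ℕ), 1 ≤ N → ∀ v : Vel d,
        (∀ n : Fin d → ℤ,
          Tendsto (fun η : ℝ => eps β V N 1 n
              (((inner ℝ (waveVec n) v : ℝ) : ℂ) + (η : ℂ) * Complex.I))
            (𝓝[>] (0 : ℝ))
            (𝓝 (epsPlus β V N 1 n (inner ℝ (waveVec n) v))) ∧
          epsPlus β V N 1 n (inner ℝ (waveVec n) v) ≠ 0) ∧
        (Summable fun n : Fin d → ℤ => kernelCoef β V N v n •
          Matrix.vecMulVec (waveVec n).ofLp (waveVec n).ofLp) ∧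
        (Summable fun n : Fin d → ℤ =>
          (β * Vhat V n * kernelCoef β V N v n) •
          Matrix.vecMulVec (waveVec n).ofLp (waveVec n).ofLp)) ∧
      ∀ g : H1 d hβ,
        ∃ (R : ℕ → ℂ → L2Phase2 d β) (T : ℕ → ℂ → Hneg1 d hβ)
          (T₀ : ℕ → Hneg1 d hβ),
          (∀ (N : ℕ), 1 ≤ N → ∀ ω : ℂ, 0 < ω.im →
            -- `R N ω` is the resolvent `(i L₂ - i ω)⁻¹` applied to `S₁² g`
            SolvesResolvent N W ω (S12 W g) (R N ω) ∧
            (∀ H : L2Phase2 d β,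
              SolvesResolvent N W ω (S12 W g) H → H = R N ω) ∧
            -- `T N ω` is the space average of `M₂¹ (i L₂ - i ω)⁻¹ S₁² g`
            (∀ φ : H1 d hβ,
              T N ω φ = avgM21Pairing N W (R N ω) φ) ∧
            -- it has the form `(∇_v - βv) · G` with `G` dominated pointwise
            ∃ G : Vel d → CVec d,
              MemLp G 2 (maxwell d β) ∧
              (∀ φ : H1 d hβ, T N ω φ = divPairing G φ) ∧
              ∀ᵐ v, ‖G v‖ ≤ C * bracket g v) ∧
          -- `T₀ N` is the asserted limit
          (∀ (N : ℕ), 1 ≤ N →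
            MemLp (limitFlux V N g) 2 (maxwell d β) ∧
            ∀ φ : H1 d hβ,
              T₀ N φ = divPairing (limitFlux V N g) φ) ∧
          -- convergence in `H⁻¹_β(ℝ^d)`, uniformly in `N ≥ 1`
          TendstoUniformlyOn (fun (ω : ℂ) (N : ℕ) => T N ω) T₀ (𝓝[{ω : ℂ | 0 < ω.im}] 0)
            {N : ℕ | 1 ≤ N} := by
  obtain ⟨C, hC0, hC⟩ := exists_norm_flux_le d hβ K
  -- The factor 2 passes from |(∇ - βv)g| + |g| to the bracket.
  refine ⟨C * 2, fun V W hW hV => ⟨fun N hN v => ⟨fun n =>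
    tendsto_epsPlus_and_ne_zero hβ hV hN n _, ?_, ?_⟩, fun g => ?_⟩⟩
  · simpa using summable_kernel hβ hW hV hN v (c := fun _ => 1) (B := 1) (by simp)
  · exact summable_kernel hβ hW hV hN v (abs_beta_mul_Vhat_le hβ hW hV)
  -- None of the three families depends on N, so uniformity in N is immediate. The limit is the
  -- divergence of the flux at ω = 0, on the boundary of the half-plane.
  refine ⟨fun _ ω => resolventExt g hW hV ω, fun _ ω => divFlux g hW hV ω,
    fun _ => divFlux g hW hV 0, fun N hN ω hω => ?_, fun N hN => ?_, ?_⟩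
  · have hs : SolvesResolvent N W ω (S12 W g) (resolventExt g hW hV ω) := by
      rw [resolventExt, dif_pos hω]
      exact solvesResolvent_resolventSol g hW hV hω hN
    refine ⟨hs, fun H hH => hH.unique hβ hW hV hN hω hs, fun φ => ?_,
      flux β V (gradStar g) (val g) ω,
      memLp_flux hβ hW hV hω.le (memLp_gradStar g) (memLp_val g),
      divFlux_apply g hW hV hω.le, ae_of_all _ fun v => ?_⟩
    · have e : resolventExt g hW hV ω = resolventSol g hW hV hω := dif_pos hω
      change divFlux g hW hV ω φ = avgM21Pairing N W (resolventExt g hW hV ω) φ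
      rw [e, divFlux_apply g hW hV hω.le, avgM21Pairing_resolventSol g hW hV hω hN]
    · refine (hC V W hW hV _ _ ω hω.le v).trans ?_
      rw [mul_assoc]
      exact mul_le_mul_of_nonneg_left (norm_add_norm_le_bracket g v) hC0
  · rw [limitFlux_eq_flux g hW hV hN]
    exact ⟨memLp_flux hβ hW hV (by simp) (memLp_gradStar g) (memLp_val g),
      divFlux_apply g hW hV (by simp)⟩
  · refine (Metric.tendstoUniformlyOn_iff (α := Hneg1 d hβ) (β := ℕ)).2 fun ε hε => ?_
    filter_upwards [(tendsto_divFlux g hW hV).eventually_lt_const hε] with ω hω N _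
    rwa [dist_comm]
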